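/- Let $\beta_1,\beta_2,\delta_1,\delta_2\ge 0$ and $\alpha_1,\alpha_2,\gamma_1,\gamma_2>0$ be real numbers with $\beta_1+\delta_1>0$ and $\beta_2+\delta_2>0$, and let $\sigma\in\mathbb C$ with $|\sigma|<1$. For $j=1,2$ let $$W_j(z)=z\,\Gamma(\alpha_j)\Gamma(\gamma_j)\sum_{n=0}^{\infty}\frac{z^n}{\Gamma(\alpha_j+n\beta_j)\Gamma(\gamma_j+n\delta_j)}$$ be the normalized four-parameter Wright function (an entire function). Let $D$ be the open unit disk. Let $S_H$ be the class of functions $f=h+\overline g$ on $D$, with $h,g$ analytic in $D$, $h(0)=g(0)=0$, $h'(0)=1$, $|g'(0)|<1$, that are sense-preserving ($|h'|>|g'|$ in $D$) and univalent in $D$; let $K_{H^o}$ be the class of those $f\in S_H$ with $g'(0)=0$ for which $f(D)$ is convex; and let $C_H$ be the class of those $f\in S_H$ for which $f(D)$ is close-to-convex, i.e. $\mathbb C\setminus f(D)$ is a union of closed half-lines that do not cross (any two distinct ones have disjoint interiors; the endpoint of one may lie on another). Let $f=h+\overline g\in K_{H^o}$, with $h(z)=z+\sum_{n\ge2}A_nz^n$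 and $g(z)=\sum_{n\ge1}B_nz^n$ (so $B_1=0$), and put $$H(z)=(h*W_1)(z)=z+\sum_{n=2}^\infty\frac{\Gamma(\alpha_1)\Gamma(\gamma_1)A_n z^n}{\Gamma(\alpha_1+(n-1)\beta_1)\Gamma(\gamma_1+(n-1)\delta_1)},$$ $$G(z)=(g*W_2)(z)=\sum_{n=1}^\infty\frac{\Gamma(\alpha_2)\Gamma(\gamma_2)B_n z^n}{\Gamma(\alpha_2+(n-1)\beta_2)\Gamma(\gamma_2+(n-1)\delta_2)},$$ where $*$ denotes the Hadamard product (convolution) of power series, and $L(f)=H+\overline{\sigma G}$. If $$W_1''(1)+2W_1'(1)+W_2''(1)\le 4,$$ then $L(f)\in C_H$, and also $H+\overline G\in C_H$. -/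

import Mathlib

/-- The open unit disk of the complex plane. -/
def unitDisk : Set ℂ := Metric.ball 0 1

/-- `f = h + conj g` on the unit disk, where `h` and `g` are analytic there, with the normalization
`h 0 = 0`, `h' 0 = 1`, `g 0 = 0`, `|g' 0| < 1`. The pair `(h, g)` is determined by `f` on the disk. -/
structure IsCanonicalRep (f h g : ℂ → ℂ) : Prop where
  analytic_h : DifferentiableOn ℂ h unitDisk
  analytic_g : DifferentiableOn ℂ g unitDisk
  h_zero : h 0 = 0
  deriv_h_zero : deriv h 0 = 1
  g_zero : g 0 = 0
  deriv_g_zero : ‖deriv g 0‖ < 1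
  eq_on_disk : ∀ z ∈ unitDisk, f z = h z + (starRingEnd ℂ) (g z)

/-- The class `S_H`: normalized harmonic mappings `f = h + conj g` of the unit disk which are
sense-preserving (`|h'| > |g'|`, i.e. positive Jacobian) and univalent. -/
def classSH : Set (ℂ → ℂ) :=
  {f | ∃ h g : ℂ → ℂ, IsCanonicalRep f h g ∧
    (∀ z ∈ unitDisk, ‖deriv g z‖ < ‖deriv h z‖) ∧ Set.InjOn f unitDisk}

/-- The class `S_{H^o}`: the members of `S_H` whose co-analytic part satisfies `g' 0 = 0`. -/
def classSHo : Set (ℂ → ℂ) :=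
  {f | f ∈ classSH ∧ ∃ h g : ℂ → ℂ, IsCanonicalRep f h g ∧ deriv g 0 = 0}

/-- The class `K_{H^o}` of harmonic convex mappings: the members of `S_{H^o}` that map the unit disk
onto a convex domain. -/
def classKHo : Set (ℂ → ℂ) :=
  {f | f ∈ classSHo ∧ Convex ℝ (f '' unitDisk)}

/-- The closed half-line with endpoint `p` and direction `u`. -/
def closedHalfLine (p u : ℂ) : Set ℂ := {w | ∃ t : ℝ, 0 ≤ t ∧ w = p + t * u}

/-- The half-line with endpoint `p` and direction `u`, without its endpoint. -/
def openHalfLine (p u : ℂ) : Set ℂ := {w | ∃ t : ℝ, 0 < t ∧ w = p + t * u}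

/-- A close-to-convex set: its complement is a union of pairwise non-crossing closed half-lines
(half-lines with disjoint interiors: the endpoint of one may lie on another). A half-line is given by
its endpoint and its unit direction, so that distinct pairs are distinct half-lines. -/
def IsCloseToConvexSet (Ω : Set ℂ) : Prop :=
  ∃ R : Set (ℂ × ℂ), (∀ r ∈ R, ‖r.2‖ = 1) ∧
    (R.Pairwise fun r s => Disjoint (openHalfLine r.1 r.2) (openHalfLine s.1 s.2)) ∧
    Ωᶜ = ⋃ r ∈ R, closedHalfLine r.1 r.2

/-- The class `C_H` of harmonic close-to-convex mappings: the members of `S_H` that map the unit disk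
onto a close-to-convex domain. -/
def classCH : Set (ℂ → ℂ) :=
  {f | f ∈ classSH ∧ IsCloseToConvexSet (f '' unitDisk)}

/-- The four-parameter Wright function `∑ zⁿ / (Γ(α + nβ) Γ(γ + nδ))`. For `α, γ > 0` and
`β, δ ≥ 0` with `β + δ > 0` the series converges for every complex `z`. -/
noncomputable def wrightFun (α β γ δ : ℝ) (z : ℂ) : ℂ :=
  ∑' n : ℕ, z ^ n / ((Real.Gamma (α + n * β) : ℂ) * (Real.Gamma (γ + n * δ) : ℂ))

/-- The normalized four-parameter Wright function `z Γ(α) Γ(γ) ∑ zⁿ / (Γ(α + nβ) Γ(γ + nδ))`. -/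
noncomputable def normWright (α β γ δ : ℝ) (z : ℂ) : ℂ :=
  z * (Real.Gamma α : ℂ) * (Real.Gamma γ : ℂ) * wrightFun α β γ δ z

/-- The `n`-th Taylor coefficient at the origin. -/
noncomputable def taylorCoeff (φ : ℂ → ℂ) (n : ℕ) : ℂ := iteratedDeriv n φ 0 / (n.factorial : ℂ)

/-- The convolution (Hadamard product) of two functions analytic at the origin. -/
noncomputable def hadamardProd (φ ψ : ℂ → ℂ) (z : ℂ) : ℂ :=
  ∑' n : ℕ, taylorCoeff φ n * taylorCoeff ψ n * z ^ n

/-- The convolution of `h + conj g` with `Φ + conj (σ Ψ)`, namely `h * Φ + conj (σ (g * Ψ))`. -/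
noncomputable def convOperator (Φ Ψ : ℂ → ℂ) (σ : ℂ) (h g : ℂ → ℂ) (z : ℂ) : ℂ :=
  hadamardProd h Φ z + (starRingEnd ℂ) (σ * hadamardProd g Ψ z)

/-! The proof joins a sharp coefficient estimate for convex harmonic maps to a simple sufficient
condition for close-to-convexity.

The sufficient condition (`mem_classCH_of_tsum_le_one`): if Σ n(|a_n| + |b_n|) ≤ 1, the map is z +
P(z) with P nonexpansive on the closed disk, strictly so when one point is interior. It is then
univalent, and the outward normals of the unit circle, carried to the points e + P(e), sweep out the
complement of the image without crossing (`isCloseToConvexSet_image_add`).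

The estimate: |A_n| ≤ (n+1)/2 and |B_n| ≤ (n-1)/2. With it, the sum for H and G is at most half of
W₁''(1) + 2(W₁'(1) - 1) + W₂''(1), which the hypothesis bounds by 1
(`hadamardProd_add_conj_mem_classCH`). A factor of modulus at most 1 before G does no harm, so both
conclusions follow at once.

The estimate rests on one inequality: there are unimodular a, b with Re[(a h' + ā g')(b - b̄ z²)] ≥
0 on the disk. It gives |Φ_n| ≤ n + 1 for Φ = a h' + ā g' by Carathéodory's bound. Since |g'| <
|h'|, the quotient (a h' - ā g')/Φ has positive real part, and multiplying the two series gives the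
bounds (`norm_taylorCoeff_le_of_re_mul_add_mul_nonneg`).

For a map extending to a strictly convex boundary curve, the inequality is geometric. Some height
function of the curve is monotone on the two half circles between -b and b
(`exists_unit_height_le`). The hyperbolic automorphisms fixing ±b move the circle towards b and so
raise the height there, hence also inside the disk by the maximum principle. Differentiating at time
0 gives the inequality (`re_deriv_mul_nonneg_of_height_le`).

A general f has no boundary regularity. Compact convex parts of its range are therefore enclosed in
sublevel sets {F < c} of strongly convex functions, and f is composed with a Riemann map φ of the
preimage. Harnack estimates show that f ∘ φ is bi-Lipschitz (`IsLevelMap.bilipschitz`), so it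
extends injectively to the closed disk. As the sublevel sets exhaust the range, φ tends to the
identity, and the inequality survives by compactness of the pairs (a, b). -/

open Filter Topology

/-! ### Nonexpansive perturbations of the identity and close-to-convex images -/

/-- The nearest-point projection of the plane onto the closed unit disk. -/
noncomputable def diskProj (z : ℂ) : ℂ := ((max 1 ‖z‖ : ℝ)⁻¹ : ℝ) * z

theorem norm_diskProj_le (z : ℂ) : ‖diskProj z‖ ≤ 1 := by
  have h : 0 < max 1 ‖z‖ := lt_max_of_lt_left one_pos
  rw [diskProj, norm_mul, Complex.norm_real, Real.norm_of_nonneg (by positivity),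
    inv_mul_le_iff₀ h, mul_one]
  exact le_max_right _ _

theorem diskProj_of_norm_le {z : ℂ} (hz : ‖z‖ ≤ 1) : diskProj z = z := by
  simp [diskProj, max_eq_left hz]

theorem diskProj_mul_of_norm_eq {e : ℂ} (he : ‖e‖ = 1) {s : ℝ} (hs : 1 ≤ s) :
    diskProj (s * e) = e := by
  have h0 : (s : ℂ) ≠ 0 := by exact_mod_cast (by linarith : s ≠ 0)
  have : ‖(s : ℂ) * e‖ = s := by
    rw [norm_mul, he, Complex.norm_real, Real.norm_of_nonneg (by linarith), mul_one]
  rw [diskProj, this, max_eq_right hs]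
  push_cast
  field_simp

theorem norm_mul_sub_mul_sq (p q : ℂ) (s t : ℝ) :
    ‖(s : ℂ) * p - t * q‖ ^ 2
      = s ^ 2 * ‖p‖ ^ 2 + t ^ 2 * ‖q‖ ^ 2 - 2 * (s * t) * (p.re * q.re + p.im * q.im) := by
  simp only [Complex.sq_norm, Complex.normSq_apply, Complex.sub_re, Complex.sub_im, Complex.mul_re,
    Complex.mul_im, Complex.ofReal_re, Complex.ofReal_im]
  ring

theorem re_mul_add_im_mul_le (p q : ℂ) : p.re * q.re + p.im * q.im ≤ ‖p‖ * ‖q‖ := by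
  have := Complex.re_le_norm (p * (starRingEnd ℂ) q)
  rw [norm_mul, RCLike.norm_conj] at this
  simpa using this

/-- For unimodular p, q one has |sp - tq|² = (s - t)² + st|p - q|². This keeps rays along distinct
outward normals apart. -/
theorem norm_sub_lt_norm_mul_sub_mul {p q : ℂ} (hp : ‖p‖ = 1) (hq : ‖q‖ = 1) (hpq : p ≠ q)
    {s t : ℝ} (hs : 1 < s) (ht : 1 < t) : ‖p - q‖ < ‖(s : ℂ) * p - t * q‖ := by
  apply lt_of_pow_lt_pow_left₀ 2 (norm_nonneg _)
  have h1 := norm_mul_sub_mul_sq p q s t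
  have h2 := norm_mul_sub_mul_sq p q 1 1
  have h4 : 0 < ‖p - q‖ ^ 2 := by have := sub_ne_zero.2 hpq; positivity
  simp only [Complex.ofReal_one, one_mul, hp, hq] at h1 h2
  nlinarith [sq_nonneg (s - t), mul_pos (sub_pos.2 hs) (sub_pos.2 ht)]

/-- Since Re(z ē) ≤ 1 ≤ s, the function s ↦ |z - se|² is nondecreasing. -/
theorem norm_sub_le_norm_sub_mul {z e : ℂ} (he : ‖e‖ = 1) (hz : ‖z‖ ≤ 1)
    {s : ℝ} (hs : 1 ≤ s) : ‖z - e‖ ≤ ‖z - s * e‖ := by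
  apply le_of_sq_le_sq _ (norm_nonneg _)
  have h1 := norm_mul_sub_mul_sq z e 1 s
  have h2 := norm_mul_sub_mul_sq z e 1 1
  have h3 := re_mul_add_im_mul_le z e
  simp only [Complex.ofReal_one, one_mul, he] at h1 h2 h3
  nlinarith

theorem norm_diskProj_sub_le (z w : ℂ) : ‖diskProj z - diskProj w‖ ≤ ‖z - w‖ := by
  have key : ∀ u : ℂ, 1 < ‖u‖ → ∃ s : ℝ, ∃ e : ℂ, 1 < s ∧ ‖e‖ = 1 ∧ u = s * e := by
    intro u hu
    have h0 : (‖u‖ : ℂ) ≠ 0 := by exact_mod_cast (by linarith : ‖u‖ ≠ 0)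
    refine ⟨‖u‖, u / ‖u‖, hu, ?_, by field_simp⟩
    rw [norm_div, Complex.norm_real, norm_norm, div_self (by linarith)]
  rcases le_or_gt ‖z‖ 1 with hz | hz <;> rcases le_or_gt ‖w‖ 1 with hw | hw
  · rw [diskProj_of_norm_le hz, diskProj_of_norm_le hw]
  · obtain ⟨s, e, hs, he, rfl⟩ := key w hw
    rw [diskProj_of_norm_le hz, diskProj_mul_of_norm_eq he hs.le]
    exact norm_sub_le_norm_sub_mul he hz hs.le
  · obtain ⟨s, e, hs, he, rfl⟩ := key z hz
    rw [diskProj_of_norm_le hw, diskProj_mul_of_norm_eq he hs.le, norm_sub_rev, norm_sub_rev _ w]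
    exact norm_sub_le_norm_sub_mul he hw hs.le
  · obtain ⟨s, e, hs, he, rfl⟩ := key z hz
    obtain ⟨t, d, ht, hd, rfl⟩ := key w hw
    rw [diskProj_mul_of_norm_eq he hs.le, diskProj_mul_of_norm_eq hd ht.le]
    rcases eq_or_ne e d with rfl | hne
    · simp
    · exact (norm_sub_lt_norm_mul_sub_mul he hd hne hs ht).le

/-- A nonexpansive perturbation of the identity with bounded range is onto. -/
theorem exists_add_eq_of_norm_sub_le {Q : ℂ → ℂ} (hQ : ∀ z w, ‖Q z - Q w‖ ≤ ‖z - w‖) {C : ℝ}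
    (hC : ∀ z, ‖Q z‖ ≤ C) (w : ℂ) : ∃ z, z + Q z = w := by
  have hQc : Continuous Q :=
    (LipschitzWith.of_dist_le_mul (K := 1) fun x y => by
      simpa [dist_eq_norm] using hQ x y).continuous
  -- Shrinking Q by 1 - 1/(m + 1) makes z ↦ w - Q z a contraction, whose fixed point solves the
  -- shrunken equation. As Q is bounded, these points stay in one compact ball and have a limit
  -- point.
  have hfix : ∀ m : ℕ, ∃ z, z + ((1 - 1 / (m + 1 : ℝ) : ℝ) : ℂ) * Q z = w := by
    intro m
    have hm : (0 : ℝ) < 1 / (m + 1 : ℝ) := by positivity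
    have hm1 : 1 / (m + 1 : ℝ) ≤ 1 := by
      rw [div_le_one (by positivity)]; linarith [Nat.cast_nonneg (α := ℝ) m]
    set k : ℝ := 1 - 1 / (m + 1 : ℝ) with hk
    have hk0 : 0 ≤ k := by linarith
    have hcon : ContractingWith k.toNNReal fun z => w - (k : ℂ) * Q z := by
      refine ⟨Real.toNNReal_lt_one.2 (by linarith),
        LipschitzWith.of_dist_le_mul fun x y => ?_⟩
      rw [Real.coe_toNNReal k hk0, dist_eq_norm, dist_eq_norm, sub_sub_sub_cancel_left, ← mul_sub,
        norm_mul,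
        Complex.norm_real, Real.norm_of_nonneg hk0, norm_sub_rev x y]
      exact mul_le_mul_of_nonneg_left (hQ y x) hk0
    refine ⟨hcon.fixedPoint, ?_⟩
    have := hcon.fixedPoint_isFixedPt
    simp only [Function.IsFixedPt] at this
    linear_combination -this
  choose z hz using hfix
  have hC0 : 0 ≤ C := (norm_nonneg _).trans (hC 0)
  have hmem : ∀ m, z m ∈ Metric.closedBall (0 : ℂ) (‖w‖ + C) := by
    intro m
    have hm : (0 : ℝ) < 1 / (m + 1 : ℝ) := by positivity
    have hm1 : 1 / (m + 1 : ℝ) ≤ 1 := by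
      rw [div_le_one (by positivity)]; linarith [Nat.cast_nonneg (α := ℝ) m]
    rw [mem_closedBall_zero_iff]
    have e : z m = w - ((1 - 1 / (m + 1 : ℝ) : ℝ) : ℂ) * Q (z m) := by
      rw [← hz m]; ring
    rw [e]
    refine (norm_sub_le _ _).trans (add_le_add_right ?_ _)
    rw [norm_mul, Complex.norm_real, Real.norm_of_nonneg (by linarith)]
    nlinarith [hC (z m), norm_nonneg (Q (z m))]
  obtain ⟨y, -, φ, hφ, hy⟩ := (isCompact_closedBall (0 : ℂ) (‖w‖ + C)).tendsto_subseq hmem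
  refine ⟨y, ?_⟩
  have h1 : Filter.Tendsto (fun m : ℕ => ((1 - 1 / (m + 1 : ℝ) : ℝ) : ℂ)) Filter.atTop
      (nhds 1) := by
    have h := tendsto_one_div_add_atTop_nhds_zero_nat (𝕜 := ℝ)
    have h' := (Complex.continuous_ofReal.tendsto _).comp ((tendsto_const_nhds (x := (1:ℝ))).sub h)
    simpa [Function.comp_def] using h'
  have h2 : Filter.Tendsto (fun m : ℕ => z (φ m) + ((1 - 1 / (φ m + 1 : ℝ) : ℝ) : ℂ) * Q (z (φ m)))
      Filter.atTop (nhds (y + 1 * Q y)) :=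
    hy.add ((h1.comp hφ.tendsto_atTop).mul ((hQc.tendsto y).comp hy))
  simp only [hz, one_mul] at h2
  exact tendsto_nhds_unique h2 tendsto_const_nhds

/-- The image of the disk under a strictly nonexpansive perturbation of the identity is
close-to-convex: the complement is swept out by the outward normals of the unit circle. -/
theorem isCloseToConvexSet_image_add {P : ℂ → ℂ}
    (hP : ∀ z w, ‖z‖ ≤ 1 → ‖w‖ ≤ 1 → ‖P z - P w‖ ≤ ‖z - w‖)
    (hP' : ∀ z w, ‖z‖ < 1 → ‖w‖ ≤ 1 → z ≠ w → ‖P z - P w‖ < ‖z - w‖) :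
    IsCloseToConvexSet ((fun z => z + P z) '' unitDisk) := by
  -- The ray of a unimodular e starts at e + P e with direction e, so its points are (1 + a)e + P e
  -- with a ≥ 0.
  refine ⟨{r | ‖r.2‖ = 1 ∧ r.1 = r.2 + P r.2}, fun r hr => hr.1, ?_, ?_⟩
  · rintro ⟨r, e⟩ ⟨he, hr⟩ ⟨s, d⟩ ⟨hd, hs⟩ hne
    simp only at he hr hd hs
    subst hr hs
    rw [Set.disjoint_left]
    rintro w ⟨a, ha, hwa⟩ ⟨b, hb, hwb⟩
    have hed : e ≠ d := fun h => hne (by rw [h])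
    simp only at hwa hwb
    have h1 := norm_sub_lt_norm_mul_sub_mul he hd hed (s := 1 + a) (t := 1 + b)
      (by linarith) (by linarith)
    have h2 := hP d e hd.le he.le
    rw [norm_sub_rev d e] at h2
    have h3 : ((1 + a : ℝ) : ℂ) * e - ((1 + b : ℝ) : ℂ) * d = P d - P e := by
      push_cast
      linear_combination hwb - hwa
    rw [h3] at h1
    exact absurd h1 (not_lt.2 h2)
  · ext w
    simp only [Set.mem_compl_iff, Set.mem_iUnion, Set.mem_ofPred_eq]
    constructor
    · intro hw
      -- Precomposing with the projection extends P to a bounded nonexpansive map of the plane. A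
      -- solution z for an omitted w lies outside the open disk, and then w is on the ray of z /
      -- |z|.
      obtain ⟨z, hz⟩ := exists_add_eq_of_norm_sub_le (Q := fun z => P (diskProj z))
        (fun z w => (hP _ _ (norm_diskProj_le z) (norm_diskProj_le w)).trans
          (norm_diskProj_sub_le z w)) (C := 1 + ‖P 0‖)
        (fun z => by
          have h1 := hP (diskProj z) 0 (norm_diskProj_le z) (by simp)
          have h2 := norm_le_norm_sub_add (P (diskProj z)) (P 0)
          rw [sub_zero] at h1
          linarith [norm_diskProj_le z]) w
      have hz1 : 1 ≤ ‖z‖ := by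
        by_contra! h
        refine hw ⟨z, by simpa [unitDisk] using h, ?_⟩
        rw [diskProj_of_norm_le h.le] at hz
        exact hz
      have h0 : (‖z‖ : ℂ) ≠ 0 := by exact_mod_cast (by linarith : ‖z‖ ≠ 0)
      have he : ‖z / ‖z‖‖ = 1 := by
        rw [norm_div, Complex.norm_real, norm_norm, div_self (by linarith)]
      have hze : z = ((‖z‖ : ℝ) : ℂ) * (z / ‖z‖) := by field_simp
      have hpz : diskProj z = z / ‖z‖ := by
        conv_lhs => rw [hze]
        exact diskProj_mul_of_norm_eq he hz1
      refine ⟨(z / ‖z‖ + P (z / ‖z‖), z / ‖z‖), ⟨he, rfl⟩, ‖z‖ - 1, by linarith, ?_⟩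
      rw [hpz] at hz
      rw [← hz]
      push_cast
      linear_combination hze
    · rintro ⟨⟨r, e⟩, ⟨he, hr⟩, a, ha, hwa⟩ ⟨z, hz, hzw⟩
      simp only at he hr hwa hzw
      have hz1 : ‖z‖ < 1 := by simpa [unitDisk] using hz
      have hze : z ≠ e := fun h => by rw [h, he] at hz1; exact lt_irrefl _ hz1
      -- A common point would give |z - (1 + a)e| = |P z - P e| < |z - e|, although moving e
      -- outwards cannot decrease the distance to z.
      have h1 := hP' z e hz1 he.le hze
      have h2 := norm_sub_le_norm_sub_mul he hz1.le (s := 1 + a) (by linarith)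
      have h3 : z - ((1 + a : ℝ) : ℂ) * e = -(P z - P e) := by
        push_cast
        linear_combination hzw + hwa + hr
      rw [h3, norm_neg] at h2
      linarith

theorem injOn_add_of_norm_sub_lt {P : ℂ → ℂ}
    (hP' : ∀ z w, ‖z‖ < 1 → ‖w‖ ≤ 1 → z ≠ w → ‖P z - P w‖ < ‖z - w‖) :
    Set.InjOn (fun z => z + P z) unitDisk := by
  intro z hz w hw h
  by_contra hne
  have h1 := hP' z w (by simpa [unitDisk] using hz)
    (le_of_lt (by simpa [unitDisk] using hw)) hne
  have h3 : z - w = -(P z - P w) := by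
    simp only at h
    linear_combination h
  rw [h3, norm_neg] at h1
  exact lt_irrefl _ h1

/-! ### Power series with Σ n|a_n| finite -/

/-- Each of the n terms of the geometric factorization is at most r^(n-1) ≤ r, because n ≥ 2. The
factor r that survives yields strict derivative bounds inside the disk. -/
theorem norm_pow_sub_pow_le_mul {z w : ℂ} {r : ℝ} (hr : r ≤ 1) (hz : ‖z‖ ≤ r) (hw : ‖w‖ ≤ r)
    {n : ℕ} (hn : 2 ≤ n) : ‖z ^ n - w ^ n‖ ≤ n * r * ‖z - w‖ := by
  have hr0 : 0 ≤ r := (norm_nonneg z).trans hz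
  rw [← (Commute.all z w).geom_sum₂_mul, norm_mul]
  refine mul_le_mul_of_nonneg_right ((norm_sum_le _ _).trans ?_) (norm_nonneg _)
  calc ∑ i ∈ Finset.range n, ‖z ^ i * w ^ (n - 1 - i)‖
      ≤ ∑ i ∈ Finset.range n, r := by
        refine Finset.sum_le_sum fun i hi => ?_
        rw [Finset.mem_range] at hi
        rw [norm_mul, norm_pow, norm_pow]
        calc ‖z‖ ^ i * ‖w‖ ^ (n - 1 - i) ≤ r ^ i * r ^ (n - 1 - i) := by gcongr
          _ = r ^ (n - 1) := by rw [← pow_add]; congr 1; omega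
          _ ≤ r ^ 1 := pow_le_pow_of_le_one hr0 hr (by omega)
          _ = r := pow_one r
    _ = n * r := by simp

/-- The single term z^(n-1) is already strictly below 1, so w may lie on the unit circle. -/
theorem norm_pow_sub_pow_lt_mul {z w : ℂ} (hz : ‖z‖ < 1) (hw : ‖w‖ ≤ 1) (hne : z ≠ w)
    {n : ℕ} (hn : 2 ≤ n) : ‖z ^ n - w ^ n‖ < n * ‖z - w‖ := by
  rw [← (Commute.all z w).geom_sum₂_mul, norm_mul]
  refine mul_lt_mul_of_pos_right ((norm_sum_le _ _).trans_lt ?_) (norm_pos_iff.2 (sub_ne_zero.2 hne))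
  calc ∑ i ∈ Finset.range n, ‖z ^ i * w ^ (n - 1 - i)‖
      < ∑ i ∈ Finset.range n, (1 : ℝ) := by
        refine Finset.sum_lt_sum (fun i _ => ?_) ⟨n - 1, by simp; omega, ?_⟩
        · rw [norm_mul, norm_pow, norm_pow]
          exact mul_le_one₀ (pow_le_one₀ (norm_nonneg _) hz.le) (by positivity)
            (pow_le_one₀ (norm_nonneg _) hw)
        · simpa using pow_lt_one₀ (norm_nonneg _) hz (by omega)
    _ = n := by simp

section powerSeries

variable {a b : ℕ → ℂ}

theorem summable_norm_of_summable_natCast_mul (ha : Summable fun n : ℕ => (n : ℝ) * ‖a n‖) :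
    Summable fun n => ‖a n‖ := by
  rw [← summable_nat_add_iff 1] at ha ⊢
  refine Summable.of_nonneg_of_le (fun _ => norm_nonneg _) (fun n => ?_) ha
  push_cast
  nlinarith [norm_nonneg (a (n + 1)), Nat.cast_nonneg (α := ℝ) n]

theorem summable_mul_pow_of_summable_natCast_mul
    (ha : Summable fun n : ℕ => (n : ℝ) * ‖a n‖) {z : ℂ} (hz : ‖z‖ ≤ 1) :
    Summable fun n => a n * z ^ n := by
  refine Summable.of_norm_bounded (summable_norm_of_summable_natCast_mul ha) fun n => ?_
  rw [norm_mul, norm_pow]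
  exact mul_le_of_le_one_right (norm_nonneg _) (pow_le_one₀ (norm_nonneg _) hz)

theorem norm_tsum_mul_pow_sub_le (ha : Summable fun n : ℕ => (n : ℝ) * ‖a n‖)
    (ha2 : ∀ n < 2, a n = 0) {z w : ℂ} {r : ℝ} (hr : r ≤ 1) (hz : ‖z‖ ≤ r) (hw : ‖w‖ ≤ r) :
    ‖∑' n, a n * z ^ n - ∑' n, a n * w ^ n‖ ≤ (∑' n : ℕ, (n : ℝ) * ‖a n‖) * r * ‖z - w‖ := by
  rw [← (summable_mul_pow_of_summable_natCast_mul ha (hz.trans hr)).tsum_sub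
    (summable_mul_pow_of_summable_natCast_mul ha (hw.trans hr)), mul_assoc, ← tsum_mul_right]
  refine tsum_of_norm_bounded (ha.mul_right _).hasSum fun n => ?_
  rcases lt_or_ge n 2 with hn | hn
  · simp [ha2 n hn]
  · rw [← mul_sub, norm_mul]
    have := mul_le_mul_of_nonneg_left (norm_pow_sub_pow_le_mul hr hz hw hn) (norm_nonneg (a n))
    linarith

theorem differentiableOn_tsum_mul_pow (ha : Summable fun n : ℕ => (n : ℝ) * ‖a n‖) :
    DifferentiableOn ℂ (fun z => ∑' n, a n * z ^ n) unitDisk := by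
  refine Complex.differentiableOn_tsum_of_summable_norm
    (summable_norm_of_summable_natCast_mul ha) (fun n => by fun_prop) Metric.isOpen_ball
    fun n z hz => ?_
  rw [norm_mul, norm_pow]
  exact mul_le_of_le_one_right (norm_nonneg _)
    (pow_le_one₀ (norm_nonneg _) (le_of_lt (by simpa [unitDisk] using hz)))

theorem norm_deriv_tsum_mul_pow_le (ha : Summable fun n : ℕ => (n : ℝ) * ‖a n‖)
    (ha2 : ∀ n < 2, a n = 0) {z : ℂ} {r : ℝ} (hr : r ≤ 1) (hz : ‖z‖ < r) :
    ‖deriv (fun z => ∑' n, a n * z ^ n) z‖ ≤ (∑' n : ℕ, (n : ℝ) * ‖a n‖) * r := by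
  have hS : 0 ≤ ∑' n : ℕ, (n : ℝ) * ‖a n‖ := tsum_nonneg fun n => by positivity
  refine norm_deriv_le_of_lip' (mul_nonneg hS ((norm_nonneg z).trans hz.le)) ?_
  filter_upwards [Metric.isOpen_ball.mem_nhds (mem_ball_zero_iff.2 hz)] with w hw
  exact norm_tsum_mul_pow_sub_le ha ha2 hr (le_of_lt (by simpa using hw)) hz.le

/-- A harmonic function `z + ∑ aₙ zⁿ + conj (∑ bₙ zⁿ)` with `∑ n (|aₙ| + |bₙ|) ≤ 1` is
close-to-convex. -/
theorem mem_classCH_of_tsum_le_one (ha : Summable fun n : ℕ => (n : ℝ) * ‖a n‖)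
    (hb : Summable fun n : ℕ => (n : ℝ) * ‖b n‖) (ha2 : ∀ n < 2, a n = 0) (hb2 : ∀ n < 2, b n = 0)
    (hab : ∑' n : ℕ, (n : ℝ) * ‖a n‖ + ∑' n : ℕ, (n : ℝ) * ‖b n‖ ≤ 1) {f : ℂ → ℂ}
    (hf : ∀ z ∈ unitDisk, f z = z + ∑' n, a n * z ^ n + (starRingEnd ℂ) (∑' n, b n * z ^ n)) :
    f ∈ classCH := by
  set A : ℂ → ℂ := fun z => ∑' n, a n * z ^ n with hA
  set B : ℂ → ℂ := fun z => ∑' n, b n * z ^ n with hB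
  set P : ℂ → ℂ := fun z => A z + (starRingEnd ℂ) (B z) with hPdef
  have hSa : 0 ≤ ∑' n : ℕ, (n : ℝ) * ‖a n‖ := tsum_nonneg fun n => by positivity
  have hSb : 0 ≤ ∑' n : ℕ, (n : ℝ) * ‖b n‖ := tsum_nonneg fun n => by positivity
  have hle : ∀ z w : ℂ, ‖P z - P w‖ ≤ ‖A z - A w‖ + ‖B z - B w‖ := fun z w => by
    have : P z - P w = (A z - A w) + (starRingEnd ℂ) (B z - B w) := by
      simp only [hPdef, map_sub]; ring
    rw [this]
    exact (norm_add_le _ _).trans_eq (by rw [RCLike.norm_conj])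
  have hP : ∀ z w : ℂ, ‖z‖ ≤ 1 → ‖w‖ ≤ 1 → ‖P z - P w‖ ≤ ‖z - w‖ := fun z w hz hw => by
    have h1 := norm_tsum_mul_pow_sub_le ha ha2 le_rfl hz hw
    have h2 := norm_tsum_mul_pow_sub_le hb hb2 le_rfl hz hw
    nlinarith [hle z w, norm_nonneg (z - w)]
  have hP' : ∀ z w : ℂ, ‖z‖ < 1 → ‖w‖ ≤ 1 → z ≠ w → ‖P z - P w‖ < ‖z - w‖ := by
    intro z w hz hw hne
    have hpos : 0 < ‖z - w‖ := norm_pos_iff.2 (sub_ne_zero.2 hne)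
    have hsab : Summable fun n : ℕ => (n : ℝ) * ‖a n‖ + (n : ℝ) * ‖b n‖ := ha.add hb
    have hterm : ∀ n, ‖a n * z ^ n - a n * w ^ n‖ + ‖b n * z ^ n - b n * w ^ n‖
        ≤ ((n : ℝ) * ‖a n‖ + (n : ℝ) * ‖b n‖) * ‖z - w‖ := by
      intro n
      rcases lt_or_ge n 2 with hn | hn
      · simp [ha2 n hn, hb2 n hn]
      · rw [← mul_sub, ← mul_sub, norm_mul, norm_mul]
        have := norm_pow_sub_pow_lt_mul hz hw hne hn
        nlinarith [norm_nonneg (a n), norm_nonneg (b n)]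
    have hs1 : Summable fun n => ‖a n * z ^ n - a n * w ^ n‖ + ‖b n * z ^ n - b n * w ^ n‖ :=
      Summable.of_nonneg_of_le (fun n => by positivity) hterm (hsab.mul_right _)
    have hsA : Summable fun n => ‖a n * z ^ n - a n * w ^ n‖ :=
      Summable.of_nonneg_of_le (fun n => by positivity)
        (fun n => le_add_of_nonneg_right (norm_nonneg _)) hs1
    have hsB : Summable fun n => ‖b n * z ^ n - b n * w ^ n‖ :=
      Summable.of_nonneg_of_le (fun n => by positivity)
        (fun n => le_add_of_nonneg_left (norm_nonneg _)) hs1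
    have h1 : ‖P z - P w‖
        ≤ ∑' n, (‖a n * z ^ n - a n * w ^ n‖ + ‖b n * z ^ n - b n * w ^ n‖) := by
      refine (hle z w).trans ?_
      rw [hsA.tsum_add hsB]
      refine add_le_add ?_ ?_
      · rw [hA, ← (summable_mul_pow_of_summable_natCast_mul ha hz.le).tsum_sub
          (summable_mul_pow_of_summable_natCast_mul ha hw)]
        exact norm_tsum_le_tsum_norm hsA
      · rw [hB, ← (summable_mul_pow_of_summable_natCast_mul hb hz.le).tsum_sub
          (summable_mul_pow_of_summable_natCast_mul hb hw)]
        exact norm_tsum_le_tsum_norm hsB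
    -- A strict inequality of sums needs one strict term, hence a nonzero coefficient. If there is
    -- none, the left side is 0.
    by_cases h0 : ∀ n, a n = 0 ∧ b n = 0
    · refine h1.trans_lt ?_
      simpa [fun n => (h0 n).1, fun n => (h0 n).2] using hpos
    · push Not at h0
      obtain ⟨m, hm⟩ := h0
      have hm' : 0 < ‖a m‖ + ‖b m‖ := by
        by_cases h : a m = 0
        · have := norm_pos_iff.2 (hm h); positivity
        · have := norm_pos_iff.2 h; positivity
      have hm2 : 2 ≤ m := by
        by_contra! h
        simp [ha2 m h, hb2 m h] at hm'
      have hlt : ‖a m * z ^ m - a m * w ^ m‖ + ‖b m * z ^ m - b m * w ^ m‖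
          < ((m : ℝ) * ‖a m‖ + (m : ℝ) * ‖b m‖) * ‖z - w‖ := by
        rw [← mul_sub, ← mul_sub, norm_mul, norm_mul]
        have := norm_pow_sub_pow_lt_mul hz hw hne hm2
        nlinarith
      refine h1.trans_lt ((Summable.tsum_lt_tsum hterm hlt hs1 (hsab.mul_right _)).trans_le ?_)
      rw [tsum_mul_right, ha.tsum_add hb]
      nlinarith
  have hEq : Set.EqOn (fun z => z + P z) f unitDisk := fun z hz => by
    simp only [hf z hz, hPdef]; ring
  have hdA := differentiableOn_tsum_mul_pow ha
  have hdB := differentiableOn_tsum_mul_pow hb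
  have hopen : IsOpen unitDisk := Metric.isOpen_ball
  have hder : ∀ z ∈ unitDisk, deriv (fun z => z + A z) z = 1 + deriv A z := fun z hz => by
    have := (hasDerivAt_id z).add (hdA.differentiableAt (hopen.mem_nhds hz)).hasDerivAt
    exact this.deriv
  -- The derivative bound carries a factor r for every small r > 0, so letting r tend to 0 gives the
  -- value 0.
  have hd0 : ∀ c : ℕ → ℂ, Summable (fun n : ℕ => (n : ℝ) * ‖c n‖) → (∀ n < 2, c n = 0) →
      deriv (fun z => ∑' n, c n * z ^ n) 0 = 0 := by
    intro c hc hc2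
    refine norm_le_zero_iff.1 (ge_of_tendsto (f := fun r : ℝ => (∑' n : ℕ, (n : ℝ) * ‖c n‖) * r)
      (x := nhdsWithin 0 (Set.Ioi 0)) ?_ ?_)
    · have : Filter.Tendsto (fun r : ℝ => (∑' n : ℕ, (n : ℝ) * ‖c n‖) * r) (nhds 0)
        (nhds ((∑' n : ℕ, (n : ℝ) * ‖c n‖) * 0)) := tendsto_const_nhds.mul Filter.tendsto_id
      rw [mul_zero] at this
      exact this.mono_left nhdsWithin_le_nhds
    · filter_upwards [self_mem_nhdsWithin, nhdsWithin_le_nhds (Iio_mem_nhds one_pos)] with r hr hr1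
      exact norm_deriv_tsum_mul_pow_le hc hc2 (le_of_lt hr1) (by simpa using hr)
  have h00 : ∀ c : ℕ → ℂ, (∀ n < 2, c n = 0) → ∑' n, c n * (0 : ℂ) ^ n = 0 := by
    intro c hc2
    refine (tsum_congr fun n => ?_).trans tsum_zero
    rcases Nat.eq_zero_or_pos n with rfl | hn
    · simp [hc2 0 (by norm_num)]
    · simp [hn.ne']
  have h0mem : (0 : ℂ) ∈ unitDisk := by simp [unitDisk]
  refine ⟨⟨fun z => z + A z, B, ⟨?_, hdB, ?_, ?_, h00 b hb2, ?_, ?_⟩, ?_, ?_⟩, ?_⟩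
  · exact differentiableOn_id.add hdA
  · simpa [hA] using h00 a ha2
  · rw [hder 0 h0mem, hd0 a ha ha2, add_zero]
  · rw [hd0 b hb hb2]; simp
  · exact hf
  · intro z hz
    have hz1 : ‖z‖ < 1 := by simpa [unitDisk] using hz
    obtain ⟨r, hzr, hr1⟩ := exists_between hz1
    have h1 := norm_deriv_tsum_mul_pow_le ha ha2 hr1.le hzr
    have h2 := norm_deriv_tsum_mul_pow_le hb hb2 hr1.le hzr
    rw [hder z hz]
    -- With coefficient sums S_a, S_b this gives |1 + A'| ≥ 1 - S_a r, while |B'| ≤ S_b r; and (S_a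
    -- + S_b) r ≤ r < 1.
    have h3 : (1 : ℝ) ≤ ‖1 + deriv A z‖ + ‖deriv A z‖ := by
      have := norm_sub_le (1 + deriv A z) (deriv A z)
      simpa using this
    have hr0 : 0 ≤ r := (norm_nonneg z).trans hzr.le
    nlinarith
  · exact (injOn_add_of_norm_sub_lt hP').congr hEq
  · rw [← Set.EqOn.image_eq hEq]
    exact isCloseToConvexSet_image_add hP hP'

end powerSeries

/-! ### Taylor coefficients and termwise differentiation of entire series -/

theorem hasSum_taylorCoeff_mul_pow {f : ℂ → ℂ} (hf : DifferentiableOn ℂ f unitDisk) {z : ℂ}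
    (hz : z ∈ unitDisk) : HasSum (fun n => taylorCoeff f n * z ^ n) (f z) := by
  have h := Complex.hasSum_taylorSeries_on_ball (c := 0) (r := 1) hf hz
  have e : (fun n => taylorCoeff f n * z ^ n)
      = fun n => ((n.factorial : ℂ))⁻¹ • (z - 0) ^ n • iteratedDeriv n f 0 := by
    funext n
    simp only [taylorCoeff, smul_eq_mul, sub_zero]
    ring
  rwa [e]

theorem taylorCoeff_eq_of_hasSum {f : ℂ → ℂ} {c : ℕ → ℂ} {r : ℝ} (hr : 0 < r)
    (hf : ∀ z ∈ Metric.ball (0 : ℂ) r, HasSum (fun n => c n * z ^ n) (f z)) (n : ℕ) :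
    taylorCoeff f n = c n := by
  have h1 : HasFPowerSeriesAt f (FormalMultilinearSeries.ofScalars ℂ c) 0 := by
    rw [hasFPowerSeriesAt_iff]
    filter_upwards [Metric.ball_mem_nhds (0 : ℂ) hr] with z hz
    simpa [FormalMultilinearSeries.coeff_ofScalars, mul_comm] using hf z hz
  have h2 := h1.analyticAt.hasFPowerSeriesAt
  have h3 := congrArg (fun p => FormalMultilinearSeries.coeff p n)
    (h2.eq_formalMultilinearSeries h1)
  simpa [FormalMultilinearSeries.coeff_ofScalars, taylorCoeff] using h3

theorem taylorCoeff_zero_index (f : ℂ → ℂ) : taylorCoeff f 0 = f 0 := by simp [taylorCoeff]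

theorem taylorCoeff_one (f : ℂ → ℂ) : taylorCoeff f 1 = deriv f 0 := by simp [taylorCoeff]

section entire

variable {c : ℕ → ℂ}

/-- The factor n + 1 is absorbed by 2^(n+1), as the hypothesis is available at radius 2(R + 1). The
conclusion has the form of the hypothesis, so the step can be iterated for second derivatives. -/
theorem summable_succ_mul_norm_mul_pow (hc : ∀ R : ℝ, 0 ≤ R → Summable fun n => ‖c n‖ * R ^ n)
    (R : ℝ) (hR : 0 ≤ R) : Summable fun n : ℕ => ‖((n : ℂ) + 1) * c (n + 1)‖ * R ^ n := by
  have h := (summable_nat_add_iff 1).2 (hc (2 * (R + 1)) (by positivity))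
  refine Summable.of_nonneg_of_le (fun n => by positivity) (fun n => ?_) h
  have h1 : ‖((n : ℂ) + 1)‖ = (n : ℝ) + 1 := by
    have : ((n : ℂ) + 1) = ((n + 1 : ℝ) : ℂ) := by push_cast; rfl
    rw [this, Complex.norm_real, Real.norm_of_nonneg (by positivity)]
  have h2 : (n : ℝ) + 1 ≤ 2 ^ (n + 1) := by
    have := (Nat.lt_two_pow_self (n := n + 1)).le
    exact_mod_cast this
  have h3 : R ^ n ≤ (R + 1) ^ (n + 1) :=
    (pow_le_pow_left₀ hR (by linarith) n).trans (pow_le_pow_right₀ (by linarith) (by omega))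
  rw [norm_mul, h1, mul_pow]
  calc ((n : ℝ) + 1) * ‖c (n + 1)‖ * R ^ n ≤ 2 ^ (n + 1) * ‖c (n + 1)‖ * (R + 1) ^ (n + 1) := by
        gcongr
    _ = _ := by ring

theorem summable_mul_pow_of_entire (hc : ∀ R : ℝ, 0 ≤ R → Summable fun n => ‖c n‖ * R ^ n)
    (z : ℂ) : Summable fun n => c n * z ^ n :=
  Summable.of_norm_bounded (hc ‖z‖ (norm_nonneg z)) fun n => by rw [norm_mul, norm_pow]

theorem deriv_tsum_mul_pow (hc : ∀ R : ℝ, 0 ≤ R → Summable fun n => ‖c n‖ * R ^ n) (z : ℂ) :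
    deriv (fun z => ∑' n, c n * z ^ n) z = ∑' n : ℕ, ((n : ℂ) + 1) * c (n + 1) * z ^ n := by
  have h := Complex.hasSum_deriv_of_summable_norm (F := fun n z => c n * z ^ n)
    (U := Metric.ball 0 (‖z‖ + 1)) (z := z) (hc (‖z‖ + 1) (by positivity))
    (fun n => by fun_prop) Metric.isOpen_ball
    (fun n w hw => by
      rw [norm_mul, norm_pow]
      have : ‖w‖ ≤ ‖z‖ + 1 := le_of_lt (by simpa using hw)
      gcongr) (by simp)
  have hd : ∀ n, deriv (fun z => c n * z ^ n) z = c n * (n * z ^ (n - 1)) := fun n => by simp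
  simp only [hd] at h
  have h1 := (hasSum_nat_add_iff' 1).2 h
  simp only [Finset.range_one, Finset.sum_singleton, Nat.cast_zero, zero_mul, mul_zero, sub_zero,
    add_tsub_cancel_right, Nat.cast_add, Nat.cast_one] at h1
  rw [← h1.tsum_eq]
  exact tsum_congr fun n => by ring

end entire

/-! ### Growth of Gamma and the coefficients of Wright functions -/

/-- Only the part of Euler's integral over (T, T + 1] is kept. Since T is free, Gamma outgrows every
exponential, which is all that convergence requires. -/
theorem le_realGamma {x T : ℝ} (hx : 0 < x) (hT : 1 ≤ T) :
    T ^ x * (Real.exp (-(T + 1)) / (T + 1)) ≤ Real.Gamma x := by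
  have hT0 : 0 < T := by linarith
  have hint := Real.GammaIntegral_convergent hx
  have hsub : Set.Ioc T (T + 1) ⊆ Set.Ioi 0 := fun t ht => hT0.trans ht.1
  rw [Real.Gamma_eq_integral hx]
  calc T ^ x * (Real.exp (-(T + 1)) / (T + 1))
      = ∫ _ in Set.Ioc T (T + 1), T ^ x * (Real.exp (-(T + 1)) / (T + 1)) := by simp
    _ ≤ ∫ t in Set.Ioc T (T + 1), Real.exp (-t) * t ^ (x - 1) := by
      refine MeasureTheory.setIntegral_mono_on
        (MeasureTheory.integrableOn_const (by simp) enorm_ne_top) (hint.mono_set hsub) measurableSet_Ioc ?_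
      intro t ht
      have ht0 : 0 < t := hsub ht
      rw [Real.rpow_sub_one ht0.ne']
      have h1 : T ^ x ≤ t ^ x := Real.rpow_le_rpow hT0.le ht.1.le hx.le
      have h2 : Real.exp (-(T + 1)) ≤ Real.exp (-t) := Real.exp_le_exp.2 (by linarith [ht.2])
      calc T ^ x * (Real.exp (-(T + 1)) / (T + 1)) ≤ t ^ x * (Real.exp (-t) / t) := by
            gcongr
            exact ht.2
        _ = _ := by ring
    _ ≤ ∫ t in Set.Ioi 0, Real.exp (-t) * t ^ (x - 1) := by
      refine MeasureTheory.setIntegral_mono_set hint ?_ hsub.eventuallyLE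
      filter_upwards [MeasureTheory.ae_restrict_mem measurableSet_Ioi] with t ht
      have : (0 : ℝ) < t := ht
      positivity

/-- Taylor coefficients of the normalized four-parameter Wright function, shifted by one. -/
noncomputable def wrightCoeff (α β γ δ : ℝ) (n : ℕ) : ℝ :=
  Real.Gamma α * Real.Gamma γ / (Real.Gamma (α + n * β) * Real.Gamma (γ + n * δ))

section wright

variable {α β γ δ : ℝ}

theorem wrightCoeff_zero (hα : 0 < α) (hγ : 0 < γ) : wrightCoeff α β γ δ 0 = 1 := by
  have h1 := Real.Gamma_pos_of_pos hα
  have h2 := Real.Gamma_pos_of_pos hγ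
  simp [wrightCoeff, h1.ne', h2.ne']

theorem wrightCoeff_pos (hα : 0 < α) (hγ : 0 < γ) (hβ : 0 ≤ β) (hδ : 0 ≤ δ) (n : ℕ) :
    0 < wrightCoeff α β γ δ n := by
  have h1 := Real.Gamma_pos_of_pos hα
  have h2 := Real.Gamma_pos_of_pos hγ
  have h3 : 0 < Real.Gamma (α + n * β) := Real.Gamma_pos_of_pos (by positivity)
  have h4 : 0 < Real.Gamma (γ + n * δ) := Real.Gamma_pos_of_pos (by positivity)
  unfold wrightCoeff
  positivity

theorem summable_wrightCoeff_mul_pow (hα : 0 < α) (hγ : 0 < γ) (hβ : 0 ≤ β) (hδ : 0 ≤ δ)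
    (hβδ : 0 < β + δ) (R : ℝ) (hR : 0 ≤ R) :
    Summable fun n => wrightCoeff α β γ δ n * R ^ n := by
  -- T is chosen with T^(β+δ) = S, so the product of the two Gamma values is at least a constant
  -- times S^n. As R ≤ S/2, a geometric series of ratio 1/2 dominates.
  set S : ℝ := 2 * (R + 1) with hS
  have hS0 : 0 < S := by positivity
  set T : ℝ := S ^ (1 / (β + δ)) with hT
  have hT1 : 1 ≤ T := Real.one_le_rpow (by linarith) (by positivity)
  have hTS : T ^ (β + δ) = S := by
    rw [hT, ← Real.rpow_mul hS0.le, one_div_mul_cancel hβδ.ne', Real.rpow_one]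
  set k : ℝ := Real.exp (-(T + 1)) / (T + 1) with hk
  have hk0 : 0 < k := by positivity
  set G : ℝ := Real.Gamma α * Real.Gamma γ with hG
  have hG0 : 0 < G := mul_pos (Real.Gamma_pos_of_pos hα) (Real.Gamma_pos_of_pos hγ)
  have hgeom : Summable fun n : ℕ => G / k ^ 2 * (1 / 2 : ℝ) ^ n :=
    (summable_geometric_of_lt_one (by norm_num) (by norm_num)).mul_left _
  refine Summable.of_nonneg_of_le
    (fun n => mul_nonneg (wrightCoeff_pos hα hγ hβ hδ n).le (by positivity)) (fun n => ?_) hgeom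
  have h1 := le_realGamma (x := α + n * β) (by positivity) hT1
  have h2 := le_realGamma (x := γ + n * δ) (by positivity) hT1
  have h3 : S ^ n * k ^ 2 ≤ Real.Gamma (α + n * β) * Real.Gamma (γ + n * δ) := by
    have e : S ^ n ≤ T ^ (α + n * β) * T ^ (γ + n * δ) := by
      rw [← Real.rpow_add (by linarith), ← hTS, ← Real.rpow_natCast, ← Real.rpow_mul (by linarith)]
      exact Real.rpow_le_rpow_of_exponent_le hT1 (by nlinarith)
    calc S ^ n * k ^ 2 ≤ T ^ (α + n * β) * T ^ (γ + n * δ) * k ^ 2 := by gcongr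
      _ = (T ^ (α + n * β) * k) * (T ^ (γ + n * δ) * k) := by ring
      _ ≤ _ := by
        refine mul_le_mul h1 h2 (by positivity) (Real.Gamma_pos_of_pos (by positivity)).le
  have hR2 : R ^ n ≤ S ^ n * (1 / 2) ^ n := by
    rw [← mul_pow]
    exact pow_le_pow_left₀ hR (by rw [hS]; linarith) n
  calc wrightCoeff α β γ δ n * R ^ n ≤ G / (S ^ n * k ^ 2) * (S ^ n * (1 / 2) ^ n) := by
        unfold wrightCoeff
        gcongr
    _ = G / k ^ 2 * (1 / 2 : ℝ) ^ n := by field_simp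

/-- Taylor coefficients of the normalized four-parameter Wright function. -/
noncomputable def normWrightCoeff (α β γ δ : ℝ) : ℕ → ℂ
  | 0 => 0
  | n + 1 => (wrightCoeff α β γ δ n : ℂ)

theorem normWright_eq_tsum (hα : 0 < α) (hγ : 0 < γ) (hβ : 0 ≤ β) (hδ : 0 ≤ δ)
    (hβδ : 0 < β + δ) :
    normWright α β γ δ = fun z => ∑' n, normWrightCoeff α β γ δ n * z ^ n := by
  funext z
  have hs : Summable fun n => normWrightCoeff α β γ δ n * z ^ n := by
    rw [← summable_nat_add_iff 1]
    refine Summable.of_norm_bounded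
      ((summable_wrightCoeff_mul_pow hα hγ hβ hδ hβδ ‖z‖ (norm_nonneg z)).mul_right ‖z‖)
      fun n => le_of_eq ?_
    rw [normWrightCoeff, norm_mul, norm_pow, Complex.norm_real,
      Real.norm_of_nonneg (wrightCoeff_pos hα hγ hβ hδ n).le]
    ring
  rw [hs.tsum_eq_zero_add]
  simp only [normWrightCoeff, zero_mul, zero_add, normWright, wrightFun]
  rw [← tsum_mul_left]
  refine tsum_congr fun n => ?_
  simp only [wrightCoeff]
  push_cast
  ring

theorem summable_norm_normWrightCoeff (hα : 0 < α) (hγ : 0 < γ) (hβ : 0 ≤ β) (hδ : 0 ≤ δ)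
    (hβδ : 0 < β + δ) (R : ℝ) (hR : 0 ≤ R) :
    Summable fun n => ‖normWrightCoeff α β γ δ n‖ * R ^ n := by
  rw [← summable_nat_add_iff 1]
  refine ((summable_wrightCoeff_mul_pow hα hγ hβ hδ hβδ R hR).mul_right R).congr fun n => ?_
  rw [normWrightCoeff, Complex.norm_real, Real.norm_of_nonneg (wrightCoeff_pos hα hγ hβ hδ n).le]
  ring

theorem taylorCoeff_normWright (hα : 0 < α) (hγ : 0 < γ) (hβ : 0 ≤ β) (hδ : 0 ≤ δ)
    (hβδ : 0 < β + δ) (n : ℕ) :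
    taylorCoeff (normWright α β γ δ) n = normWrightCoeff α β γ δ n := by
  refine taylorCoeff_eq_of_hasSum one_pos (fun z _ => ?_) n
  rw [normWright_eq_tsum hα hγ hβ hδ hβδ]
  exact (summable_mul_pow_of_entire (summable_norm_normWrightCoeff hα hγ hβ hδ hβδ) z).hasSum

theorem hasSum_deriv_normWright_one (hα : 0 < α) (hγ : 0 < γ) (hβ : 0 ≤ β) (hδ : 0 ≤ δ)
    (hβδ : 0 < β + δ) :
    HasSum (fun n : ℕ => ((n : ℝ) + 1) * wrightCoeff α β γ δ n)
      (deriv (normWright α β γ δ) 1).re := by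
  have hc := summable_norm_normWrightCoeff hα hγ hβ hδ hβδ
  have h := (summable_mul_pow_of_entire (summable_succ_mul_norm_mul_pow hc) 1).hasSum
  rw [← deriv_tsum_mul_pow hc, ← normWright_eq_tsum hα hγ hβ hδ hβδ] at h
  have e : (fun n : ℕ => ((n : ℝ) + 1) * wrightCoeff α β γ δ n)
      = fun n : ℕ => (((n : ℂ) + 1) * normWrightCoeff α β γ δ (n + 1) * 1 ^ n).re := by
    funext n
    have : ((n : ℂ) + 1) * normWrightCoeff α β γ δ (n + 1) * 1 ^ n
        = (((n + 1) * wrightCoeff α β γ δ n : ℝ) : ℂ) := by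
      simp [normWrightCoeff]
    rw [this, Complex.ofReal_re]
  rw [e]
  exact Complex.hasSum_re h

theorem hasSum_iteratedDeriv_two_normWright_one (hα : 0 < α) (hγ : 0 < γ) (hβ : 0 ≤ β)
    (hδ : 0 ≤ δ) (hβδ : 0 < β + δ) :
    HasSum (fun n : ℕ => ((n : ℝ) + 1) * (n + 2) * wrightCoeff α β γ δ (n + 1))
      (iteratedDeriv 2 (normWright α β γ δ) 1).re := by
  have hc := summable_norm_normWrightCoeff hα hγ hβ hδ hβδ
  have hc1 := summable_succ_mul_norm_mul_pow hc
  have h := (summable_mul_pow_of_entire (summable_succ_mul_norm_mul_pow hc1) 1).hasSum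
  have hd : deriv (normWright α β γ δ)
      = fun z => ∑' n : ℕ, ((n : ℂ) + 1) * normWrightCoeff α β γ δ (n + 1) * z ^ n := by
    funext z
    rw [normWright_eq_tsum hα hγ hβ hδ hβδ, deriv_tsum_mul_pow hc]
  rw [← deriv_tsum_mul_pow hc1, ← hd] at h
  have e : (fun n : ℕ => ((n : ℝ) + 1) * (n + 2) * wrightCoeff α β γ δ (n + 1))
      = fun n : ℕ => (((n : ℂ) + 1) * ((((n + 1 : ℕ) : ℂ) + 1) *
          normWrightCoeff α β γ δ (n + 1 + 1)) * 1 ^ n).re := by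
    funext n
    have : ((n : ℂ) + 1) * ((((n + 1 : ℕ) : ℂ) + 1) *
          normWrightCoeff α β γ δ (n + 1 + 1)) * 1 ^ n
        = (((n + 1) * (n + 2) * wrightCoeff α β γ δ (n + 1) : ℝ) : ℂ) := by
      simp only [normWrightCoeff, one_pow, mul_one]
      push_cast
      ring
    rw [this, Complex.ofReal_re]
  rw [e, iteratedDeriv_succ, iteratedDeriv_one]
  exact Complex.hasSum_re h

end wright

/-! ### From coefficient bounds to close-to-convexity -/

/-- Functions whose coefficients obey the bounds for harmonic convex mappings are sent to
close-to-convex mappings by convolution with Wright functions. -/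
theorem hadamardProd_add_conj_mem_classCH {α₁ β₁ γ₁ δ₁ α₂ β₂ γ₂ δ₂ : ℝ} {σ : ℂ}
    (hα₁ : 0 < α₁) (hγ₁ : 0 < γ₁) (hα₂ : 0 < α₂) (hγ₂ : 0 < γ₂)
    (hβ₁ : 0 ≤ β₁) (hδ₁ : 0 ≤ δ₁) (hβ₂ : 0 ≤ β₂) (hδ₂ : 0 ≤ δ₂)
    (hconv₁ : 0 < β₁ + δ₁) (hconv₂ : 0 < β₂ + δ₂) (hσ : ‖σ‖ ≤ 1) {h g : ℂ → ℂ}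
    (hh0 : h 0 = 0) (hh1 : deriv h 0 = 1) (hg0 : g 0 = 0) (hg1 : deriv g 0 = 0)
    (hA : ∀ n : ℕ, ‖taylorCoeff h (n + 1)‖ ≤ (n + 2) / 2)
    (hB : ∀ n : ℕ, ‖taylorCoeff g (n + 1)‖ ≤ n / 2)
    (hineq : (iteratedDeriv 2 (normWright α₁ β₁ γ₁ δ₁) 1).re
      + 2 * (deriv (normWright α₁ β₁ γ₁ δ₁) 1).re
      + (iteratedDeriv 2 (normWright α₂ β₂ γ₂ δ₂) 1).re ≤ 4) :
    (fun z => hadamardProd h (normWright α₁ β₁ γ₁ δ₁) z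
      + (starRingEnd ℂ) (σ * hadamardProd g (normWright α₂ β₂ γ₂ δ₂) z)) ∈ classCH := by
  set w₁ := wrightCoeff α₁ β₁ γ₁ δ₁
  set w₂ := wrightCoeff α₂ β₂ γ₂ δ₂
  have hw₁ := wrightCoeff_pos hα₁ hγ₁ hβ₁ hδ₁
  have hw₂ := wrightCoeff_pos hα₂ hγ₂ hβ₂ hδ₂
  set a₀ : ℕ → ℂ := fun n => taylorCoeff h n * taylorCoeff (normWright α₁ β₁ γ₁ δ₁) n with ha₀
  -- The linear term of h * W₁ is split off, so that the remaining series starts in degree 2.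
  set a : ℕ → ℂ := fun n => if n < 2 then 0 else a₀ n with ha
  set b : ℕ → ℂ := fun n => σ * (taylorCoeff g n * taylorCoeff (normWright α₂ β₂ γ₂ δ₂) n) with hb
  have h11 := hasSum_deriv_normWright_one hα₁ hγ₁ hβ₁ hδ₁ hconv₁
  have h12 := hasSum_iteratedDeriv_two_normWright_one hα₁ hγ₁ hβ₁ hδ₁ hconv₁
  have h22 := hasSum_iteratedDeriv_two_normWright_one hα₂ hγ₂ hβ₂ hδ₂ hconv₂
  -- Removing the term n = 0, which equals 1, leaves W₁'(1) - 1. This is why the bound 4 becomes (4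
  -- - 2)/2 = 1 at the end.
  have h11' := (hasSum_nat_add_iff' 1).2 h11
  simp only [Finset.range_one, Finset.sum_singleton, Nat.cast_zero, zero_add, one_mul,
    wrightCoeff_zero hα₁ hγ₁] at h11'
  have hS1 := (h12.add (h11'.mul_left 2)).div_const 2
  have hS2 := h22.div_const 2
  -- The bound (n+2)(n+3)/2 splits as [(n+1)(n+2) + 2(n+2)]/2, matching the terms of W₁''(1) and
  -- W₁'(1).
  have hale : ∀ n : ℕ, ((n + 2 : ℕ) : ℝ) * ‖a (n + 2)‖
      ≤ (((n : ℝ) + 1) * (n + 2) * w₁ (n + 1) + 2 * ((((n + 1 : ℕ) : ℝ) + 1) * w₁ (n + 1))) / 2 := by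
    intro n
    have hAn := hA (n + 1)
    push_cast at hAn ⊢
    simp only [ha, ha₀, taylorCoeff_normWright hα₁ hγ₁ hβ₁ hδ₁ hconv₁, normWrightCoeff,
      show ¬ n + 2 < 2 by omega, if_false, norm_mul, Complex.norm_real,
      Real.norm_of_nonneg (hw₁ _).le]
    calc ((n : ℝ) + 2) * (‖taylorCoeff h (n + 2)‖ * w₁ (n + 1))
        ≤ ((n : ℝ) + 2) * (((n : ℝ) + 1 + 2) / 2 * w₁ (n + 1)) := by
          have := hw₁ (n + 1)
          gcongr
      _ = _ := by ring
  have hble : ∀ n : ℕ, ((n + 2 : ℕ) : ℝ) * ‖b (n + 2)‖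
      ≤ (((n : ℝ) + 1) * (n + 2) * w₂ (n + 1)) / 2 := by
    intro n
    have hBn := hB (n + 1)
    push_cast at hBn ⊢
    simp only [hb, taylorCoeff_normWright hα₂ hγ₂ hβ₂ hδ₂ hconv₂, normWrightCoeff,
      norm_mul, Complex.norm_real, Real.norm_of_nonneg (hw₂ _).le]
    calc ((n : ℝ) + 2) * (‖σ‖ * (‖taylorCoeff g (n + 2)‖ * w₂ (n + 1)))
        ≤ ((n : ℝ) + 2) * (1 * (((n : ℝ) + 1) / 2 * w₂ (n + 1))) := by
          have := hw₂ (n + 1)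
          gcongr
      _ = _ := by ring
  have ha2 : ∀ n < 2, a n = 0 := fun n hn => by simp only [ha, if_pos hn]
  have hb2 : ∀ n < 2, b n = 0 := fun n hn => by
    interval_cases n
    · simp [hb, taylorCoeff_zero_index, hg0]
    · simp [hb, taylorCoeff_one, hg1]
  have hsa' : Summable fun n : ℕ => ((n + 2 : ℕ) : ℝ) * ‖a (n + 2)‖ :=
    Summable.of_nonneg_of_le (fun n => by positivity) hale hS1.summable
  have hsb' : Summable fun n : ℕ => ((n + 2 : ℕ) : ℝ) * ‖b (n + 2)‖ :=
    Summable.of_nonneg_of_le (fun n => by positivity) hble hS2.summable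
  have hsa : Summable fun n : ℕ => (n : ℝ) * ‖a n‖ := (summable_nat_add_iff 2).1 hsa'
  have hsb : Summable fun n : ℕ => (n : ℝ) * ‖b n‖ := (summable_nat_add_iff 2).1 hsb'
  have hta := hsa.sum_add_tsum_nat_add 2
  have htb := hsb.sum_add_tsum_nat_add 2
  simp only [Finset.sum_range_succ, Finset.range_zero, Finset.sum_empty, ha2 0 (by norm_num),
    ha2 1 (by norm_num), hb2 0 (by norm_num), hb2 1 (by norm_num), norm_zero, mul_zero, add_zero,
    zero_add] at hta htb
  refine mem_classCH_of_tsum_le_one hsa hsb ha2 hb2 ?_ fun z hz => ?_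
  · rw [← hta, ← htb]
    have e1 := hsa'.tsum_le_tsum hale hS1.summable
    have e2 := hsb'.tsum_le_tsum hble hS2.summable
    rw [hS1.tsum_eq] at e1
    rw [hS2.tsum_eq] at e2
    linarith
  · have hz1 : ‖z‖ ≤ 1 := le_of_lt (by simpa [unitDisk] using hz)
    have hsz := summable_mul_pow_of_summable_natCast_mul hsa hz1
    have hsz' : Summable fun n => a₀ n * z ^ n := by
      rw [← summable_nat_add_iff 2] at hsz ⊢
      simpa [ha] using hsz
    congr 1
    · rw [hadamardProd, hsz'.sum_add_tsum_nat_add 2 |>.symm, ← hsz.sum_add_tsum_nat_add 2]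
      have e0 : a₀ 0 = 0 := by simp [ha₀, taylorCoeff_zero_index, hh0]
      have e1 : a₀ 1 = 1 := by
        simp only [ha₀, taylorCoeff_normWright hα₁ hγ₁ hβ₁ hδ₁ hconv₁, normWrightCoeff,
          taylorCoeff_one, hh1, wrightCoeff_zero hα₁ hγ₁]
        simp
      have e2 : ∀ n, a (n + 2) = a₀ (n + 2) := fun n => by simp [ha]
      simp only [Finset.sum_range_succ, Finset.range_zero, Finset.sum_empty, e0, e1, e2,
        ha2 0 (by norm_num), ha2 1 (by norm_num)]
      ring
    · rw [hadamardProd, ← tsum_mul_left]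
      simp only [hb, mul_assoc]

theorem HasSum.congr_of_eq {f g : ℕ → ℂ} {a b : ℂ} (h : HasSum f a) (hfg : ∀ n, g n = f n)
    (hab : b = a) : HasSum g b := by
  rwa [show g = f from funext hfg, hab]

/-! ### Analytic functions with nonnegative real part -/

section positiveRealPart

variable {p : ℂ → ℂ} {c : ℂ} {R : ℝ}

/-- This is Schwarz's lemma for the Cayley transform (p - p(c)) / (p + conj p(c)), which sends the
right half-plane to the disk and vanishes at c. -/
theorem norm_sub_le_mul_norm_add_conj_of_pos (hp : DifferentiableOn ℂ p (Metric.ball c R))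
    (hre : ∀ z ∈ Metric.ball c R, 0 < (p z).re) {z : ℂ} (hz : z ∈ Metric.ball c R) :
    ‖p z - p c‖ ≤ dist z c / R * ‖p z + (starRingEnd ℂ) (p c)‖ := by
  have hR : 0 < R := Metric.pos_of_mem_ball hz
  have hc : c ∈ Metric.ball c R := Metric.mem_ball_self hR
  have hne : ∀ w ∈ Metric.ball c R, p w + (starRingEnd ℂ) (p c) ≠ 0 := fun w hw h => by
    have h1 := congrArg Complex.re h
    simp only [Complex.add_re, Complex.conj_re, Complex.zero_re] at h1
    linarith [hre w hw, hre c hc]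
  set q : ℂ → ℂ := fun w => (p w - p c) / (p w + (starRingEnd ℂ) (p c)) with hq
  have hqc : q c = 0 := by simp [hq]
  have hqd : DifferentiableOn ℂ q (Metric.ball c R) :=
    (hp.sub_const _).div (hp.add_const _) hne
  have hmaps : Set.MapsTo q (Metric.ball c R) (Metric.closedBall (q c) 1) := by
    intro w hw
    rw [hqc, mem_closedBall_zero_iff, hq, norm_div,
      div_le_one (norm_pos_iff.2 (hne w hw))]
    apply le_of_sq_le_sq _ (norm_nonneg _)
    simp only [Complex.sq_norm, Complex.normSq_apply, Complex.sub_re, Complex.sub_im,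
      Complex.add_re, Complex.add_im, Complex.conj_re, Complex.conj_im]
    nlinarith [mul_pos (hre w hw) (hre c hc)]
  have h := Complex.dist_le_div_mul_dist_of_mapsTo_ball hqd hmaps hz
  rw [hqc, dist_zero_right, hq, norm_div, div_le_iff₀ (norm_pos_iff.2 (hne z hz))] at h
  refine h.trans_eq ?_
  ring

/-- Adding ε/2 to p restores strict positivity and leaves p z - p c unchanged. -/
theorem norm_sub_le_mul_norm_add_conj (hp : DifferentiableOn ℂ p (Metric.ball c R))
    (hre : ∀ z ∈ Metric.ball c R, 0 ≤ (p z).re) {z : ℂ} (hz : z ∈ Metric.ball c R) :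
    ‖p z - p c‖ ≤ dist z c / R * ‖p z + (starRingEnd ℂ) (p c)‖ := by
  have hR : 0 < R := Metric.pos_of_mem_ball hz
  have ht : dist z c / R ≤ 1 := (div_le_one hR).2 (le_of_lt hz)
  refine le_of_forall_pos_le_add fun ε hε => ?_
  have h := norm_sub_le_mul_norm_add_conj_of_pos (p := fun w => p w + ((ε / 2 : ℝ) : ℂ))
    (hp.add_const _) (fun w hw => by
      simpa using add_pos_of_nonneg_of_pos (hre w hw) (half_pos hε)) hz
  simp only [add_sub_add_right_eq_sub, map_add, Complex.conj_ofReal] at h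
  refine h.trans ?_
  have e : p z + ((ε / 2 : ℝ) : ℂ) + ((starRingEnd ℂ) (p c) + ((ε / 2 : ℝ) : ℂ))
      = (p z + (starRingEnd ℂ) (p c)) + (ε : ℂ) := by push_cast; ring
  rw [e]
  have h2 := norm_add_le (p z + (starRingEnd ℂ) (p c)) (ε : ℂ)
  rw [Complex.norm_real, Real.norm_of_nonneg hε.le] at h2
  calc _ ≤ dist z c / R * (‖p z + (starRingEnd ℂ) (p c)‖ + ε) := by gcongr
    _ ≤ _ := by rw [mul_add]; nlinarith

/-- The growth theorem for functions with nonnegative real part. -/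
theorem norm_sub_mul_le_of_re_nonneg (hp : DifferentiableOn ℂ p (Metric.ball c R))
    (hre : ∀ z ∈ Metric.ball c R, 0 ≤ (p z).re) {z : ℂ} (hz : z ∈ Metric.ball c R) :
    ‖p z - p c‖ * (1 - dist z c / R) ≤ 2 * (p c).re * (dist z c / R) := by
  have hR : 0 < R := Metric.pos_of_mem_ball hz
  have h := norm_sub_le_mul_norm_add_conj hp hre hz
  have e : p z + (starRingEnd ℂ) (p c) = (p z - p c) + ((2 * (p c).re : ℝ) : ℂ) := by
    rw [← Complex.add_conj]; ring
  have h2 := norm_add_le (p z - p c) ((2 * (p c).re : ℝ) : ℂ)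
  rw [← e, Complex.norm_real,
    Real.norm_of_nonneg (by linarith [hre c (Metric.mem_ball_self hR)])] at h2
  have h3 := mul_le_mul_of_nonneg_left h2 (div_nonneg (dist_nonneg (x := z) (y := c)) hR.le)
  nlinarith

/-- Harnack's inequality. -/
theorem re_mul_le_of_re_nonneg (hp : DifferentiableOn ℂ p (Metric.ball c R))
    (hre : ∀ z ∈ Metric.ball c R, 0 ≤ (p z).re) {z : ℂ} (hz : z ∈ Metric.ball c R) :
    (p c).re * (1 - dist z c / R) ≤ (p z).re * (1 + dist z c / R) := by
  have hR : 0 < R := Metric.pos_of_mem_ball hz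
  have h := norm_sub_le_mul_norm_add_conj hp hre hz
  have ht : dist z c / R ≤ 1 := (div_le_one hR).2 (le_of_lt hz)
  have ht0 : 0 ≤ dist z c / R := by positivity
  set t := dist z c / R
  have h1 := hre c (Metric.mem_ball_self hR)
  have h2 := hre z hz
  have h3 := pow_le_pow_left₀ (norm_nonneg _) h 2
  rw [mul_pow] at h3
  simp only [Complex.sq_norm, Complex.normSq_apply, Complex.sub_re, Complex.sub_im,
      Complex.add_re, Complex.add_im, Complex.conj_re, Complex.conj_im] at h3
  have ht2 : t ^ 2 ≤ 1 := pow_le_one₀ ht0 ht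
  have h4 : ((p c).re - (p z).re) ^ 2 ≤ (t * ((p z).re + (p c).re)) ^ 2 := by
    nlinarith [mul_nonneg (sub_nonneg.2 ht2) (sq_nonneg ((p z).im - (p c).im))]
  have h5 := abs_le_of_sq_le_sq h4 (by positivity)
  have := (le_abs_self _).trans h5
  linarith

/-- The growth theorem is a Lipschitz bound at the centre, whose constant tends to 2 Re p(c) / R as
the neighbourhood shrinks. -/
theorem norm_deriv_le_of_re_nonneg (hR : 0 < R) (hp : DifferentiableOn ℂ p (Metric.ball c R))
    (hre : ∀ z ∈ Metric.ball c R, 0 ≤ (p z).re) : ‖deriv p c‖ ≤ 2 * (p c).re / R := by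
  have hk := hre c (Metric.mem_ball_self hR)
  have key : ∀ t ∈ Set.Ioo (0 : ℝ) 1, ‖deriv p c‖ ≤ 2 * (p c).re / R / (1 - t) := by
    rintro t ⟨ht0, ht1⟩
    refine norm_deriv_le_of_lip' (div_nonneg (by positivity) (by linarith)) ?_
    filter_upwards [Metric.ball_mem_nhds c (mul_pos ht0 hR)] with z hz
    have hz' : dist z c < t * R := hz
    have hzt : dist z c / R < t := (div_lt_iff₀ hR).2 hz'
    have hzb : z ∈ Metric.ball c R := lt_trans hz' (by nlinarith)
    have h := norm_sub_mul_le_of_re_nonneg hp hre hzb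
    rw [← dist_eq_norm z c, div_mul_eq_mul_div, le_div_iff₀ (by linarith)]
    calc ‖p z - p c‖ * (1 - t) ≤ ‖p z - p c‖ * (1 - dist z c / R) := by gcongr
      _ ≤ _ := h.trans_eq (by ring)
  have hlim : Filter.Tendsto (fun t : ℝ => 2 * (p c).re / R / (1 - t)) (nhdsWithin 0 (Set.Ioi 0))
      (nhds (2 * (p c).re / R)) := by
    have : ContinuousAt (fun t : ℝ => 2 * (p c).re / R / (1 - t)) 0 :=
      ContinuousAt.div (by fun_prop) (by fun_prop) (by norm_num)
    have h := this.tendsto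
    simp only [sub_zero, div_one] at h
    exact h.mono_left nhdsWithin_le_nhds
  refine ge_of_tendsto hlim ?_
  filter_upwards [Ioo_mem_nhdsGT (zero_lt_one (α := ℝ))] with t ht using key t ht

end positiveRealPart

/-! ### Cauchy integrals on circles and Carathéodory's bound -/

section circle

variable {p : ℂ → ℂ} {r : ℝ}

theorem continuous_comp_circleMap (hp : DifferentiableOn ℂ p unitDisk) (hr : 0 < r) (hr1 : r < 1) :
    Continuous fun θ => p (circleMap 0 r θ) :=
  hp.continuousOn.comp_continuous (continuous_circleMap 0 r) fun θ => by
    simpa [unitDisk, abs_of_pos hr] using hr1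

theorem integral_mul_inv_circleMap_pow (hp : DifferentiableOn ℂ p unitDisk)
    (hr : 0 < r) (hr1 : r < 1) (n : ℕ) :
    ∫ θ in (0 : ℝ)..2 * Real.pi, p (circleMap 0 r θ) * (circleMap 0 r θ ^ n)⁻¹
      = 2 * Real.pi * taylorCoeff p n := by
  have hsub : Metric.closedBall (0 : ℂ) r ⊆ unitDisk := Metric.closedBall_subset_ball hr1
  have h := DifferentiableOn.circleIntegral_one_div_sub_center_pow_smul (c := 0) (f := p) hr
    n (hp.mono hsub)
  rw [circleIntegral] at h
  have e : (fun θ => deriv (circleMap 0 r) θ • (1 / (circleMap 0 r θ - 0) ^ (n + 1)) •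
      p (circleMap 0 r θ)) = fun θ => Complex.I *
        (p (circleMap 0 r θ) * (circleMap 0 r θ ^ n)⁻¹) := by
    funext θ
    have h0 : circleMap 0 r θ ≠ 0 := circleMap_ne_center hr.ne'
    simp only [deriv_circleMap, smul_eq_mul, sub_zero, pow_succ]
    field_simp
  rw [e, intervalIntegral.integral_const_mul] at h
  apply mul_left_cancel₀ Complex.I_ne_zero
  rw [h, taylorCoeff, smul_eq_mul]
  ring

theorem integral_mul_circleMap_pow (hp : DifferentiableOn ℂ p unitDisk)
    (hr : 0 < r) (hr1 : r < 1) {n : ℕ} (hn : n ≠ 0) :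
    ∫ θ in (0 : ℝ)..2 * Real.pi, p (circleMap 0 r θ) * circleMap 0 r θ ^ n = 0 := by
  obtain ⟨m, rfl⟩ := Nat.exists_eq_succ_of_ne_zero hn
  have hsub : Metric.closedBall (0 : ℂ) r ⊆ unitDisk := Metric.closedBall_subset_ball hr1
  have hd : DifferentiableOn ℂ (fun z => p z * z ^ m) (Metric.closedBall 0 r) :=
    (hp.mono hsub).mul (by fun_prop)
  have h := (hd.diffContOnCl_ball subset_rfl).circleIntegral_eq_zero hr.le
  rw [circleIntegral] at h
  have e : (fun θ => deriv (circleMap 0 r) θ • (p (circleMap 0 r θ) * circleMap 0 r θ ^ m))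
      = fun θ => Complex.I * (p (circleMap 0 r θ) * circleMap 0 r θ ^ (m + 1)) := by
    funext θ
    simp only [deriv_circleMap, smul_eq_mul]
    ring
  rw [e, intervalIntegral.integral_const_mul] at h
  exact (mul_eq_zero.1 h).resolve_left Complex.I_ne_zero

end circle

/-- Carathéodory's coefficient bound. -/
theorem norm_taylorCoeff_le_of_re_nonneg {p : ℂ → ℂ} (hp : DifferentiableOn ℂ p unitDisk)
    (hre : ∀ z ∈ unitDisk, 0 ≤ (p z).re) {n : ℕ} (hn : n ≠ 0) :
    ‖taylorCoeff p n‖ ≤ 2 * (p 0).re := by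
  have key : ∀ r ∈ Set.Ioo (0 : ℝ) 1, ‖taylorCoeff p n‖ * r ^ n ≤ 2 * (p 0).re := by
    rintro r ⟨hr, hr1⟩
    have hcont := continuous_comp_circleMap hp hr hr1
    have hcm : Continuous (circleMap 0 r) := continuous_circleMap 0 r
    have hne : ∀ θ, circleMap 0 r θ ≠ 0 := fun θ => circleMap_ne_center hr.ne'
    have hnorm : ∀ θ, ‖circleMap 0 r θ‖ = r := fun θ => by simp [abs_of_pos hr]
    have hA := integral_mul_inv_circleMap_pow hp hr hr1 n
    have hB := integral_mul_circleMap_pow hp hr hr1 hn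
    have h0 := integral_mul_inv_circleMap_pow hp hr hr1 0
    simp only [pow_zero, inv_one, mul_one, taylorCoeff_zero_index] at h0
    -- On |z| = r one has conj z = r²/z, so this is a multiple of the conjugate of a vanishing
    -- Cauchy integral. Hence 2 Re p may replace p in the coefficient formula.
    have hB' : ∫ θ in (0 : ℝ)..2 * Real.pi,
        (starRingEnd ℂ) (p (circleMap 0 r θ)) * (circleMap 0 r θ ^ n)⁻¹ = 0 := by
      have e : (fun θ => (starRingEnd ℂ) (p (circleMap 0 r θ)) * (circleMap 0 r θ ^ n)⁻¹)
          = fun θ => ((r : ℂ) ^ (2 * n))⁻¹ *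
            (starRingEnd ℂ) (p (circleMap 0 r θ) * circleMap 0 r θ ^ n) := by
        funext θ
        have hc : (starRingEnd ℂ) (circleMap 0 r θ) = (r : ℂ) ^ 2 * (circleMap 0 r θ)⁻¹ := by
          rw [eq_mul_inv_iff_mul_eq₀ (hne θ), mul_comm, Complex.mul_conj, Complex.normSq_eq_norm_sq,
            hnorm]
          push_cast; rfl
        have hr0 : (r : ℂ) ≠ 0 := by exact_mod_cast hr.ne'
        rw [map_mul, map_pow, hc, mul_pow, ← pow_mul, inv_pow]
        field_simp
      rw [e, intervalIntegral.integral_const_mul]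
      have : ∫ θ in (0 : ℝ)..2 * Real.pi, (starRingEnd ℂ) (p (circleMap 0 r θ) *
          circleMap 0 r θ ^ n) = (starRingEnd ℂ) (∫ θ in (0 : ℝ)..2 * Real.pi,
            p (circleMap 0 r θ) * circleMap 0 r θ ^ n) := by
        rw [intervalIntegral.integral_of_le Real.two_pi_pos.le,
          intervalIntegral.integral_of_le Real.two_pi_pos.le, integral_conj]
      rw [this, hB, map_zero, mul_zero]
    have hsum : ∫ θ in (0 : ℝ)..2 * Real.pi,
        ((2 * (p (circleMap 0 r θ)).re : ℝ) : ℂ) * (circleMap 0 r θ ^ n)⁻¹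
        = 2 * Real.pi * taylorCoeff p n := by
      have hi : Continuous fun θ => (circleMap 0 r θ ^ n)⁻¹ :=
        (hcm.pow n).inv₀ fun θ => pow_ne_zero _ (hne θ)
      have hadd := intervalIntegral.integral_add (μ := MeasureTheory.volume)
        ((hcont.mul hi).intervalIntegrable 0 (2 * Real.pi))
        (((Complex.continuous_conj.comp hcont).mul hi).intervalIntegrable 0 (2 * Real.pi))
      simp only [Pi.mul_apply, Function.comp_apply] at hadd
      rw [hA, hB', add_zero] at hadd
      rw [← hadd]
      refine intervalIntegral.integral_congr fun θ _ => ?_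
      change _ = p (circleMap 0 r θ) * _ + (starRingEnd ℂ) (p (circleMap 0 r θ)) * _
      rw [← add_mul, Complex.add_conj]
    have hle : ‖(2 * Real.pi * taylorCoeff p n : ℂ)‖
        ≤ ∫ θ in (0 : ℝ)..2 * Real.pi, 2 * (p (circleMap 0 r θ)).re * (r ^ n)⁻¹ := by
      rw [← hsum]
      refine (intervalIntegral.norm_integral_le_integral_norm Real.two_pi_pos.le).trans_eq ?_
      refine intervalIntegral.integral_congr fun θ _ => ?_
      change ‖((2 * (p (circleMap 0 r θ)).re : ℝ) : ℂ) * (circleMap 0 r θ ^ n)⁻¹‖ = _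
      rw [norm_mul, Complex.norm_real, norm_inv, norm_pow, hnorm, Real.norm_of_nonneg]
      have := hre (circleMap 0 r θ) (by simpa [unitDisk, abs_of_pos hr] using hr1)
      linarith
    have hmean : ∫ θ in (0 : ℝ)..2 * Real.pi, (p (circleMap 0 r θ)).re
        = 2 * Real.pi * (p 0).re := by
      have h1 := congrArg Complex.re h0
      rw [intervalIntegral.integral_of_le Real.two_pi_pos.le] at h1 ⊢
      have hint : MeasureTheory.Integrable (fun θ => p (circleMap 0 r θ))
          (MeasureTheory.volume.restrict (Set.Ioc 0 (2 * Real.pi))) :=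
        (hcont.intervalIntegrable 0 (2 * Real.pi)).1
      have h2 := integral_re hint
      simp only [RCLike.re_to_complex] at h2
      rw [h2, h1]
      simp
    have h2 : ∫ θ in (0 : ℝ)..2 * Real.pi, 2 * (p (circleMap 0 r θ)).re * (r ^ n)⁻¹
        = 2 * (2 * Real.pi * (p 0).re) * (r ^ n)⁻¹ := by
      rw [intervalIntegral.integral_mul_const, intervalIntegral.integral_const_mul, hmean]
    rw [h2, norm_mul] at hle
    have h3 : ‖(2 * Real.pi : ℂ)‖ = 2 * Real.pi := by
      have : (2 * Real.pi : ℂ) = ((2 * Real.pi : ℝ) : ℂ) := by push_cast; rfl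
      rw [this, Complex.norm_real, Real.norm_of_nonneg Real.two_pi_pos.le]
    rw [h3, ← div_eq_mul_inv, le_div_iff₀ (by positivity)] at hle
    nlinarith [Real.two_pi_pos]
  have hlim : Filter.Tendsto (fun r : ℝ => ‖taylorCoeff p n‖ * r ^ n) (nhdsWithin 1 (Set.Iio 1))
      (nhds (‖taylorCoeff p n‖ * 1 ^ n)) :=
    ((continuous_const.mul (continuous_pow n)).tendsto 1).mono_left nhdsWithin_le_nhds
  rw [one_pow, mul_one] at hlim
  refine le_of_tendsto hlim ?_
  filter_upwards [Ioo_mem_nhdsLT (zero_lt_one (α := ℝ))] with r hr using key r hr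

/-! ### Coefficient bounds from the half-plane condition -/

section products

variable {u v : ℂ → ℂ}

theorem contDiffAt_zero_of_differentiableOn (hu : DifferentiableOn ℂ u unitDisk) (n : ℕ) :
    ContDiffAt ℂ n u 0 :=
  (hu.analyticAt (Metric.ball_mem_nhds 0 one_pos)).contDiffAt

theorem taylorCoeff_mul (hu : DifferentiableOn ℂ u unitDisk) (hv : DifferentiableOn ℂ v unitDisk)
    (n : ℕ) : taylorCoeff (fun z => u z * v z) n
      = ∑ i ∈ Finset.range (n + 1), taylorCoeff u i * taylorCoeff v (n - i) := by
  rw [taylorCoeff, iteratedDeriv_fun_mul (contDiffAt_zero_of_differentiableOn hu n)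
    (contDiffAt_zero_of_differentiableOn hv n), Finset.sum_div]
  refine Finset.sum_congr rfl fun i hi => ?_
  have hi' : i ≤ n := Nat.lt_succ_iff.1 (Finset.mem_range.1 hi)
  have h := Nat.choose_mul_factorial_mul_factorial hi'
  have h' : ((n.choose i : ℕ) : ℂ) * (i.factorial : ℂ) * ((n - i).factorial : ℂ)
      = (n.factorial : ℂ) := by exact_mod_cast h
  have h1 : (i.factorial : ℂ) ≠ 0 := by exact_mod_cast i.factorial_ne_zero
  have h2 : ((n - i).factorial : ℂ) ≠ 0 := by exact_mod_cast (n - i).factorial_ne_zero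
  have h3 : (n.factorial : ℂ) ≠ 0 := by exact_mod_cast n.factorial_ne_zero
  simp only [taylorCoeff]
  rw [div_mul_div_comm, div_eq_div_iff h3 (mul_ne_zero h1 h2), ← h']
  ring

theorem taylorCoeff_const_mul (a : ℂ) (n : ℕ) :
    taylorCoeff (fun z => a * u z) n = a * taylorCoeff u n := by
  simp only [taylorCoeff, iteratedDeriv_const_mul_field]
  ring

theorem taylorCoeff_deriv (n : ℕ) :
    taylorCoeff (deriv u) n = (n + 1) * taylorCoeff u (n + 1) := by
  have h1 : (n.factorial : ℂ) ≠ 0 := by exact_mod_cast n.factorial_ne_zero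
  have h2 : (n : ℂ) + 1 ≠ 0 := by exact_mod_cast n.succ_ne_zero
  simp only [taylorCoeff, iteratedDeriv_succ', Nat.factorial_succ]
  push_cast
  field_simp

end products

/-- Coefficients of an analytic function whose product with a unimodular multiple of
`1 - b z ^ 2` has nonnegative real part. -/
theorem norm_taylorCoeff_le_of_re_mul_nonneg {Φ : ℂ → ℂ} (hΦ : DifferentiableOn ℂ Φ unitDisk)
    {b : ℂ} (hb : ‖b‖ = 1) (h0 : ‖Φ 0‖ = 1)
    (hre : ∀ z ∈ unitDisk, 0 ≤ (Φ z * (b - (starRingEnd ℂ) b * z ^ 2)).re) (n : ℕ) :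
    ‖taylorCoeff Φ n‖ ≤ n + 1 := by
  set P : ℂ → ℂ := fun z => Φ z * (b - (starRingEnd ℂ) b * z ^ 2) with hP
  have hPd : DifferentiableOn ℂ P unitDisk := hΦ.mul (by fun_prop)
  have hcoef : ∀ n, taylorCoeff P n = b * taylorCoeff Φ n
      - (if n < 2 then 0 else (starRingEnd ℂ) b * taylorCoeff Φ (n - 2)) := by
    refine taylorCoeff_eq_of_hasSum one_pos fun z hz => ?_
    have h1 := hasSum_taylorCoeff_mul_pow hΦ hz
    have h2 : HasSum (fun n => (if n < 2 then 0 else (starRingEnd ℂ) b * taylorCoeff Φ (n - 2)) *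
        z ^ n) ((starRingEnd ℂ) b * z ^ 2 * Φ z) := by
      rw [← hasSum_nat_add_iff' 2]
      simp only [Finset.sum_range_succ, Finset.range_zero, Finset.sum_empty]
      have h3 := h1.mul_left ((starRingEnd ℂ) b * z ^ 2)
      refine h3.congr_of_eq (fun n => ?_) (by simp)
      simp only [show ¬ n + 2 < 2 by omega, if_false, Nat.add_sub_cancel]
      ring
    refine ((h1.mul_left b).sub h2).congr_of_eq (fun n => by ring) ?_
    simp only [hP]; ring
  -- Together with bΦ_n = P_n + conj(b) Φ_{n-2}, this raises the bound for |Φ_n| by 2 every two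
  -- steps, starting from 1 and 2.
  have hPn : ∀ n, ‖taylorCoeff P (n + 1)‖ ≤ 2 := fun n => by
    refine (norm_taylorCoeff_le_of_re_nonneg hPd hre n.succ_ne_zero).trans ?_
    have h1 := Complex.re_le_norm (P 0)
    have h2 : ‖P 0‖ = 1 := by simp [hP, hb, h0]
    linarith
  induction n using Nat.twoStepInduction with
  | zero => simp [taylorCoeff_zero_index, h0]
  | one =>
    have h1 := hPn 0
    rw [hcoef] at h1
    simp only [zero_add, show 1 < 2 by norm_num, if_true, sub_zero, norm_mul, hb, one_mul] at h1
    push_cast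
    linarith
  | more n ih _ =>
    have h1 := hPn (n + 1)
    rw [hcoef] at h1
    simp only [show ¬ n + 1 + 1 < 2 by omega, if_false] at h1
    have h2 := norm_sub_norm_le (b * taylorCoeff Φ (n + 1 + 1))
      ((starRingEnd ℂ) b * taylorCoeff Φ (n + 1 + 1 - 2))
    simp only [norm_mul, hb, RCLike.norm_conj, one_mul] at h2
    have h3 : n + 1 + 1 - 2 = n := by omega
    rw [h3] at h1 h2
    push_cast
    have : ‖taylorCoeff Φ (n + 1 + 1)‖ = ‖taylorCoeff Φ (n + 2)‖ := rfl
    linarith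

theorem sum_range_succ_eq (n : ℕ) :
    ∑ i ∈ Finset.range (n + 1), ((i : ℝ) + 1) = (n + 1) * (n + 2) / 2 := by
  induction n with
  | zero => norm_num
  | succ n ih => rw [Finset.sum_range_succ, ih]; push_cast; ring

/-- The coefficient bounds of Clunie and Sheil-Small, from their half-plane condition. -/
theorem norm_taylorCoeff_le_of_re_mul_add_mul_nonneg {h g : ℂ → ℂ}
    (hh : DifferentiableOn ℂ h unitDisk) (hg : DifferentiableOn ℂ g unitDisk)
    (hlt : ∀ z ∈ unitDisk, ‖deriv g z‖ < ‖deriv h z‖) (hh1 : deriv h 0 = 1) (hg1 : deriv g 0 = 0)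
    {a b : ℂ} (ha : ‖a‖ = 1) (hb : ‖b‖ = 1)
    (hre : ∀ z ∈ unitDisk, 0 ≤ ((a * deriv h z + (starRingEnd ℂ) a * deriv g z) *
      (b - (starRingEnd ℂ) b * z ^ 2)).re) (n : ℕ) :
    ‖taylorCoeff h (n + 1)‖ ≤ (n + 2) / 2 ∧ ‖taylorCoeff g (n + 1)‖ ≤ n / 2 := by
  have hopen : IsOpen unitDisk := Metric.isOpen_ball
  have h0 : (0 : ℂ) ∈ unitDisk := by simp [unitDisk]
  have hh' := hh.deriv hopen
  have hg' := hg.deriv hopen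
  have hca : ‖(starRingEnd ℂ) a‖ = 1 := by rw [RCLike.norm_conj, ha]
  set U : ℂ → ℂ := fun z => a * deriv h z with hU
  set V : ℂ → ℂ := fun z => (starRingEnd ℂ) a * deriv g z with hV
  set Φ : ℂ → ℂ := fun z => U z + V z with hΦ
  have hUd : DifferentiableOn ℂ U unitDisk := hh'.const_mul a
  have hVd : DifferentiableOn ℂ V unitDisk := hg'.const_mul _
  have hΦd : DifferentiableOn ℂ Φ unitDisk := hUd.add hVd
  have hUV : ∀ z ∈ unitDisk, ‖V z‖ < ‖U z‖ := fun z hz => by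
    simp only [hU, hV, norm_mul, ha, hca, one_mul]
    exact hlt z hz
  have hΦ0 : ∀ z ∈ unitDisk, Φ z ≠ 0 := fun z hz h => by
    have h1 : U z = -V z := eq_neg_of_add_eq_zero_left h
    have h2 := hUV z hz
    rw [h1, norm_neg] at h2
    exact lt_irrefl _ h2
  have hΦn := norm_taylorCoeff_le_of_re_mul_nonneg hΦd hb (by simp [hΦ, hU, hV, hh1, hg1, ha]) hre
  -- The real part of p is nonnegative because |V| < |U|, and p(0) = 1 because g'(0) = 0. Then U =
  -- (Φ + pΦ)/2 and V = (Φ - pΦ)/2.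
  set p : ℂ → ℂ := fun z => (U z - V z) / Φ z with hp
  have hpd : DifferentiableOn ℂ p unitDisk := (hUd.sub hVd).div hΦd hΦ0
  have hpre : ∀ z ∈ unitDisk, 0 ≤ (p z).re := fun z hz => by
    have h1 : (p z).re = (‖U z‖ ^ 2 - ‖V z‖ ^ 2) / Complex.normSq (Φ z) := by
      simp only [hp, hΦ, Complex.div_re, Complex.sq_norm, Complex.normSq_apply, Complex.sub_re,
        Complex.sub_im, Complex.add_re, Complex.add_im]
      ring
    rw [h1]
    have := pow_le_pow_left₀ (norm_nonneg _) (hUV z hz).le 2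
    exact div_nonneg (by linarith) (Complex.normSq_nonneg _)
  have hp0 : p 0 = 1 := by
    have : a ≠ 0 := fun h => by simp [h] at ha
    simp [hp, hΦ, hU, hV, hh1, hg1, this]
  have hpn : ∀ n, ‖taylorCoeff p (n + 1)‖ ≤ 2 := fun n =>
    (norm_taylorCoeff_le_of_re_nonneg hpd hpre n.succ_ne_zero).trans (by simp [hp0])
  have hpΦ := taylorCoeff_mul hpd hΦd
  have hadd : ∀ {F : ℂ → ℂ}, DifferentiableOn ℂ F unitDisk → ∀ (s : ℂ),
      Set.EqOn F (fun z => (1 / 2) * Φ z + s * (p z * Φ z)) unitDisk → ∀ n,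
      taylorCoeff F n = (1 / 2) * taylorCoeff Φ n
        + s * ∑ i ∈ Finset.range (n + 1), taylorCoeff p i * taylorCoeff Φ (n - i) := by
    intro F hF s hEq
    refine taylorCoeff_eq_of_hasSum one_pos fun z hz => ?_
    rw [hEq hz]
    have h1 := (hasSum_taylorCoeff_mul_pow hΦd hz).mul_left (1 / 2)
    have h2 := (hasSum_taylorCoeff_mul_pow (hpd.mul hΦd) hz).mul_left s
    refine (h1.add h2).congr_of_eq (fun n => ?_) rfl
    have := hpΦ n
    simp only [Pi.mul_def]
    rw [this]
    ring
  -- The term i = 0 is Φ_n. It survives in U and cancels in V, which accounts for the difference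
  -- between the two bounds.
  have hsplit : ∀ n, ∑ i ∈ Finset.range (n + 1), taylorCoeff p i * taylorCoeff Φ (n - i)
      = ∑ i ∈ Finset.range n, taylorCoeff p (i + 1) * taylorCoeff Φ (n - (i + 1))
        + taylorCoeff Φ n := fun n => by
    rw [Finset.sum_range_succ', taylorCoeff_zero_index, hp0, one_mul, Nat.sub_zero]
  -- From |p_i| ≤ 2 and |Φ_k| ≤ k + 1 the sum is at most 2(1 + ... + n).
  have hrest : ‖∑ i ∈ Finset.range n, taylorCoeff p (i + 1) * taylorCoeff Φ (n - (i + 1))‖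
      ≤ n * (n + 1) := by
    refine (norm_sum_le _ _).trans ?_
    calc ∑ i ∈ Finset.range n, ‖taylorCoeff p (i + 1) * taylorCoeff Φ (n - (i + 1))‖
        ≤ ∑ i ∈ Finset.range n, 2 * (((n - 1 - i : ℕ) : ℝ) + 1) := by
          refine Finset.sum_le_sum fun i hi => ?_
          rw [norm_mul]
          have e : n - (i + 1) = n - 1 - i := by omega
          have := hΦn (n - 1 - i)
          rw [e]
          exact mul_le_mul (hpn i) this (norm_nonneg _) (by norm_num)
      _ = ∑ i ∈ Finset.range n, 2 * ((i : ℝ) + 1) :=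
          Finset.sum_range_reflect (fun i => 2 * ((i : ℝ) + 1)) n
      _ = n * (n + 1) := by
          rw [← Finset.mul_sum]
          rcases n with _ | m
          · simp
          · rw [sum_range_succ_eq]; push_cast; ring
  have hn1 : ‖((n : ℂ) + 1)‖ = (n : ℝ) + 1 := by
    have : ((n : ℂ) + 1) = ((n + 1 : ℝ) : ℂ) := by push_cast; rfl
    rw [this, Complex.norm_real, Real.norm_of_nonneg (by positivity)]
  have hn0 : (0 : ℝ) < n + 1 := by positivity
  constructor
  · have h1 := hadd hUd (1 / 2) (fun z hz => by
      simp only [hp]; rw [div_mul_cancel₀ _ (hΦ0 z hz)]; simp only [hΦ]; ring) n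
    rw [hsplit, hU, taylorCoeff_const_mul, taylorCoeff_deriv] at h1
    have h2 := congrArg norm h1
    rw [norm_mul, norm_mul, ha, one_mul, hn1] at h2
    set S := ∑ i ∈ Finset.range n, taylorCoeff p (i + 1) * taylorCoeff Φ (n - (i + 1))
    have h3 : (1 / 2 : ℂ) * taylorCoeff Φ n + 1 / 2 * (S + taylorCoeff Φ n)
        = (1 / 2 : ℂ) * S + taylorCoeff Φ n := by ring
    rw [h3] at h2
    have h4 := norm_add_le ((1 / 2 : ℂ) * S) (taylorCoeff Φ n)
    rw [norm_mul] at h4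
    norm_num at h4
    have := hΦn n
    nlinarith
  · have h1 := hadd hVd (-(1 / 2)) (fun z hz => by
      simp only [hp]; rw [div_mul_cancel₀ _ (hΦ0 z hz)]; simp only [hΦ]; ring) n
    rw [hsplit, hV, taylorCoeff_const_mul, taylorCoeff_deriv] at h1
    have h2 := congrArg norm h1
    rw [norm_mul, norm_mul, hca, one_mul, hn1] at h2
    set S := ∑ i ∈ Finset.range n, taylorCoeff p (i + 1) * taylorCoeff Φ (n - (i + 1))
    have h3 : (1 / 2 : ℂ) * taylorCoeff Φ n + -(1 / 2) * (S + taylorCoeff Φ n)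
        = -(1 / 2 : ℂ) * S := by ring
    rw [h3, norm_mul] at h2
    norm_num at h2
    nlinarith

/-! ### Normal families and Hurwitz's theorem -/

/-- Montel's theorem, along an ultrafilter. -/
theorem exists_tendstoLocallyUniformlyOn_of_mapsTo_closedBall {ι : Type*} (l : Ultrafilter ι)
    {U : Set ℂ} (hU : IsOpen U) {F : ι → ℂ → ℂ} (hF : ∀ i, DifferentiableOn ℂ (F i) U)
    (hb : ∀ i, ∀ z ∈ U, ‖F i z‖ ≤ 1) : ∃ G : ℂ → ℂ, TendstoLocallyUniformlyOn F G l U := by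
  -- Along an ultrafilter, compactness of the closed disk gives pointwise limits without extracting
  -- subsequences. Schwarz's lemma supplies a uniform local Lipschitz constant that makes the
  -- convergence locally uniform.
  have hlim : ∀ z : ℂ, ∃ w : ℂ, z ∈ U → Tendsto (fun i => F i z) l (𝓝 w) := by
    intro z
    by_cases hz : z ∈ U
    · obtain ⟨w, -, hw⟩ := (isCompact_closedBall (0 : ℂ) 1).ultrafilter_le_nhds
        (l.map fun i => F i z) (by
          rw [le_principal_iff]
          exact mem_map.2 (Eventually.of_forall fun i => by simpa using hb i z hz))
      exact ⟨w, fun _ => hw⟩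
    · exact ⟨0, fun h => absurd h hz⟩
  choose G hG using hlim
  refine ⟨G, Metric.tendstoLocallyUniformlyOn_iff.2 fun ε hε x hx => ?_⟩
  obtain ⟨R, hR, hRU⟩ := Metric.isOpen_iff.1 hU x hx
  have hlip : ∀ i, ∀ y ∈ Metric.ball x R, dist (F i y) (F i x) ≤ 2 / R * dist y x := by
    intro i y hy
    refine Complex.dist_le_div_mul_dist_of_mapsTo_ball ((hF i).mono hRU) (fun w hw => ?_) hy
    rw [Metric.mem_closedBall, dist_eq_norm]
    refine (norm_sub_le _ _).trans ?_
    linarith [hb i w (hRU hw), hb i x hx]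
  have hlipG : ∀ y ∈ Metric.ball x R, dist (G y) (G x) ≤ 2 / R * dist y x := fun y hy =>
    le_of_tendsto ((hG y (hRU hy)).dist (hG x hx)) (Eventually.of_forall fun i => hlip i y hy)
  refine ⟨Metric.ball x (min R (ε * R / 8)),
    mem_nhdsWithin_of_mem_nhds (Metric.ball_mem_nhds x (by positivity)), ?_⟩
  filter_upwards [(hG x hx).eventually (Metric.ball_mem_nhds (G x) (half_pos hε))] with i hi y hy
  have hyR : y ∈ Metric.ball x R := Metric.ball_subset_ball (min_le_left _ _) hy
  have hy2 : dist y x < ε * R / 8 := lt_of_lt_of_le hy (min_le_right _ _)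
  have h3 : 2 / R * dist y x < ε / 4 := by
    calc 2 / R * dist y x < 2 / R * (ε * R / 8) := by gcongr
      _ = ε / 4 := by field_simp; ring
  have h1 := hlip i y hyR
  have h2 := hlipG y hyR
  have h4 : dist (F i x) (G x) < ε / 2 := hi
  calc dist (G y) (F i y) ≤ dist (G y) (G x) + dist (G x) (F i x) + dist (F i x) (F i y) :=
        dist_triangle4 _ _ _ _
    _ < ε := by rw [dist_comm (G x), dist_comm (F i x) (F i y)]; linarith

/-- Hurwitz's theorem: a nonconstant locally uniform limit of injective analytic functions is
injective. -/
theorem injOn_of_tendstoLocallyUniformlyOn {ι : Type*} {l : Filter ι} [l.NeBot] {U : Set ℂ}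
    (hU : IsOpen U) (hUc : IsPreconnected U) {F : ι → ℂ → ℂ} {G : ℂ → ℂ}
    (hF : ∀ i, DifferentiableOn ℂ (F i) U) (hinj : ∀ i, Set.InjOn (F i) U)
    (hFG : TendstoLocallyUniformlyOn F G l U) (hne : ∀ b ∈ U, ¬ Set.EqOn G (fun _ => G b) U) :
    Set.InjOn G U := by
  have hGd : DifferentiableOn ℂ G U := hFG.differentiableOn (Eventually.of_forall hF) hU
  have hGa : AnalyticOnNhd ℂ G U := hGd.analyticOnNhd hU
  intro a ha b hb hab
  by_contra hneq
  have hev : ∀ᶠ z in 𝓝[≠] b, G z ≠ G b := by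
    rcases (hGa b hb).eventually_eq_or_eventually_ne (analyticAt_const (v := G b)) with h | h
    · exact absurd (hGa.eqOn_of_preconnected_of_eventuallyEq analyticOnNhd_const hUc hb h) (hne b hb)
    · exact h
  rw [eventually_nhdsWithin_iff, Metric.eventually_nhds_iff_ball] at hev
  obtain ⟨r₁, hr₁, h₁⟩ := hev
  obtain ⟨r₂, hr₂, h₂⟩ := Metric.isOpen_iff.1 hU b hb
  have hdab : 0 < dist a b := dist_pos.2 hneq
  set r : ℝ := min (min r₁ r₂) (dist a b) / 2 with hr
  have hm : 0 < min (min r₁ r₂) (dist a b) := lt_min (lt_min hr₁ hr₂) hdab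
  have hr0 : 0 < r := half_pos hm
  have hr1 : r < r₁ := (half_lt_self hm).trans_le ((min_le_left _ _).trans (min_le_left _ _))
  have hr2 : r < r₂ := (half_lt_self hm).trans_le ((min_le_left _ _).trans (min_le_right _ _))
  have hr3 : r < dist a b := (half_lt_self hm).trans_le (min_le_right _ _)
  have hsub : Metric.closedBall b r ⊆ U := (Metric.closedBall_subset_ball hr2).trans h₂
  have hsphere : ∃ m > 0, ∀ z ∈ Metric.sphere b r, m ≤ ‖G z - G b‖ := by
    obtain ⟨z, hz, hmin⟩ := (isCompact_sphere b r).exists_isMinOn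
      (NormedSpace.sphere_nonempty.2 hr0.le) (f := fun z => ‖G z - G b‖)
      ((hGd.continuousOn.mono (Metric.sphere_subset_closedBall.trans hsub)).sub
        continuousOn_const).norm
    refine ⟨‖G z - G b‖, norm_pos_iff.2 (sub_ne_zero.2 (h₁ z ?_ ?_)), fun w hw => hmin hw⟩
    · exact lt_of_le_of_lt (le_of_eq hz) hr1
    · rintro rfl
      simp only [Metric.mem_sphere, dist_self] at hz
      exact hr0.ne hz
  obtain ⟨m, hm0, hm⟩ := hsphere
  have hK : IsCompact (insert a (Metric.closedBall b r)) := (isCompact_closedBall b r).insert a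
  have hunif := (tendstoLocallyUniformlyOn_iff_forall_isCompact hU).1 hFG _
    (Set.insert_subset ha hsub) hK
  rw [Metric.tendstoUniformlyOn_iff] at hunif
  obtain ⟨i, hi⟩ := (hunif (m / 8) (by positivity)).exists
  have hia := hi a (Set.mem_insert _ _)
  have hib := hi b (Set.mem_insert_of_mem _ (Metric.mem_closedBall_self hr0.le))
  rw [dist_comm, dist_eq_norm] at hia hib
  have hmin : ∀ z ∈ Metric.sphere b r, m / 2 ≤ ‖F i z - F i b‖ := by
    intro z hz
    have hiz := hi z (Set.mem_insert_of_mem _ (Metric.sphere_subset_closedBall hz))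
    rw [dist_comm, dist_eq_norm] at hiz
    have h4 := hm z hz
    have e : G z - G b = (F i z - F i b) - (F i z - G z) + (F i b - G b) := by ring
    have h5 : ‖G z - G b‖ ≤ ‖F i z - F i b‖ + ‖F i z - G z‖ + ‖F i b - G b‖ := by
      rw [e]; exact (norm_add_le _ _).trans (add_le_add_left (norm_sub_le _ _) _)
    linarith
  have hfreq : ∃ᶠ z in 𝓝 b, F i z ≠ F i b := by
    have h6 : ∀ᶠ z in 𝓝[≠] b, F i z ≠ F i b := by
      filter_upwards [self_mem_nhdsWithin, mem_nhdsWithin_of_mem_nhds (hU.mem_nhds hb)] with z hz hzU h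
      exact hz (hinj i hzU hb h)
    exact h6.frequently.filter_mono nhdsWithin_le_nhds
  -- By the quantitative open mapping theorem, F i maps the small closed disk about b over the disk
  -- of radius m/4 about F i b. The latter contains F i a because G a = G b, so injectivity would
  -- put a into the small disk.
  have hball := ((hF i).mono hsub).diffContOnCl_ball subset_rfl
    |>.ball_subset_image_closedBall hr0 hmin hfreq
  have hmem : F i a ∈ Metric.ball (F i b) (m / 2 / 2) := by
    rw [Metric.mem_ball, dist_eq_norm]
    have e : F i a - F i b = (F i a - G a) - (F i b - G b) := by rw [hab]; ring
    rw [e]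
    refine (norm_sub_le _ _).trans_lt ?_
    linarith
  obtain ⟨z, hz, hza⟩ := hball hmem
  have := hinj i (hsub hz) ha hza
  subst this
  exact absurd (Metric.mem_closedBall.1 hz) (not_le.2 hr3)

/-! ### The Riemann mapping theorem inside the disk -/

/-- The automorphism of the unit disk that sends `w` to the origin. -/
noncomputable def diskAut (w z : ℂ) : ℂ := (z - w) / (1 - (starRingEnd ℂ) w * z)

section diskAut

variable {w z : ℂ}

theorem one_sub_conj_mul_ne_zero (hw : ‖w‖ < 1) (hz : ‖z‖ < 1) :
    1 - (starRingEnd ℂ) w * z ≠ 0 := by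
  intro h
  have h1 : ‖(starRingEnd ℂ) w * z‖ = 1 := by rw [← sub_eq_zero.1 h, norm_one]
  rw [norm_mul, RCLike.norm_conj] at h1
  nlinarith [norm_nonneg w, norm_nonneg z]

theorem norm_diskAut_lt_one (hw : ‖w‖ < 1) (hz : ‖z‖ < 1) : ‖diskAut w z‖ < 1 := by
  rw [diskAut, norm_div, div_lt_one (norm_pos_iff.2 (one_sub_conj_mul_ne_zero hw hz))]
  apply lt_of_pow_lt_pow_left₀ 2 (norm_nonneg _)
  have hw2 : ‖w‖ ^ 2 < 1 := pow_lt_one₀ (norm_nonneg _) hw two_ne_zero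
  have hz2 : ‖z‖ ^ 2 < 1 := pow_lt_one₀ (norm_nonneg _) hz two_ne_zero
  simp only [Complex.sq_norm, Complex.normSq_apply, Complex.sub_re, Complex.sub_im, Complex.one_re,
    Complex.one_im, Complex.mul_re, Complex.mul_im, Complex.conj_re, Complex.conj_im] at *
  nlinarith [mul_pos (sub_pos.2 hw2) (sub_pos.2 hz2)]

theorem diskAut_injOn (hw : ‖w‖ < 1) : Set.InjOn (diskAut w) (Metric.ball 0 1) := by
  intro z hz z' hz' h
  rw [mem_ball_zero_iff] at hz hz'
  rw [diskAut, diskAut, div_eq_div_iff (one_sub_conj_mul_ne_zero hw hz)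
    (one_sub_conj_mul_ne_zero hw hz')] at h
  have h1 : (1 - (starRingEnd ℂ) w * w) * (z - z') = 0 := by linear_combination h
  exact sub_eq_zero.1 ((mul_eq_zero.1 h1).resolve_left (one_sub_conj_mul_ne_zero hw hw))

theorem hasDerivAt_diskAut (hw : ‖w‖ < 1) (hz : ‖z‖ < 1) : HasDerivAt (diskAut w)
    ((1 - (starRingEnd ℂ) w * w) / (1 - (starRingEnd ℂ) w * z) ^ 2) z := by
  have h1 := ((hasDerivAt_id z).sub_const w)
  have h2 := ((hasDerivAt_id z).const_mul ((starRingEnd ℂ) w)).const_sub 1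
  have h := h1.div h2 (one_sub_conj_mul_ne_zero hw hz)
  refine h.congr_deriv ?_
  change (1 * (1 - (starRingEnd ℂ) w * z) - (z - w) * (-((starRingEnd ℂ) w * 1))) / _ = _
  congr 1
  ring

theorem conj_mul_self_eq (w : ℂ) : (starRingEnd ℂ) w * w = ((‖w‖ ^ 2 : ℝ) : ℂ) := by
  rw [mul_comm, Complex.mul_conj, Complex.normSq_eq_norm_sq]

end diskAut

theorem hasDerivAt_of_sq_eq {k g : ℂ → ℂ} {k' x : ℂ} (hk : HasDerivAt k k' x)
    (hg : ContinuousAt g x) (hgk : ∀ z, g z ^ 2 = k z) (h0 : g x ≠ 0) :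
    HasDerivAt g (k' / (2 * g x)) x := by
  rw [hasDerivAt_iff_tendsto_slope] at hk ⊢
  have hsum : Tendsto (fun y => g y + g x) (𝓝[≠] x) (𝓝 (2 * g x)) := by
    have : Tendsto (fun y => g y + g x) (𝓝 x) (𝓝 (g x + g x)) := hg.tendsto.add_const _
    rw [← two_mul] at this
    exact this.mono_left nhdsWithin_le_nhds
  have h2 : 2 * g x ≠ 0 := mul_ne_zero two_ne_zero h0
  refine (hk.div hsum h2).congr' ?_
  filter_upwards [hsum.eventually_ne h2] with y hy
  simp only [Pi.div_apply, slope_def_field, ← hgk]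
  rw [div_eq_iff hy]
  ring

/-- If an injective analytic function from a simply connected domain to the disk omits a point, then
another such function has a larger derivative at the origin. -/
theorem exists_norm_deriv_lt_of_notMem_image {U : Set ℂ} (hU : IsOpen U)
    (hUc : IsSimplyConnected U) (h0 : (0 : ℂ) ∈ U) {ψ : ℂ → ℂ} (hψ : DifferentiableOn ℂ ψ U)
    (hinj : Set.InjOn ψ U) (hmaps : ∀ z ∈ U, ‖ψ z‖ < 1) (hψ0 : ψ 0 = 0) (hd : deriv ψ 0 ≠ 0)
    {w : ℂ} (hw : ‖w‖ < 1) (hwU : w ∉ ψ '' U) :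
    ∃ χ : ℂ → ℂ, DifferentiableOn ℂ χ U ∧ Set.InjOn χ U ∧ (∀ z ∈ U, ‖χ z‖ < 1) ∧ χ 0 = 0 ∧
      ‖deriv ψ 0‖ < ‖deriv χ 0‖ := by
  set k : ℂ → ℂ := fun z => diskAut w (ψ z) with hk
  have hkder : ∀ z ∈ U, HasDerivAt k
      ((1 - (starRingEnd ℂ) w * w) / (1 - (starRingEnd ℂ) w * ψ z) ^ 2 * deriv ψ z) z :=
    fun z hz => (hasDerivAt_diskAut hw (hmaps z hz)).comp z
      (hψ.differentiableAt (hU.mem_nhds hz)).hasDerivAt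
  have hkne : ∀ z ∈ U, k z ≠ 0 := by
    intro z hz h
    change (ψ z - w) / _ = 0 at h
    rw [div_eq_zero_iff] at h
    rcases h with h | h
    · exact hwU ⟨z, hz, sub_eq_zero.1 h⟩
    · exact one_sub_conj_mul_ne_zero hw (hmaps z hz) h
  -- Koebe's square-root trick: simple connectivity gives the zero-free function k a continuous
  -- root, which is still injective and bounded by 1.
  obtain ⟨g, hgc, hgk⟩ := Complex.exists_continuousOn_pow_eq hUc hU
    (fun z hz => (hkder z hz).continuousAt.continuousWithinAt)
    (by rintro ⟨z, hz, h⟩; exact hkne z hz h) two_ne_zero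
  have hg0 : ∀ z ∈ U, g z ≠ 0 := fun z hz h => hkne z hz (by rw [← hgk z, h]; norm_num)
  have hg1 : ∀ z ∈ U, ‖g z‖ < 1 := fun z hz => by
    have h1 : ‖g z‖ ^ 2 < 1 := by
      rw [← norm_pow, hgk]; exact norm_diskAut_lt_one hw (hmaps z hz)
    exact (pow_lt_one_iff_of_nonneg (norm_nonneg _) two_ne_zero).1 h1
  have hgder : ∀ z ∈ U, HasDerivAt g _ z := fun z hz =>
    hasDerivAt_of_sq_eq (hkder z hz) (hgc.continuousAt (hU.mem_nhds hz)) hgk (hg0 z hz)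
  have hc := hg1 0 h0
  have hχder : ∀ z ∈ U, HasDerivAt (fun z => diskAut (g 0) (g z)) _ z := fun z hz =>
    (hasDerivAt_diskAut hc (hg1 z hz)).comp z (hgder z hz)
  refine ⟨fun z => diskAut (g 0) (g z),
    fun z hz => (hχder z hz).differentiableAt.differentiableWithinAt, ?_,
    fun z hz => norm_diskAut_lt_one hc (hg1 z hz), by simp [diskAut], ?_⟩
  · intro z hz z' hz' h
    have h1 := diskAut_injOn hc (by simpa using hg1 z hz) (by simpa using hg1 z' hz') h
    have h2 : k z = k z' := by rw [← hgk, ← hgk, h1]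
    exact hinj hz hz' (diskAut_injOn hw (by simpa using hmaps z hz) (by simpa using hmaps z' hz') h2)
  · rw [(hχder 0 h0).deriv, hψ0, conj_mul_self_eq, conj_mul_self_eq]
    have hk0 : ‖g 0‖ ^ 2 = ‖w‖ := by
      rw [← norm_pow, hgk]; simp [hk, diskAut, hψ0]
    set s := ‖g 0‖ with hs
    have hs0 : 0 < s := norm_pos_iff.2 (hg0 0 h0)
    have hs2 : s ^ 2 < 1 := pow_lt_one₀ hs0.le hc two_ne_zero
    have hdpos : 0 < ‖deriv ψ 0‖ := norm_pos_iff.2 hd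
    rw [← hk0]
    have e1 : (1 : ℂ) - ((s ^ 2 : ℝ) : ℂ) = ((1 - s ^ 2 : ℝ) : ℂ) := by push_cast; ring
    have e2 : (1 : ℂ) - (((s ^ 2) ^ 2 : ℝ) : ℂ) = ((1 - s ^ 4 : ℝ) : ℂ) := by push_cast; ring
    have hs4 : 0 < 1 - s ^ 4 := by nlinarith
    rw [e1, e2]
    simp only [mul_zero, sub_zero, one_pow, div_one, norm_mul, norm_div, norm_pow,
      Complex.norm_real, Complex.norm_ofNat, ← hs]
    rw [Real.norm_of_nonneg hs4.le, Real.norm_of_nonneg (by linarith : (0 : ℝ) ≤ 1 - s ^ 2)]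
    -- With |w| = s² the derivative at the origin is multiplied by (1 + s²)/(2s), which exceeds 1.
    have e3 : (1 - s ^ 2) / (1 - s ^ 2) ^ 2 * ((1 - s ^ 4) * ‖deriv ψ 0‖ / (2 * s))
        = (1 + s ^ 2) / (2 * s) * ‖deriv ψ 0‖ := by
      have : 1 - s ^ 2 ≠ 0 := by linarith
      field_simp
      ring
    rw [e3]
    have : 1 < (1 + s ^ 2) / (2 * s) := by
      rw [lt_div_iff₀ (by positivity)]
      nlinarith [sq_pos_of_ne_zero (sub_ne_zero.2 hc.ne)]
    nlinarith

/-- The Riemann mapping theorem for simply connected subdomains of the unit disk. -/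
theorem exists_riemannMap {U : Set ℂ} (hU : IsOpen U) (hUc : IsSimplyConnected U)
    (hUD : U ⊆ Metric.ball 0 1) (h0 : (0 : ℂ) ∈ U) :
    ∃ ψ : ℂ → ℂ, DifferentiableOn ℂ ψ U ∧ Set.InjOn ψ U ∧ ψ '' U = Metric.ball 0 1 ∧ ψ 0 = 0 := by
  set 𝓕 : Set (ℂ → ℂ) := {ψ | DifferentiableOn ℂ ψ U ∧ Set.InjOn ψ U ∧ (∀ z ∈ U, ‖ψ z‖ < 1) ∧
    ψ 0 = 0} with h𝓕
  have hid : id ∈ 𝓕 := ⟨differentiableOn_id, Function.injective_id.injOn,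
    fun z hz => by simpa using hUD hz, rfl⟩
  set S : Set ℝ := (fun ψ => ‖deriv ψ 0‖) '' 𝓕 with hS
  obtain ⟨r, hr, hrU⟩ := Metric.isOpen_iff.1 hU 0 h0
  have hSb : BddAbove S := by
    refine ⟨1 / r, ?_⟩
    rintro _ ⟨ψ, ⟨hψ, -, hψ1, hψ0⟩, rfl⟩
    refine Complex.norm_deriv_le_div_of_mapsTo_ball (hψ.mono hrU) (fun z hz => ?_) hr
    simpa [hψ0] using (hψ1 z (hrU hz)).le
  have hSne : S.Nonempty := ⟨_, id, hid, rfl⟩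
  have hS1 : 1 ≤ sSup S := le_csSup hSb ⟨id, hid, by simp⟩
  obtain ⟨u, -, hu, huS⟩ := exists_seq_tendsto_sSup hSne hSb
  choose F hF hFu using huS
  set l : Ultrafilter ℕ := hyperfilter ℕ with hl
  obtain ⟨G, hG⟩ := exists_tendstoLocallyUniformlyOn_of_mapsTo_closedBall l hU
    (fun i => (hF i).1) (fun i z hz => ((hF i).2.2.1 z hz).le)
  have hGd : DifferentiableOn ℂ G U :=
    hG.differentiableOn (Eventually.of_forall fun i => (hF i).1) hU
  have hG0 : G 0 = 0 := by
    refine tendsto_nhds_unique (hG.tendsto_at h0) ?_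
    simp only [(hF _).2.2.2]
    exact tendsto_const_nhds
  have hGder : ‖deriv G 0‖ = sSup S := by
    have h1 := ((hG.deriv (Eventually.of_forall fun i => (hF i).1) hU).tendsto_at h0).norm
    refine tendsto_nhds_unique h1 ?_
    simp only [Function.comp_apply, hFu]
    exact hu.mono_left (Nat.hyperfilter_le_atTop)
  have hGne : deriv G 0 ≠ 0 := fun h => by
    rw [h, norm_zero] at hGder; linarith
  have hUpre : IsPreconnected U := hUc.isPathConnected.isConnected.isPreconnected
  have hnc : ∀ c : ℂ, ¬ Set.EqOn G (fun _ => c) U := fun c h => by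
    have h1 : G =ᶠ[𝓝 0] fun _ => c := h.eventuallyEq_of_mem (hU.mem_nhds h0)
    exact hGne (by rw [h1.deriv_eq]; simp)
  have hGinj : Set.InjOn G U := injOn_of_tendstoLocallyUniformlyOn hU hUpre
    (fun i => (hF i).1) (fun i => (hF i).2.1) hG (fun b _ => hnc _)
  have hGle : ∀ z ∈ U, ‖G z‖ ≤ 1 := fun z hz =>
    le_of_tendsto (hG.tendsto_at hz).norm
      (Eventually.of_forall fun i => ((hF i).2.2.1 z hz).le)
  -- The limit has values in the closed disk; being nonconstant it is open, so its values lie in the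
  -- interior.
  have hGlt : G '' U ⊆ Metric.ball 0 1 := by
    rcases (hGd.analyticOnNhd hU).is_constant_or_isOpen hUpre with ⟨c, hc⟩ | ho
    · exact absurd hc (hnc c)
    · rw [← interior_closedBall (0 : ℂ) one_ne_zero]
      refine interior_maximal ?_ (ho U subset_rfl hU)
      rintro _ ⟨z, hz, rfl⟩
      simpa using hGle z hz
  have hGlt' : ∀ z ∈ U, ‖G z‖ < 1 := fun z hz => by simpa using hGlt ⟨z, hz, rfl⟩
  refine ⟨G, hGd, hGinj, hGlt.antisymm fun w hw => ?_, hG0⟩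
  by_contra hwU
  obtain ⟨χ, h1, h2, h3, h4, h5⟩ := exists_norm_deriv_lt_of_notMem_image hU hUc h0 hGd hGinj hGlt'
    hG0 hGne (by simpa using hw) hwU
  rw [hGder] at h5
  exact absurd (le_csSup hSb ⟨χ, ⟨h1, h2, h3, h4⟩, rfl⟩) (not_le.2 h5)

/-! ### Strongly convex functions enclosing a compact convex set -/

/-- A strongly convex function `F` with continuous gradient field `n` and upper quadratic bound,
whose sublevel set at height `c` is compact. -/
structure IsConvexDefining (F : ℂ → ℝ) (n : ℂ → ℂ) (η c : ℝ) : Prop where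
  eta_pos : 0 < η
  c_pos : 0 < c
  map_zero : F 0 = 0
  continuous_F : Continuous F
  continuous_n : Continuous n
  lower : ∀ x y, F x + ((starRingEnd ℂ) (n x) * (y - x)).re + η * ‖y - x‖ ^ 2 ≤ F y
  upper : ∀ x y, F y ≤ F x + ((starRingEnd ℂ) (n x) * (y - x)).re + (1 + η) * ‖y - x‖ ^ 2
  compact : IsCompact {x | F x ≤ c}

namespace IsConvexDefining

variable {F : ℂ → ℝ} {n : ℂ → ℂ} {η c : ℝ}

theorem le_re_conj_mul_self (hF : IsConvexDefining F n η c) (x : ℂ) :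
    F x ≤ ((starRingEnd ℂ) (n x) * x).re := by
  have h := hF.lower x 0
  rw [hF.map_zero, zero_sub, mul_neg, Complex.neg_re] at h
  nlinarith [hF.eta_pos, sq_nonneg ‖-x‖, mul_nonneg hF.eta_pos.le (sq_nonneg ‖-x‖)]

theorem re_conj_mul_sub_le (hF : IsConvexDefining F n η c) (x y : ℂ) :
    ((starRingEnd ℂ) (n x) * (y - x)).re ≤ F y - F x := by
  have h := hF.lower x y
  nlinarith [mul_nonneg hF.eta_pos.le (sq_nonneg ‖y - x‖)]

theorem convex_lt (hF : IsConvexDefining F n η c) : Convex ℝ {x | F x < c} := by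
  intro x hx y hy a b ha hb hab
  simp only [Set.mem_ofPred_eq] at hx hy ⊢
  set m := a • x + b • y with hm
  have h1 := hF.re_conj_mul_sub_le m x
  have h2 := hF.re_conj_mul_sub_le m y
  have h3 : a * ((starRingEnd ℂ) (n m) * (x - m)).re + b * ((starRingEnd ℂ) (n m) * (y - m)).re
      = 0 := by
    have e : (a : ℂ) * ((starRingEnd ℂ) (n m) * (x - m)) + b * ((starRingEnd ℂ) (n m) * (y - m))
        = 0 := by
      have hab' : (a : ℂ) + b = 1 := by exact_mod_cast hab
      have : (a : ℂ) * x + b * y = m := by simp [hm]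
      linear_combination (starRingEnd ℂ) (n m) * this - (starRingEnd ℂ) (n m) * m * hab'
    have := congrArg Complex.re e
    simpa [Complex.add_re, Complex.re_ofReal_mul] using this
  rcases ha.eq_or_lt with rfl | ha'
  · have : b = 1 := by linarith
    subst this
    nlinarith
  · nlinarith

end IsConvexDefining

theorem exists_nearest_point {K : Set ℂ} (hK : IsCompact K) (hKc : Convex ℝ K) (hne : K.Nonempty)
    (x : ℂ) : ∃ p ∈ K, ∀ q ∈ K, ((starRingEnd ℂ) (x - p) * (q - p)).re ≤ 0 := by
  obtain ⟨p, hp, hmin⟩ := exists_norm_eq_iInf_of_complete_convex hne hK.isComplete hKc x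
  refine ⟨p, hp, fun q hq => ?_⟩
  have := (norm_eq_iInf_iff_real_inner_le_zero hKc hp).1 hmin q hq
  rwa [Complex.inner, mul_comm] at this

theorem norm_add_sq_complex (a b : ℂ) :
    ‖a + b‖ ^ 2 = ‖a‖ ^ 2 + 2 * ((starRingEnd ℂ) a * b).re + ‖b‖ ^ 2 := by
  simp only [Complex.sq_norm, Complex.normSq_apply, Complex.add_re, Complex.add_im, Complex.mul_re,
    Complex.conj_re, Complex.conj_im]
  ring

/-- F is the squared distance to K plus η|x|². For any convex K the distance term is convex with a
quadratic upper bound, and its gradient 2(x - π x) is continuous since the projection π is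
nonexpansive. The other term adds strong convexity. -/
theorem exists_isConvexDefining {K Ω : Set ℂ} (hK : IsCompact K) (hKc : Convex ℝ K)
    (h0 : (0 : ℂ) ∈ K) (hΩ : IsOpen Ω) (hKΩ : K ⊆ Ω) :
    ∃ (F : ℂ → ℝ) (n : ℂ → ℂ) (η c : ℝ), IsConvexDefining F n η c ∧ (∀ x ∈ K, F x < c) ∧
      {x | F x ≤ c} ⊆ Ω := by
  choose π hπK hπ using exists_nearest_point hK hKc ⟨0, h0⟩
  obtain ⟨δ, hδ, hδΩ⟩ := hK.exists_cthickening_subset_open hΩ hKΩ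
  obtain ⟨R, hR⟩ := hK.isBounded.exists_norm_le
  have hπfix : ∀ x ∈ K, π x = x := fun x hx => by
    have h := hπ x x hx
    rw [← Complex.normSq_eq_conj_mul_self, Complex.ofReal_re] at h
    exact (sub_eq_zero.1 (Complex.normSq_eq_zero.1 (le_antisymm h (Complex.normSq_nonneg _)))).symm
  have hlip : ∀ x y, ‖π x - π y‖ ≤ ‖x - y‖ := by
    intro x y
    have h1 := hπ x (π y) (hπK y)
    have h2 := hπ y (π x) (hπK x)
    have h3 : ‖π x - π y‖ ^ 2 ≤ ((starRingEnd ℂ) (x - y) * (π x - π y)).re := by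
      simp only [Complex.sq_norm, Complex.normSq_apply, Complex.sub_re, Complex.sub_im,
        Complex.mul_re, Complex.conj_re, Complex.conj_im] at *
      nlinarith
    have h4 := Complex.re_le_norm ((starRingEnd ℂ) (x - y) * (π x - π y))
    rw [norm_mul, RCLike.norm_conj] at h4
    rcases (norm_nonneg (π x - π y)).eq_or_lt with h | h
    · rw [← h]; exact norm_nonneg _
    · nlinarith
  have hπc : Continuous π :=
    (LipschitzWith.of_dist_le_mul (K := 1) fun x y => by
      simpa [dist_eq_norm] using hlip x y).continuous
  -- With c = δ² the set {F ≤ c} lies in the δ-thickening of K, and η is so small that F ≤ c/2 on K.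
  set c : ℝ := δ ^ 2 with hc
  have hc0 : 0 < c := by positivity
  set η : ℝ := c / (2 * (R ^ 2 + 1)) with hη
  have hη0 : 0 < η := by positivity
  set F : ℂ → ℝ := fun x => ‖x - π x‖ ^ 2 + η * ‖x‖ ^ 2 with hF
  set n : ℂ → ℂ := fun x => 2 * (x - π x) + 2 * η * x with hn
  have hFc : Continuous F := by fun_prop
  have hsub : {x | F x ≤ c} ⊆ Metric.cthickening δ K := by
    intro x hx
    refine Metric.mem_cthickening_of_dist_le x (π x) δ K (hπK x) ?_
    rw [dist_eq_norm]
    have hx' : ‖x - π x‖ ^ 2 + η * ‖x‖ ^ 2 ≤ δ ^ 2 := hx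
    exact le_of_sq_le_sq (by nlinarith [mul_nonneg hη0.le (sq_nonneg ‖x‖)]) hδ.le
  have hnre : ∀ x v, ((starRingEnd ℂ) (n x) * v).re
      = 2 * ((starRingEnd ℂ) (x - π x) * v).re + 2 * η * ((starRingEnd ℂ) x * v).re := by
    intro x v
    simp only [hn, map_add, map_mul, Complex.conj_ofReal, Complex.conj_ofNat]
    simp only [Complex.add_re, Complex.mul_re, Complex.add_im, Complex.mul_im, Complex.ofReal_re,
      Complex.ofReal_im, Complex.re_ofNat, Complex.im_ofNat]
    ring
  have hsq : ∀ x y : ℂ, ‖y‖ ^ 2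
      = ‖x‖ ^ 2 + 2 * ((starRingEnd ℂ) x * (y - x)).re + ‖y - x‖ ^ 2 := fun x y => by
    rw [← norm_add_sq_complex]; congr 2; ring
  refine ⟨F, n, η, c, ⟨hη0, hc0, ?_, hFc, by fun_prop, ?_, ?_, ?_⟩, ?_, hsub.trans hδΩ⟩
  · simp [hF, hπfix 0 h0]
  · intro x y
    rw [hnre]
    have h1 := hsq x y
    -- Expand |(y - π y) - (x - π x)|² ≥ 0 and use the variational inequality at x.
    have h2 : ‖x - π x‖ ^ 2 + 2 * ((starRingEnd ℂ) (x - π x) * (y - x)).re ≤ ‖y - π y‖ ^ 2 := by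
      have h3 := hπ x (π y) (hπK y)
      have h4 : 0 ≤ ‖(y - π y) - (x - π x)‖ ^ 2 := sq_nonneg _
      simp only [Complex.sq_norm, Complex.normSq_apply, Complex.sub_re, Complex.sub_im,
        Complex.mul_re, Complex.conj_re, Complex.conj_im] at *
      nlinarith
    simp only [hF]
    nlinarith
  · intro x y
    rw [hnre]
    have h1 := hsq x y
    -- This is |y - π y| ≤ |y - π x| with the right side expanded about x.
    have h2 : ‖y - π y‖ ^ 2
        ≤ ‖x - π x‖ ^ 2 + 2 * ((starRingEnd ℂ) (x - π x) * (y - x)).re + ‖y - x‖ ^ 2 := by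
      have h3 := hπ y (π x) (hπK x)
      have h4 : 0 ≤ ‖π y - π x‖ ^ 2 := sq_nonneg _
      simp only [Complex.sq_norm, Complex.normSq_apply, Complex.sub_re, Complex.sub_im,
        Complex.mul_re, Complex.conj_re, Complex.conj_im] at *
      nlinarith
    simp only [hF]
    nlinarith
  · exact hK.cthickening.of_isClosed_subset (isClosed_le hFc continuous_const) hsub
  · intro x hx
    simp only [hF, hπfix x hx, sub_self, norm_zero]
    have h1 : ‖x‖ ^ 2 ≤ R ^ 2 := pow_le_pow_left₀ (norm_nonneg _) (hR x hx) 2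
    have h2 : η * (R ^ 2 + 1) = c / 2 := by rw [hη]; field_simp
    nlinarith

/-! ### Harmonic maps, their differentials and inverses -/

/-- The harmonic function with analytic part `h` and co-analytic part `g`. -/
noncomputable def harm (h g : ℂ → ℂ) (z : ℂ) : ℂ := h z + (starRingEnd ℂ) (g z)

/-- The real differential `v ↦ a v + conj (b v)` of a harmonic function. -/
noncomputable def harmDeriv (a b : ℂ) : ℂ →L[ℝ] ℂ :=
  a • (1 : ℂ →L[ℝ] ℂ) + (Complex.conjCLE : ℂ →L[ℝ] ℂ).comp (b • (1 : ℂ →L[ℝ] ℂ))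

theorem harmDeriv_apply (a b v : ℂ) : harmDeriv a b v = a * v + (starRingEnd ℂ) (b * v) := by
  simp [harmDeriv]

theorem norm_harmDeriv_le (a b v : ℂ) : ‖harmDeriv a b v‖ ≤ (‖a‖ + ‖b‖) * ‖v‖ := by
  rw [harmDeriv_apply]
  refine (norm_add_le _ _).trans_eq ?_
  rw [RCLike.norm_conj, norm_mul, norm_mul]
  ring

theorem le_norm_harmDeriv (a b v : ℂ) : (‖a‖ - ‖b‖) * ‖v‖ ≤ ‖harmDeriv a b v‖ := by
  rw [harmDeriv_apply]
  have h := norm_sub_norm_le (a * v) (-(starRingEnd ℂ) (b * v))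
  rw [sub_neg_eq_add, norm_neg, RCLike.norm_conj, norm_mul, norm_mul] at h
  linarith

/-- The least stretching of v ↦ av + conj(bv) is at least |a| - |b|, so preservation of sense gives
invertibility with a quantitative inverse. -/
theorem exists_equiv_harmDeriv {a b : ℂ} (hab : ‖b‖ < ‖a‖) :
    ∃ e : ℂ ≃L[ℝ] ℂ, (e : ℂ →L[ℝ] ℂ) = harmDeriv a b ∧
      ∀ v, ‖e.symm v‖ * (‖a‖ - ‖b‖) ≤ ‖v‖ := by
  have hinj : Function.Injective (harmDeriv a b : ℂ →ₗ[ℝ] ℂ) := by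
    rw [injective_iff_map_eq_zero]
    intro v hv
    have h1 := le_norm_harmDeriv a b v
    have hv' : harmDeriv a b v = 0 := hv
    rw [hv', norm_zero] at h1
    by_contra hne
    have := mul_pos (sub_pos.2 hab) (norm_pos_iff.2 hne)
    linarith
  set e := (LinearEquiv.ofInjectiveEndo (harmDeriv a b : ℂ →ₗ[ℝ] ℂ) hinj).toContinuousLinearEquiv
  have he : ∀ v, e v = harmDeriv a b v := fun v => rfl
  refine ⟨e, by ext1; rfl, fun v => ?_⟩
  have h1 := le_norm_harmDeriv a b (e.symm v)
  rw [← he, e.apply_symm_apply] at h1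
  linarith

section harm

variable {h g : ℂ → ℂ} {U : Set ℂ}

theorem hasStrictFDerivAt_harm (hU : IsOpen U) (hh : DifferentiableOn ℂ h U)
    (hg : DifferentiableOn ℂ g U) {z : ℂ} (hz : z ∈ U) :
    HasStrictFDerivAt (harm h g) (harmDeriv (deriv h z) (deriv g z)) z := by
  have h1 := (hh.analyticAt (hU.mem_nhds hz)).hasStrictDerivAt.complexToReal_fderiv
  have h2 := (hg.analyticAt (hU.mem_nhds hz)).hasStrictDerivAt.complexToReal_fderiv
  exact h1.add ((Complex.conjCLE : ℂ →L[ℝ] ℂ).hasStrictFDerivAt.comp z h2)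

theorem continuousOn_harm (hh : DifferentiableOn ℂ h U) (hg : DifferentiableOn ℂ g U) :
    ContinuousOn (harm h g) U :=
  hh.continuousOn.add (Complex.continuous_conj.comp_continuousOn hg.continuousOn)

theorem map_nhds_harm (hU : IsOpen U) (hh : DifferentiableOn ℂ h U)
    (hg : DifferentiableOn ℂ g U) (hlt : ∀ z ∈ U, ‖deriv g z‖ < ‖deriv h z‖) {z : ℂ} (hz : z ∈ U) :
    map (harm h g) (𝓝 z) = 𝓝 (harm h g z) := by
  obtain ⟨e, he, -⟩ := exists_equiv_harmDeriv (hlt z hz)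
  have h1 := hasStrictFDerivAt_harm hU hh hg hz
  rw [← he] at h1
  exact h1.map_nhds_eq_of_equiv

theorem isOpen_image_harm (hU : IsOpen U) (hh : DifferentiableOn ℂ h U)
    (hg : DifferentiableOn ℂ g U) (hlt : ∀ z ∈ U, ‖deriv g z‖ < ‖deriv h z‖) :
    IsOpen (harm h g '' U) := by
  rw [isOpen_iff_mem_nhds]
  rintro _ ⟨z, hz, rfl⟩
  rw [← map_nhds_harm hU hh hg hlt hz]
  exact image_mem_map (hU.mem_nhds hz)

theorem continuousAt_leftInv_harm (hU : IsOpen U) (hh : DifferentiableOn ℂ h U)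
    (hg : DifferentiableOn ℂ g U) (hlt : ∀ z ∈ U, ‖deriv g z‖ < ‖deriv h z‖) {k : ℂ → ℂ}
    (hk : ∀ z ∈ U, k (harm h g z) = z) {z : ℂ} (hz : z ∈ U) : ContinuousAt k (harm h g z) := by
  intro V hV
  rw [hk z hz] at hV
  rw [← map_nhds_harm hU hh hg hlt hz, mem_map, mem_map]
  filter_upwards [hV, hU.mem_nhds hz] with w hwV hwU
  simpa [hk w hwU] using hwV

/-- A univalent harmonic function with convex range and differential bounded below expands
distances. -/
theorem mul_norm_sub_le_norm_harm_sub (hU : IsOpen U) (hh : DifferentiableOn ℂ h U)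
    (hg : DifferentiableOn ℂ g U) {m : ℝ} (hm : 0 < m)
    (hlt : ∀ z ∈ U, m ≤ ‖deriv h z‖ - ‖deriv g z‖) (hinj : Set.InjOn (harm h g) U)
    (hconv : Convex ℝ (harm h g '' U)) {z w : ℂ} (hz : z ∈ U) (hw : w ∈ U) :
    m * ‖z - w‖ ≤ ‖harm h g z - harm h g w‖ := by
  have hlt' : ∀ z ∈ U, ‖deriv g z‖ < ‖deriv h z‖ := fun z hz => by linarith [hlt z hz]
  set k := Function.invFunOn (harm h g) U with hk
  have hkl : ∀ z ∈ U, k (harm h g z) = z := fun z hz => hinj.leftInvOn_invFunOn hz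
  have hder : ∀ x ∈ harm h g '' U, ∃ L : ℂ →L[ℝ] ℂ,
      HasFDerivWithinAt k L (harm h g '' U) x ∧ ‖L‖ ≤ 1 / m := by
    rintro _ ⟨z, hz, rfl⟩
    obtain ⟨e, he, heb⟩ := exists_equiv_harmDeriv (hlt' z hz)
    refine ⟨(e.symm : ℂ →L[ℝ] ℂ), ?_, ContinuousLinearMap.opNorm_le_bound _ (by positivity)
      fun v => ?_⟩
    · have h1 := (hasStrictFDerivAt_harm hU hh hg hz).hasFDerivAt
      rw [← he] at h1
      refine HasFDerivAt.hasFDerivWithinAt ?_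
      refine HasFDerivAt.of_local_left_inverse (f := harm h g) (f' := e)
        (continuousAt_leftInv_harm hU hh hg hlt' hkl hz) (by rwa [hkl z hz]) ?_
      filter_upwards [(isOpen_image_harm hU hh hg hlt').mem_nhds ⟨z, hz, rfl⟩]
      rintro _ ⟨y, hy, rfl⟩
      rw [hkl y hy]
    · have h1 := heb v
      have h2 := hlt z hz
      rw [one_div, inv_mul_eq_div, le_div_iff₀ hm]
      refine le_trans ?_ h1
      gcongr
      rfl
  choose! L hL hLb using hder
  -- The mean value inequality is applied to the inverse map, which is why the range has to be
  -- convex.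
  have h1 := hconv.norm_image_sub_le_of_norm_hasFDerivWithin_le hL hLb ⟨w, hw, rfl⟩ ⟨z, hz, rfl⟩
  rw [hkl z hz, hkl w hw, one_div, inv_mul_eq_div, le_div_iff₀ hm] at h1
  linarith

theorem norm_harm_sub_le (hU : IsOpen U) (hUc : Convex ℝ U) (hh : DifferentiableOn ℂ h U)
    (hg : DifferentiableOn ℂ g U) {C : ℝ}
    (hC : ∀ z ∈ U, ‖deriv h z‖ + ‖deriv g z‖ ≤ C) {z w : ℂ} (hz : z ∈ U) (hw : w ∈ U) :
    ‖harm h g z - harm h g w‖ ≤ C * ‖z - w‖ := by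
  refine hUc.norm_image_sub_le_of_norm_hasFDerivWithin_le
    (fun x hx => (hasStrictFDerivAt_harm hU hh hg hx).hasFDerivAt.hasFDerivWithinAt)
    (fun x hx => ?_) hw hz
  have h0 : 0 ≤ C := le_trans (by positivity) (hC x hx)
  refine ContinuousLinearMap.opNorm_le_bound _ h0 fun v => (norm_harmDeriv_le _ _ v).trans ?_
  have := hC x hx
  gcongr

end harm

/-- The inverse of an injective analytic function is analytic, and its derivative is the inverse. -/
theorem exists_analytic_inverse {U : Set ℂ} (hU : IsOpen U) (hUc : IsPreconnected U)
    {ψ : ℂ → ℂ} (hψ : DifferentiableOn ℂ ψ U) (hinj : Set.InjOn ψ U) :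
    ∃ φ : ℂ → ℂ, DifferentiableOn ℂ φ (ψ '' U) ∧ (∀ z ∈ U, φ (ψ z) = z) ∧
      ∀ z ∈ U, deriv φ (ψ z) * deriv ψ z = 1 := by
  rcases U.eq_empty_or_nonempty with rfl | hUne
  · exact ⟨id, differentiableOn_id, by simp, by simp⟩
  set φ := Function.invFunOn ψ U with hφ
  have hφl : ∀ z ∈ U, φ (ψ z) = z := fun z hz => hinj.leftInvOn_invFunOn hz
  have hψa : AnalyticOnNhd ℂ ψ U := hψ.analyticOnNhd hU
  have hopen : ∀ V ⊆ U, IsOpen V → IsOpen (ψ '' V) := by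
    rcases hψa.is_constant_or_isOpen hUc with ⟨c, hc⟩ | h
    · exfalso
      obtain ⟨z, hz⟩ := hUne
      have h1 : ∀ᶠ w in 𝓝[≠] z, w ∈ U := mem_nhdsWithin_of_mem_nhds (hU.mem_nhds hz)
      obtain ⟨w, hwU, hw⟩ := (h1.and self_mem_nhdsWithin).exists
      exact hw (hinj hwU hz (by rw [hc w hwU, hc z hz]))
    · exact h
  have hcont : ∀ z ∈ U, ContinuousAt φ (ψ z) := by
    intro z hz V hV
    rw [hφl z hz] at hV
    obtain ⟨W, hWV, hW, hzW⟩ := mem_nhds_iff.1 hV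
    rw [mem_map]
    refine mem_of_superset ((hopen (W ∩ U) Set.inter_subset_right (hW.inter hU)).mem_nhds
      ⟨z, ⟨hzW, hz⟩, rfl⟩) ?_
    rintro _ ⟨y, ⟨hyW, hyU⟩, rfl⟩
    rw [Set.mem_preimage, hφl y hyU]
    exact hWV hyW
  have hright : ∀ z ∈ U, ∀ᶠ y in 𝓝 (ψ z), ψ (φ y) = y := by
    intro z hz
    filter_upwards [(hopen U subset_rfl hU).mem_nhds ⟨z, hz, rfl⟩]
    rintro _ ⟨y, hy, rfl⟩
    rw [hφl y hy]
  have hdiff_of_ne : ∀ z ∈ U, deriv ψ z ≠ 0 → DifferentiableAt ℂ φ (ψ z) := by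
    intro z hz hd
    refine HasDerivAt.differentiableAt (HasDerivAt.of_local_left_inverse (f := ψ) (hcont z hz)
      ?_ hd (hright z hz))
    rw [hφl z hz]
    exact (hψ.differentiableAt (hU.mem_nhds hz)).hasDerivAt
  -- Zeros of ψ' are isolated, so the continuous inverse has at worst isolated singularities, and
  -- these are removable. That ψ' never vanishes then follows from the chain rule.
  have hdiff : ∀ z ∈ U, DifferentiableAt ℂ φ (ψ z) := by
    intro z hz
    have hda : AnalyticOnNhd ℂ (deriv ψ) U := hψa.deriv
    have hev : ∀ᶠ w in 𝓝[≠] z, deriv ψ w ≠ 0 := by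
      rcases (hda z hz).eventually_eq_zero_or_eventually_ne_zero with h | h
      · exfalso
        have h0 : Set.EqOn (deriv ψ) 0 U :=
          hda.eqOn_zero_of_preconnected_of_eventuallyEq_zero hUc hz h
        have h1 : ∀ᶠ w in 𝓝[≠] z, w ∈ U := mem_nhdsWithin_of_mem_nhds (hU.mem_nhds hz)
        obtain ⟨w, hwU, hw⟩ := (h1.and self_mem_nhdsWithin).exists
        exact hw (hinj hwU hz (hU.is_const_of_deriv_eq_zero hUc hψ h0 hwU hz))
      · exact h
    rw [eventually_nhdsWithin_iff] at hev
    refine AnalyticAt.differentiableAt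
      (Complex.analyticAt_of_differentiable_on_punctured_nhds_of_continuousAt ?_ (hcont z hz))
    rw [eventually_nhdsWithin_iff]
    have h2 : ∀ᶠ y in 𝓝 (ψ z), φ y ∈ {w | w ∈ ({z}ᶜ : Set ℂ) → deriv ψ w ≠ 0} :=
      (hcont z hz) (by rw [hφl z hz]; exact hev)
    filter_upwards [h2, (hopen U subset_rfl hU).mem_nhds ⟨z, hz, rfl⟩]
    rintro _ hy ⟨w, hw, rfl⟩ hne
    rw [hφl w hw] at hy
    exact hdiff_of_ne w hw (hy fun h => hne (by rw [Set.mem_singleton_iff.1 h]; rfl))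
  refine ⟨φ, ?_, hφl, fun z hz => ?_⟩
  · rintro _ ⟨z, hz, rfl⟩
    exact (hdiff z hz).differentiableWithinAt
  · have h1 := (hdiff z hz).hasDerivAt.comp z (hψ.differentiableAt (hU.mem_nhds hz)).hasDerivAt
    have h2 : φ ∘ ψ =ᶠ[𝓝 z] id := by
      filter_upwards [hU.mem_nhds hz] with w hw using hφl w hw
    exact (h1.congr_of_eventuallyEq h2.symm).unique (hasDerivAt_id z)

/-! ### Pulling the convex function back to the disk -/

/-- `h + conj g` is a univalent sense-preserving harmonic map of the unit disk onto a convex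
domain, fixing the origin. -/
structure IsConvexHarmonic (h g : ℂ → ℂ) : Prop where
  analytic_h : DifferentiableOn ℂ h unitDisk
  analytic_g : DifferentiableOn ℂ g unitDisk
  h_zero : h 0 = 0
  g_zero : g 0 = 0
  lt : ∀ z ∈ unitDisk, ‖deriv g z‖ < ‖deriv h z‖
  injOn : Set.InjOn (harm h g) unitDisk
  convex : Convex ℝ (harm h g '' unitDisk)

theorem isOpen_unitDisk : IsOpen unitDisk := Metric.isOpen_ball

theorem zero_mem_unitDisk : (0 : ℂ) ∈ unitDisk := Metric.mem_ball_self one_pos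

theorem mem_unitDisk {z : ℂ} : z ∈ unitDisk ↔ ‖z‖ < 1 := mem_ball_zero_iff

/-- The mean value inequality is used twice, first for u' and then for u minus its linear part. The
constant B in place of B/2 is enough. -/
theorem norm_sub_sub_mul_le {u : ℂ → ℂ} {w : ℂ} {ρ B : ℝ}
    (hu : DifferentiableOn ℂ u (Metric.ball w ρ)) (hB0 : 0 ≤ B)
    (hB : ∀ y ∈ Metric.ball w ρ, ‖deriv (deriv u) y‖ ≤ B) {v : ℂ} (hv : ‖v‖ < ρ) :
    ‖u (w + v) - u w - deriv u w * v‖ ≤ B * ‖v‖ ^ 2 := by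
  have hρ : 0 < ρ := lt_of_le_of_lt (norm_nonneg v) hv
  have hw : w ∈ Metric.ball w ρ := Metric.mem_ball_self hρ
  have hu' : ∀ y ∈ Metric.ball w ρ, DifferentiableAt ℂ u y :=
    fun y hy => hu.differentiableAt (Metric.isOpen_ball.mem_nhds hy)
  have h1 : ∀ y ∈ Metric.ball w ρ, ‖deriv u y - deriv u w‖ ≤ B * ‖y - w‖ := fun y hy =>
    (convex_ball w ρ).norm_image_sub_le_of_norm_deriv_le
      (fun x hx => ((hu.deriv Metric.isOpen_ball).differentiableAt
        (Metric.isOpen_ball.mem_nhds hx))) hB hw hy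
  have hsub : Metric.closedBall w ‖v‖ ⊆ Metric.ball w ρ := Metric.closedBall_subset_ball hv
  have h2 : ‖(u (w + v) - deriv u w * (w + v)) - (u w - deriv u w * w)‖
      ≤ (B * ‖v‖) * ‖w + v - w‖ := by
    refine (convex_closedBall w ‖v‖).norm_image_sub_le_of_norm_hasDerivWithin_le
      (f := fun y => u y - deriv u w * y) (f' := fun y => deriv u y - deriv u w)
      (fun x hx => ?_) (fun x hx => ?_) (Metric.mem_closedBall_self (norm_nonneg v)) (by simp)
    · exact (((hu' x (hsub hx)).hasDerivAt).sub
        (((hasDerivAt_id x).const_mul (deriv u w)).congr_deriv (mul_one _))).hasDerivWithinAt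
    · refine (h1 x (hsub hx)).trans ?_
      gcongr
      exact mem_closedBall_iff_norm.1 hx
  refine le_trans (le_of_eq ?_) (h2.trans_eq ?_)
  · congr 1; ring
  · rw [add_sub_cancel_left]; ring

/-- The complex gradient of `F ∘ (h + conj g)`, where `F` has gradient `n`. -/
noncomputable def pullbackGrad (n h g : ℂ → ℂ) (w : ℂ) : ℂ :=
  (starRingEnd ℂ) (n (harm h g w)) * deriv h w + n (harm h g w) * deriv g w

section pullback

variable {h g n : ℂ → ℂ} {F : ℂ → ℝ} {η c : ℝ}

theorem norm_mul_le_norm_pullbackGrad (w : ℂ) :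
    ‖n (harm h g w)‖ * (‖deriv h w‖ - ‖deriv g w‖) ≤ ‖pullbackGrad n h g w‖ := by
  have h1 := norm_sub_norm_le ((starRingEnd ℂ) (n (harm h g w)) * deriv h w)
    (-(n (harm h g w) * deriv g w))
  rw [sub_neg_eq_add, norm_neg, norm_mul, norm_mul, RCLike.norm_conj] at h1
  unfold pullbackGrad
  linarith

theorem IsConvexHarmonic.isCompact_sublevel (hf : IsConvexHarmonic h g)
    (hF : IsConvexDefining F n η c) (hsub : {x | F x ≤ c} ⊆ harm h g '' unitDisk) :
    IsCompact {z | z ∈ unitDisk ∧ F (harm h g z) ≤ c} := by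
  set k := Function.invFunOn (harm h g) unitDisk with hk
  have hkl : ∀ z ∈ unitDisk, k (harm h g z) = z := fun z hz => hf.injOn.leftInvOn_invFunOn hz
  have hcont : ContinuousOn k {x | F x ≤ c} := by
    intro x hx
    obtain ⟨z, hz, rfl⟩ := hsub hx
    exact (continuousAt_leftInv_harm isOpen_unitDisk hf.analytic_h hf.analytic_g hf.lt hkl
      hz).continuousWithinAt
  have := hF.compact.image_of_continuousOn hcont
  convert this using 1
  ext z
  constructor
  · rintro ⟨hz, hFz⟩
    exact ⟨harm h g z, hFz, hkl z hz⟩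
  · rintro ⟨x, hx, rfl⟩
    obtain ⟨z, hz, rfl⟩ := hsub hx
    rw [hkl z hz]
    exact ⟨hz, hx⟩

/-- All constants come from compactness of the sublevel set: its ρ-thickening stays in the disk, and
there the first and second derivatives are bounded. M combines the Taylor remainders of h and g with
the quadratic bound for F. -/
theorem IsConvexHarmonic.exists_pullback_bound (hf : IsConvexHarmonic h g)
    (hF : IsConvexDefining F n η c) (hsub : {x | F x ≤ c} ⊆ harm h g '' unitDisk) :
    ∃ ρ M B Λ m : ℝ, 0 < ρ ∧ 0 < M ∧ 0 < B ∧ 0 < Λ ∧ 0 < m ∧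
      ∀ w ∈ unitDisk, F (harm h g w) ≤ c →
        ‖deriv h w‖ + ‖deriv g w‖ ≤ B ∧ m ≤ ‖deriv h w‖ - ‖deriv g w‖ ∧
        ‖pullbackGrad n h g w‖ ≤ Λ ∧ ∀ v : ℂ, ‖v‖ < ρ → w + v ∈ unitDisk ∧
          F (harm h g (w + v)) ≤ F (harm h g w) + (pullbackGrad n h g w * v).re + M * ‖v‖ ^ 2 := by
  set Q := {z | z ∈ unitDisk ∧ F (harm h g z) ≤ c} with hQ
  have hQc : IsCompact Q := hf.isCompact_sublevel hF hsub
  have hQD : Q ⊆ unitDisk := fun z hz => hz.1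
  obtain ⟨ρ, hρ, hρD⟩ := hQc.exists_cthickening_subset_open isOpen_unitDisk hQD
  have hTc : IsCompact (Metric.cthickening ρ Q) := hQc.cthickening
  have hh' := hf.analytic_h.deriv isOpen_unitDisk
  have hg' := hf.analytic_g.deriv isOpen_unitDisk
  obtain ⟨B1, hB1⟩ := hTc.exists_bound_of_continuousOn (hh'.continuousOn.mono hρD)
  obtain ⟨B2, hB2⟩ := hTc.exists_bound_of_continuousOn (hg'.continuousOn.mono hρD)
  obtain ⟨B3, hB3⟩ := hTc.exists_bound_of_continuousOn
    ((hh'.deriv isOpen_unitDisk).continuousOn.mono hρD)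
  obtain ⟨B4, hB4⟩ := hTc.exists_bound_of_continuousOn
    ((hg'.deriv isOpen_unitDisk).continuousOn.mono hρD)
  obtain ⟨N, hN⟩ := hF.compact.exists_bound_of_continuousOn hF.continuous_n.continuousOn
  have hmcont : ContinuousOn (fun z => ‖deriv h z‖ - ‖deriv g z‖) Q :=
    (hh'.continuousOn.norm.sub hg'.continuousOn.norm).mono hQD
  obtain ⟨m, hm, hmQ⟩ : ∃ m : ℝ, 0 < m ∧ ∀ z ∈ Q, m ≤ ‖deriv h z‖ - ‖deriv g z‖ := by
    rcases Q.eq_empty_or_nonempty with h | h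
    · exact ⟨1, one_pos, by simp [h]⟩
    · obtain ⟨z, hz, hmin⟩ := hQc.exists_isMinOn h hmcont
      exact ⟨_, sub_pos.2 (hf.lt z hz.1), fun y hy => hmin hy⟩
  set B := max (B1 + B2) 1
  set C := max (B3 + B4) 1
  set N' := max N 1
  have hB0 : 0 < B := lt_of_lt_of_le one_pos (le_max_right _ _)
  have hC0 : 0 < C := lt_of_lt_of_le one_pos (le_max_right _ _)
  have hN0 : 0 < N' := lt_of_lt_of_le one_pos (le_max_right _ _)
  have hball : ∀ w ∈ Q, Metric.ball w ρ ⊆ Metric.cthickening ρ Q := fun w hw y hy =>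
    Metric.mem_cthickening_of_dist_le y w ρ Q hw (le_of_lt hy)
  have hη := hF.eta_pos
  refine ⟨ρ, N' * C + (1 + η) * B ^ 2, B, N' * B, m, hρ, by positivity, hB0, by positivity, hm,
    fun w hw hwc => ?_⟩
  have hwQ : w ∈ Q := ⟨hw, hwc⟩
  have hwT := hball w hwQ (Metric.mem_ball_self hρ)
  have hNw : ‖n (harm h g w)‖ ≤ N' := (hN _ hwc).trans (le_max_left _ _)
  have hBw : ∀ y ∈ Metric.cthickening ρ Q, ‖deriv h y‖ + ‖deriv g y‖ ≤ B := fun y hy =>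
    (add_le_add (hB1 y hy) (hB2 y hy)).trans (le_max_left _ _)
  refine ⟨hBw w hwT, hmQ w hwQ, ?_, fun v hv => ?_⟩
  · refine (norm_add_le _ _).trans ?_
    rw [norm_mul, norm_mul, RCLike.norm_conj, ← mul_add]
    exact mul_le_mul hNw (hBw w hwT) (by positivity) hN0.le
  have hvb : w + v ∈ Metric.ball w ρ := by simpa using hv
  have hbD := (hball w hwQ).trans hρD
  refine ⟨hbD hvb, ?_⟩
  have h3 := norm_sub_sub_mul_le (hf.analytic_h.mono hbD)
    ((norm_nonneg _).trans (hB3 w hwT)) (fun y hy => hB3 y (hball w hwQ hy)) hv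
  have h4 := norm_sub_sub_mul_le (hf.analytic_g.mono hbD)
    ((norm_nonneg _).trans (hB4 w hwT)) (fun y hy => hB4 y (hball w hwQ hy)) hv
  have h5 : ‖harm h g (w + v) - harm h g w‖ ≤ B * ‖v‖ := by
    have := norm_harm_sub_le (h := h) (g := g) Metric.isOpen_ball (convex_ball w ρ)
      (hf.analytic_h.mono hbD) (hf.analytic_g.mono hbD)
      (fun y hy => hBw y (hball w hwQ hy)) hvb (Metric.mem_ball_self hρ)
    simpa using this
  have h6 := hF.upper (harm h g w) (harm h g (w + v))
  have h7 : ((starRingEnd ℂ) (n (harm h g w)) * (harm h g (w + v) - harm h g w)).re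
      ≤ (pullbackGrad n h g w * v).re + N' * (C * ‖v‖ ^ 2) := by
    have e : ((starRingEnd ℂ) (n (harm h g w)) * (harm h g (w + v) - harm h g w)).re
        = (pullbackGrad n h g w * v).re
          + ((starRingEnd ℂ) (n (harm h g w)) * ((h (w + v) - h w - deriv h w * v)
            + (starRingEnd ℂ) (g (w + v) - g w - deriv g w * v))).re := by
      simp only [harm, pullbackGrad, Complex.add_re, Complex.add_im, Complex.mul_re, Complex.mul_im,
        Complex.sub_re, Complex.sub_im, Complex.conj_re, Complex.conj_im]
      ring
    rw [e]
    gcongr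
    refine (Complex.re_le_norm _).trans ?_
    rw [norm_mul, RCLike.norm_conj]
    refine mul_le_mul hNw ((norm_add_le _ _).trans ?_) (norm_nonneg _) hN0.le
    rw [RCLike.norm_conj]
    calc _ ≤ (B3 + B4) * ‖v‖ ^ 2 := by rw [add_mul]; exact add_le_add h3 h4
      _ ≤ _ := by gcongr; exact le_max_left _ _
  have h8 : ‖harm h g (w + v) - harm h g w‖ ^ 2 ≤ B ^ 2 * ‖v‖ ^ 2 := by
    rw [← mul_pow]; exact pow_le_pow_left₀ (norm_nonneg _) h5 2
  nlinarith [mul_le_mul_of_nonneg_left h8 (by positivity : 0 ≤ 1 + η)]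

end pullback

/-! ### Riemann maps of sublevel domains -/

/-- `φ` is the normalized Riemann map of the sublevel domain `{F ∘ (h + conj g) < c}`. -/
structure IsLevelMap (h g : ℂ → ℂ) (F : ℂ → ℝ) (c : ℝ) (φ : ℂ → ℂ) : Prop where
  analytic : DifferentiableOn ℂ φ unitDisk
  injOn : Set.InjOn φ unitDisk
  image_eq : φ '' unitDisk = {z | z ∈ unitDisk ∧ F (harm h g z) < c}
  map_zero : φ 0 = 0
  deriv_zero : ∃ t : ℝ, 0 < t ∧ deriv φ 0 = t

section levelMap

variable {h g n φ : ℂ → ℂ} {F : ℂ → ℝ} {η c : ℝ}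

theorem IsConvexHarmonic.isOpen_sublevel (hf : IsConvexHarmonic h g) (hF : Continuous F) :
    IsOpen {z | z ∈ unitDisk ∧ F (harm h g z) < c} :=
  (continuousOn_harm hf.analytic_h hf.analytic_g).isOpen_inter_preimage isOpen_unitDisk
    (isOpen_lt hF continuous_const)

theorem IsConvexHarmonic.harm_zero (hf : IsConvexHarmonic h g) : harm h g 0 = 0 := by
  simp [harm, hf.h_zero, hf.g_zero]

/-- The harmonic map is a homeomorphism of this set onto the convex set {F < c}, so the set is
contractible. -/
theorem IsConvexHarmonic.isSimplyConnected_sublevel (hf : IsConvexHarmonic h g)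
    (hF : IsConvexDefining F n η c) (hsub : {x | F x ≤ c} ⊆ harm h g '' unitDisk) :
    IsSimplyConnected {z | z ∈ unitDisk ∧ F (harm h g z) < c} := by
  set k := Function.invFunOn (harm h g) unitDisk with hk
  have hkl : ∀ z ∈ unitDisk, k (harm h g z) = z := fun z hz => hf.injOn.leftInvOn_invFunOn hz
  have hlt : {x | F x < c} ⊆ {x | F x ≤ c} := fun x (hx : F x < c) => show F x ≤ c from hx.le
  have hcont : ContinuousOn k {x | F x < c} := by
    intro x hx
    obtain ⟨z, hz, rfl⟩ := hsub (hlt hx)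
    exact (continuousAt_leftInv_harm isOpen_unitDisk hf.analytic_h hf.analytic_g hf.lt hkl
      hz).continuousWithinAt
  have hcf : ContinuousOn (harm h g) {z | z ∈ unitDisk ∧ F (harm h g z) < c} :=
    (continuousOn_harm hf.analytic_h hf.analytic_g).mono fun z hz => hz.1
  have hkm : ∀ x : {x | F x < c}, k x ∈ {z | z ∈ unitDisk ∧ F (harm h g z) < c} := by
    intro x
    obtain ⟨z, hz, hzx⟩ := hsub (hlt x.2)
    rw [← hzx, hkl z hz]
    refine ⟨hz, ?_⟩
    rw [hzx]
    exact x.2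
  let e : {z | z ∈ unitDisk ∧ F (harm h g z) < c} ≃ₜ {x | F x < c} :=
    { toFun := fun z => ⟨harm h g z, z.2.2⟩
      invFun := fun x => ⟨k x, hkm x⟩
      left_inv := fun z => Subtype.ext (hkl z z.2.1)
      right_inv := fun x => Subtype.ext (by
        obtain ⟨z, hz, hzx⟩ := hsub (hlt x.2)
        change harm h g (k x) = x
        rw [← hzx, hkl z hz])
      continuous_toFun := (continuousOn_iff_continuous_domRestrict.1 hcf).subtype_mk fun z => z.2.2
      continuous_invFun := (continuousOn_iff_continuous_domRestrict.1 hcont).subtype_mk hkm }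
  have hne : {x | F x < c}.Nonempty := ⟨0, by rw [Set.mem_ofPred_eq, hF.map_zero]; exact hF.c_pos⟩
  have : ContractibleSpace {x | F x < c} := hF.convex_lt.contractibleSpace hne
  have := e.contractibleSpace
  exact SimplyConnectedSpace.ofContractible _

theorem exists_isLevelMap (hf : IsConvexHarmonic h g) (hF : IsConvexDefining F n η c)
    (hsub : {x | F x ≤ c} ⊆ harm h g '' unitDisk) : ∃ φ, IsLevelMap h g F c φ := by
  set U := {z | z ∈ unitDisk ∧ F (harm h g z) < c} with hU
  have h0 : (0 : ℂ) ∈ U := ⟨zero_mem_unitDisk, by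
    rw [hf.harm_zero, hF.map_zero]; exact hF.c_pos⟩
  have hUo : IsOpen U := hf.isOpen_sublevel hF.continuous_F
  have hUc := hf.isSimplyConnected_sublevel hF hsub
  obtain ⟨ψ, hψ, hinj, himg, hψ0⟩ := exists_riemannMap hUo hUc (fun z hz => hz.1) h0
  obtain ⟨φ, hφ, hφψ, hφd⟩ := exists_analytic_inverse hUo
    hUc.isPathConnected.isConnected.isPreconnected hψ hinj
  rw [himg] at hφ
  have hφ0 : φ 0 = 0 := by have := hφψ 0 h0; rwa [hψ0] at this
  have hd0 : deriv φ 0 ≠ 0 := by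
    intro h
    have := hφd 0 h0
    rw [hψ0, h, zero_mul] at this
    exact zero_ne_one this
  set d := deriv φ 0 with hd
  have hdn : (‖d‖ : ℂ) ≠ 0 := by exact_mod_cast norm_ne_zero_iff.2 hd0
  -- Rotating the variable by u makes the derivative at the origin positive.
  set u : ℂ := (starRingEnd ℂ) d / ‖d‖ with hu
  have hun : ‖u‖ = 1 := by
    rw [hu, norm_div, RCLike.norm_conj, Complex.norm_real, norm_norm,
      div_self (norm_ne_zero_iff.2 hd0)]
  have hmaps : ∀ z ∈ unitDisk, u * z ∈ unitDisk := fun z hz => by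
    rw [mem_unitDisk] at hz ⊢
    rwa [norm_mul, hun, one_mul]
  have hu0 : u ≠ 0 := norm_ne_zero_iff.1 (by rw [hun]; exact one_ne_zero)
  have hφinj : Set.InjOn φ unitDisk := by
    intro x hx y hy hxy
    have hx' : x ∈ ψ '' U := by rw [himg]; exact hx
    have hy' : y ∈ ψ '' U := by rw [himg]; exact hy
    obtain ⟨a, ha, rfl⟩ := hx'
    obtain ⟨b, hb, rfl⟩ := hy'
    rw [hφψ a ha, hφψ b hb] at hxy
    rw [hxy]
  refine ⟨fun z => φ (u * z), ⟨?_, ?_, ?_, ?_, ‖d‖, norm_pos_iff.2 hd0, ?_⟩⟩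
  · exact hφ.comp (differentiableOn_id.const_mul u) hmaps
  · intro x hx y hy hxy
    exact mul_left_cancel₀ hu0 (hφinj (hmaps x hx) (hmaps y hy) hxy)
  · ext w
    constructor
    · rintro ⟨z, hz, rfl⟩
      have : u * z ∈ ψ '' U := by rw [himg]; exact hmaps z hz
      obtain ⟨a, ha, hau⟩ := this
      simp only [← hau, hφψ a ha]
      exact ha
    · intro hw
      refine ⟨u⁻¹ * ψ w, ?_, ?_⟩
      · have : ψ w ∈ Metric.ball (0 : ℂ) 1 := himg ▸ ⟨w, hw, rfl⟩
        rw [mem_unitDisk, norm_mul, norm_inv, hun, inv_one, one_mul]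
        exact mem_ball_zero_iff.1 this
      · simp only [mul_inv_cancel_left₀ hu0]
        exact hφψ w hw
  · simp [hφ0]
  · have h1 : HasDerivAt φ d (u * 0) := by
      rw [mul_zero]
      exact (hφ.differentiableAt (isOpen_unitDisk.mem_nhds zero_mem_unitDisk)).hasDerivAt
    have h2 := (h1.comp 0 (((hasDerivAt_id (0 : ℂ)).const_mul u).congr_deriv (mul_one u))).deriv
    change deriv (φ ∘ fun z => u * z) 0 = _
    refine h2.trans ?_
    rw [hu, mul_div_assoc', Complex.mul_conj', sq, mul_div_assoc, div_self hdn, mul_one]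

theorem IsLevelMap.mem (hφ : IsLevelMap h g F c φ) {z : ℂ} (hz : z ∈ unitDisk) :
    φ z ∈ unitDisk ∧ F (harm h g (φ z)) < c := by
  have : φ z ∈ φ '' unitDisk := ⟨z, hz, rfl⟩
  rwa [hφ.image_eq] at this

theorem IsLevelMap.norm_deriv_le (hφ : IsLevelMap h g F c φ) {z : ℂ} (hz : z ∈ unitDisk) :
    ‖deriv φ z‖ ≤ 2 / (1 - ‖z‖) := by
  have hz' := mem_unitDisk.1 hz
  have hsub : Metric.ball z (1 - ‖z‖) ⊆ unitDisk := fun y hy => by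
    rw [mem_unitDisk]
    have := norm_le_norm_add_norm_sub' y z
    rw [Metric.mem_ball, dist_eq_norm] at hy
    linarith
  refine Complex.norm_deriv_le_div_of_mapsTo_ball (hφ.analytic.mono hsub) (fun y hy => ?_)
    (by linarith)
  have h1 := mem_unitDisk.1 (hφ.mem (hsub hy)).1
  have h2 := mem_unitDisk.1 (hφ.mem hz).1
  rw [Metric.mem_closedBall, dist_eq_norm]
  linarith [norm_sub_le (φ y) (φ z)]

/-- The support function of `{F < c}` at the point `f (φ z)`, pulled back to the disk. -/
theorem IsLevelMap.re_support (hf : IsConvexHarmonic h g) (hF : IsConvexDefining F n η c)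
    (hφ : IsLevelMap h g F c φ) {z : ℂ} (hz : z ∈ unitDisk) :
    ∃ p : ℂ → ℂ, DifferentiableOn ℂ p unitDisk ∧ (∀ y ∈ unitDisk, 0 ≤ (p y).re) ∧
      (p z).re = c - F (harm h g (φ z)) ∧ c ≤ (p 0).re ∧
      deriv p z = - (pullbackGrad n h g (φ z) * deriv φ z) := by
  set x := harm h g (φ z) with hx
  have hmaps : Set.MapsTo φ unitDisk unitDisk := fun y hy => (hφ.mem hy).1
  -- The real part is c - F x minus the linear form of the normal at x. By convexity it is at least
  -- c - F(f(φ y)), hence positive.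
  set p : ℂ → ℂ := fun y => ((c - F x : ℝ) : ℂ) + (starRingEnd ℂ) (n x) * x
    - ((starRingEnd ℂ) (n x) * h (φ y) + n x * g (φ y)) with hp
  have hre : ∀ y, (p y).re = (c - F x) - ((starRingEnd ℂ) (n x) * (harm h g (φ y) - x)).re := by
    intro y
    simp only [hp, harm, Complex.add_re, Complex.add_im, Complex.mul_re,
      Complex.sub_re, Complex.sub_im, Complex.conj_re, Complex.conj_im, Complex.ofReal_re]
    ring
  have hzn := isOpen_unitDisk.mem_nhds hz
  have hφzn := isOpen_unitDisk.mem_nhds (hφ.mem hz).1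
  refine ⟨p, ?_, fun y hy => ?_, ?_, ?_, ?_⟩
  · exact (differentiableOn_const _).sub
      (((hf.analytic_h.comp hφ.analytic hmaps).const_mul _).add
        ((hf.analytic_g.comp hφ.analytic hmaps).const_mul _))
  · rw [hre]
    linarith [hF.re_conj_mul_sub_le x (harm h g (φ y)), (hφ.mem hy).2]
  · rw [hre, ← hx, sub_self, mul_zero, Complex.zero_re, sub_zero]
  · rw [hre, hφ.map_zero, hf.harm_zero, zero_sub, mul_neg, Complex.neg_re]
    linarith [hF.le_re_conj_mul_self x]
  · have h1 := ((hf.analytic_h.differentiableAt hφzn).hasDerivAt.comp z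
      (hφ.analytic.differentiableAt hzn).hasDerivAt).const_mul ((starRingEnd ℂ) (n x))
    have h2 := ((hf.analytic_g.differentiableAt hφzn).hasDerivAt.comp z
      (hφ.analytic.differentiableAt hzn).hasDerivAt).const_mul (n x)
    refine (((h1.add h2).const_sub (((c - F x : ℝ) : ℂ) + (starRingEnd ℂ) (n x) * x)).congr_deriv
      ?_).deriv
    simp only [pullbackGrad, ← hx]
    ring

/-- Harnack's inequality applies to the support function, whose real part is at least c at the
origin and equals the depth c - F at z. -/
theorem IsLevelMap.mul_one_sub_norm_le (hf : IsConvexHarmonic h g)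
    (hF : IsConvexDefining F n η c) (hφ : IsLevelMap h g F c φ) {z : ℂ} (hz : z ∈ unitDisk) :
    c * (1 - ‖z‖) ≤ 2 * (c - F (harm h g (φ z))) := by
  obtain ⟨p, hp, hre, hpz, hp0, -⟩ := hφ.re_support hf hF hz
  have h1 := re_mul_le_of_re_nonneg hp hre hz
  rw [dist_zero_right, div_one, hpz] at h1
  have h2 := mem_unitDisk.1 hz
  have h3 := (hφ.mem hz).2
  nlinarith [norm_nonneg z]

end levelMap

/-! ### Harnack estimates for maps into the disk -/

section selfMap

variable {ψ : ℂ → ℂ} {w₀ : ℂ} {R : ℝ}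

/-- Choosing u so that u ψ(w) = |ψ(w)| replaces 1 - |ψ| by the real part of an analytic function
that dominates it and agrees with it at w. Harnack and gradient bounds then apply. -/
theorem exists_re_nonneg_of_norm_lt_one (hψ : DifferentiableOn ℂ ψ (Metric.ball w₀ R))
    (hψ1 : ∀ y ∈ Metric.ball w₀ R, ‖ψ y‖ < 1) (w : ℂ) :
    ∃ u : ℂ, ‖u‖ = 1 ∧ DifferentiableOn ℂ (fun y => 1 - u * ψ y) (Metric.ball w₀ R) ∧
      (∀ y ∈ Metric.ball w₀ R, 0 ≤ (1 - u * ψ y).re) ∧ (∀ y, 1 - ‖ψ y‖ ≤ (1 - u * ψ y).re) ∧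
      (1 - u * ψ w).re = 1 - ‖ψ w‖ := by
  obtain ⟨u, hu, huw⟩ := Complex.exists_norm_eq_mul_self (ψ w)
  have h1 : ∀ y, 1 - ‖ψ y‖ ≤ (1 - u * ψ y).re := fun y => by
    have := Complex.re_le_norm (u * ψ y)
    rw [norm_mul, hu, one_mul] at this
    rw [Complex.sub_re, Complex.one_re]
    linarith
  refine ⟨u, hu, (hψ.const_mul u).const_sub 1, fun y hy => ?_, h1, ?_⟩
  · linarith [h1 y, hψ1 y hy]
  · rw [← huw, Complex.sub_re, Complex.one_re, Complex.ofReal_re]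

theorem one_sub_norm_mul_le (hψ : DifferentiableOn ℂ ψ (Metric.ball w₀ R))
    (hψ1 : ∀ y ∈ Metric.ball w₀ R, ‖ψ y‖ < 1) {w : ℂ} (hw : w ∈ Metric.ball w₀ R) :
    (1 - ‖ψ w₀‖) * (1 - dist w w₀ / R) ≤ 2 * (1 - ‖ψ w‖) := by
  obtain ⟨u, hu, hp, hre, hle, hweq⟩ := exists_re_nonneg_of_norm_lt_one hψ hψ1 w
  have h1 := re_mul_le_of_re_nonneg hp hre hw
  rw [hweq] at h1
  have hR : 0 < R := Metric.pos_of_mem_ball hw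
  have ht : dist w w₀ / R ≤ 1 := (div_le_one hR).2 (le_of_lt hw)
  nlinarith [hle w₀, hψ1 w hw]

theorem norm_deriv_le_one_sub_norm (hR : 0 < R) (hψ : DifferentiableOn ℂ ψ (Metric.ball w₀ R))
    (hψ1 : ∀ y ∈ Metric.ball w₀ R, ‖ψ y‖ < 1) : ‖deriv ψ w₀‖ ≤ 2 * (1 - ‖ψ w₀‖) / R := by
  obtain ⟨u, hu, hp, hre, hle, hweq⟩ := exists_re_nonneg_of_norm_lt_one hψ hψ1 w₀
  have h1 := norm_deriv_le_of_re_nonneg hR hp hre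
  have hd := (hψ.differentiableAt (Metric.ball_mem_nhds w₀ hR)).hasDerivAt
  rw [hweq, ((hd.const_mul u).const_sub 1).deriv, norm_neg, norm_mul, hu, one_mul] at h1
  exact h1

end selfMap

/-! ### Two-sided boundary estimates for the level map -/

section boundary

variable {h g n φ : ℂ → ℂ} {F : ℂ → ℝ} {η c : ℝ}

theorem IsConvexDefining.exists_sub_le (hF : IsConvexDefining F n η c) :
    ∃ T : ℝ, 0 < T ∧ ∀ x, F x ≤ c → c - F x ≤ T := by
  obtain ⟨T, hT⟩ := hF.compact.exists_bound_of_continuousOn hF.continuous_F.continuousOn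
  refine ⟨c + max T 1, by linarith [hF.c_pos, le_max_right T 1], fun x hx => ?_⟩
  have h1 := hT x hx
  rw [Real.norm_eq_abs] at h1
  linarith [neg_abs_le (F x), le_max_left T 1]

/-- Where F ≥ c/2, the inequality F(x) ≤ Re(conj n(x) x) ≤ |n||x| on a bounded set keeps the normal
n away from 0. -/
theorem IsConvexDefining.exists_le_norm_pullbackGrad (hF : IsConvexDefining F n η c) {m : ℝ} (hm : 0 < m)
    (hmle : ∀ w ∈ unitDisk, F (harm h g w) ≤ c → m ≤ ‖deriv h w‖ - ‖deriv g w‖) :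
    ∃ l : ℝ, 0 < l ∧ ∀ w ∈ unitDisk, F (harm h g w) ≤ c → c / 2 ≤ F (harm h g w) →
      l ≤ ‖pullbackGrad n h g w‖ := by
  obtain ⟨R, hR⟩ := hF.compact.isBounded.exists_norm_le
  have hR0 : 0 < max R 1 := lt_of_lt_of_le one_pos (le_max_right _ _)
  have hc := hF.c_pos
  refine ⟨c / (2 * max R 1) * m, by positivity, fun w hw hwc hwl => ?_⟩
  refine le_trans ?_ (norm_mul_le_norm_pullbackGrad w)
  refine mul_le_mul ?_ (hmle w hw hwc) hm.le (norm_nonneg _)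
  rw [div_le_iff₀ (by positivity)]
  have h1 := hF.le_re_conj_mul_self (harm h g w)
  have h2 := (Complex.re_le_norm _).trans (norm_mul_le ((starRingEnd ℂ) (n (harm h g w)))
    (harm h g w))
  rw [RCLike.norm_conj] at h2
  have h3 := mul_le_mul_of_nonneg_left ((hR _ hwc).trans (le_max_left R 1))
    (norm_nonneg (n (harm h g w)))
  linarith

/-- An interior ball touching near the boundary of the sublevel domain. -/
theorem exists_interior_ball (hf : IsConvexHarmonic h g)
    (hF : IsConvexDefining F n η c) (hsub : {x | F x ≤ c} ⊆ harm h g '' unitDisk) :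
    ∃ ρ κ ε : ℝ, 0 < ρ ∧ 0 < κ ∧ 0 < ε ∧ ∀ w ∈ unitDisk, F (harm h g w) < c →
      c / 2 ≤ F (harm h g w) → κ * (c - F (harm h g w)) ≤ ρ ∧
      ∃ w₀ ∈ unitDisk, dist w w₀ = ρ ∧ F (harm h g w₀) ≤ c - ε ∧
        Metric.ball w₀ (ρ + κ * (c - F (harm h g w))) ⊆
          {z | z ∈ unitDisk ∧ F (harm h g z) < c} := by
  obtain ⟨ρ₀, M, B, Λ, m, hρ₀, hM, hB, hΛ, hm, hQ⟩ := hf.exists_pullback_bound hF hsub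
  obtain ⟨T, hT, hTle⟩ := hF.exists_sub_le
  obtain ⟨l, hl, hlle⟩ := hF.exists_le_norm_pullbackGrad hm fun w hw hwc => (hQ w hw hwc).2.1
  set ρ := min (ρ₀ / 4) (l / (2 * M)) with hρ
  have hρ0 : 0 < ρ := lt_min (by positivity) (by positivity)
  have hρ1 : ρ ≤ ρ₀ / 4 := min_le_left _ _
  have hρ2 : 2 * M * ρ ≤ l := by
    have : ρ ≤ l / (2 * M) := min_le_right _ _
    rwa [le_div_iff₀ (by positivity), mul_comm] at this
  have hden : 0 < T + 2 * ρ * (Λ + M * ρ) := by positivity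
  -- κ satisfies κT ≤ ρ and κ(Λ + Mρ) ≤ 1/2: the enlargement κΔ of the radius is at most ρ, and it
  -- costs at most half of the depth Δ.
  set κ := ρ / (T + 2 * ρ * (Λ + M * ρ)) with hκ
  have hκ0 : 0 < κ := by positivity
  have hκe : κ * (T + 2 * ρ * (Λ + M * ρ)) = ρ := div_mul_cancel₀ _ hden.ne'
  have hκT : κ * T ≤ ρ := by
    have : 0 ≤ κ * (2 * ρ * (Λ + M * ρ)) := by positivity
    linarith
  have hκ2 : κ * (Λ + M * ρ) ≤ 1 / 2 := by
    have h1 : (κ * (Λ + M * ρ)) * (2 * ρ) ≤ 1 / 2 * (2 * ρ) := by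
      have : 0 ≤ κ * T := by positivity
      linarith
    exact le_of_mul_le_mul_right h1 (by positivity)
  refine ⟨ρ, κ, l * ρ / 2, hρ0, hκ0, by positivity, fun w hw hwc hwl => ?_⟩
  obtain ⟨-, -, hΛw, hexp⟩ := hQ w hw hwc.le
  have hlw := hlle w hw hwc.le hwl
  set lam := pullbackGrad n h g w with hlam
  set Δ := c - F (harm h g w) with hΔ
  have hΔ0 : 0 < Δ := sub_pos.2 hwc
  have hδρ : κ * Δ ≤ ρ := le_trans (by gcongr; exact hTle _ hwc.le) hκT
  set δ := κ * Δ with hδ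
  have hδ0 : 0 < δ := by positivity
  -- u is the direction of steepest ascent of F ∘ f at w. The centre is w - ρu, where F ∘ f has
  -- dropped by at least lρ/2.
  obtain ⟨u, hu, hul⟩ := Complex.exists_norm_eq_mul_self lam
  have hwρ : ‖(ρ : ℂ) * u‖ = ρ := by
    rw [norm_mul, hu, mul_one, Complex.norm_real, Real.norm_of_nonneg hρ0.le]
  have hc0 := hexp (-(ρ * u)) (by rw [norm_neg, hwρ]; linarith)
  refine ⟨hδρ, w + -(ρ * u), hc0.1, ?_, ?_, fun y hy => ?_⟩
  · rw [dist_eq_norm, sub_add_cancel_left, neg_neg, hwρ]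
  · have h1 := hc0.2
    have e : (lam * -(ρ * u)).re = -(ρ * ‖lam‖) := by
      have : lam * -(ρ * u) = ((-(ρ * ‖lam‖) : ℝ) : ℂ) := by
        push_cast; rw [hul]; ring
      rw [this, Complex.ofReal_re]
    rw [e, norm_neg, hwρ] at h1
    nlinarith
  · rw [Metric.mem_ball, dist_eq_norm] at hy
    set s := y - (w + -(ρ * u)) with hs
    have hyv : y = w + (-(ρ * u) + s) := by rw [hs]; ring
    have hv : ‖-(ρ * u) + s‖ < ρ₀ := by
      refine (norm_add_le _ _).trans_lt ?_
      rw [norm_neg, hwρ]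
      linarith
    have h1 := hexp _ hv
    rw [← hyv] at h1
    refine ⟨h1.1, lt_of_le_of_lt h1.2 ?_⟩
    set a := ((starRingEnd ℂ) (-u) * s).re with ha
    have ha1 : |a| ≤ ‖s‖ := by
      refine (Complex.abs_re_le_norm _).trans_eq ?_
      rw [norm_mul, RCLike.norm_conj, norm_neg, hu, one_mul]
    have hlamu : lam = (‖lam‖ : ℂ) * (starRingEnd ℂ) u := by
      rw [hul, mul_right_comm, Complex.mul_conj', hu]; simp
    have e1 : (lam * (-(ρ * u) + s)).re = -(ρ * ‖lam‖) - ‖lam‖ * a := by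
      have : lam * (-(ρ * u) + s) = ((-(ρ * ‖lam‖) : ℝ) : ℂ)
          - (‖lam‖ : ℂ) * ((starRingEnd ℂ) (-u) * s) := by
        rw [map_neg, mul_add]
        conv_lhs => rw [show lam * s = (‖lam‖ : ℂ) * (starRingEnd ℂ) u * s by rw [← hlamu]]
        push_cast; rw [hul]; ring
      rw [this, Complex.sub_re, Complex.re_ofReal_mul, Complex.ofReal_re]
    have e2 : ‖-(ρ * u) + s‖ ^ 2 = ρ ^ 2 + 2 * ρ * a + ‖s‖ ^ 2 := by
      rw [norm_add_sq_complex, norm_neg, hwρ, ha]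
      have : (starRingEnd ℂ) (-((ρ : ℂ) * u)) * s = (ρ : ℂ) * ((starRingEnd ℂ) (-u) * s) := by
        simp only [map_neg, map_mul, Complex.conj_ofReal]; ring
      rw [this, Complex.re_ofReal_mul]
      ring
    rw [e1, e2]
    have h5 : ‖s‖ ^ 2 ≤ (ρ + δ) ^ 2 := pow_le_pow_left₀ (norm_nonneg _) hy.le 2
    -- The factors are nonnegative since 2Mρ ≤ l and |a| ≤ |s| < ρ + δ. This lets the linear descent
    -- absorb the curvature term 2Mρ(ρ + a).
    have h6 : 0 ≤ (‖lam‖ - 2 * M * ρ) * (ρ + a + δ) :=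
      mul_nonneg (by linarith) (by linarith [neg_abs_le a])
    have h7 : δ * (Λ + M * ρ) ≤ Δ / 2 := by
      calc δ * (Λ + M * ρ) = Δ * (κ * (Λ + M * ρ)) := by rw [hδ]; ring
        _ ≤ Δ * (1 / 2) := by gcongr
        _ = _ := by ring
    have h8 : F (harm h g w) = c - Δ := by rw [hΔ]; ring
    rw [h8]
    nlinarith [mul_le_mul_of_nonneg_left h5 hM.le, mul_le_mul_of_nonneg_right hΛw hδ0.le,
      mul_nonneg (mul_nonneg hM.le hδ0.le) (sub_nonneg.2 hδρ)]

end boundary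

section boundary

variable {h g n φ : ℂ → ℂ} {F : ℂ → ℝ} {η c : ℝ}

/-- Gradient and curvature of F ∘ f are bounded on the sublevel set, so a step shorter than a fixed
multiple of the depth cannot use up that depth. -/
theorem exists_ball_subset_sublevel (hf : IsConvexHarmonic h g)
    (hF : IsConvexDefining F n η c) (hsub : {x | F x ≤ c} ⊆ harm h g '' unitDisk) :
    ∃ κ : ℝ, 0 < κ ∧ ∀ w ∈ unitDisk, F (harm h g w) < c →
      Metric.ball w (κ * (c - F (harm h g w))) ⊆ {z | z ∈ unitDisk ∧ F (harm h g z) < c} := by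
  obtain ⟨ρ, M, B, Λ, m, hρ, hM, hB, hΛ, hm, hQ⟩ := hf.exists_pullback_bound hF hsub
  obtain ⟨T, hT, hTle⟩ := hF.exists_sub_le
  have hden : 0 < T + ρ * (Λ + M * ρ) := by positivity
  set κ := ρ / (T + ρ * (Λ + M * ρ)) with hκ
  have hκ0 : 0 < κ := by positivity
  have hκe : κ * (T + ρ * (Λ + M * ρ)) = ρ := div_mul_cancel₀ _ hden.ne'
  have hκT : κ * T ≤ ρ := by
    have : 0 ≤ κ * (ρ * (Λ + M * ρ)) := by positivity
    linarith
  have hκ2 : κ * (Λ + M * ρ) ≤ 1 := by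
    have h1 : (κ * (Λ + M * ρ)) * ρ ≤ 1 * ρ := by
      have : 0 ≤ κ * T := by positivity
      linarith
    exact le_of_mul_le_mul_right h1 (by positivity)
  refine ⟨κ, hκ0, fun w hw hwc y hy => ?_⟩
  obtain ⟨-, -, hΛw, hexp⟩ := hQ w hw hwc.le
  set Δ := c - F (harm h g w) with hΔ
  have hδρ : κ * Δ ≤ ρ := le_trans (by gcongr; exact hTle _ hwc.le) hκT
  rw [Metric.mem_ball, dist_eq_norm] at hy
  have hv : ‖y - w‖ < ρ := hy.trans_le hδρ
  have h1 := hexp _ hv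
  rw [add_sub_cancel] at h1
  refine ⟨h1.1, lt_of_le_of_lt h1.2 ?_⟩
  have h2 := (Complex.re_le_norm _).trans (norm_mul_le (pullbackGrad n h g w) (y - w))
  have h3 : ‖y - w‖ * (Λ + M * ρ) < Δ := by
    calc ‖y - w‖ * (Λ + M * ρ) < κ * Δ * (Λ + M * ρ) := by gcongr
      _ = Δ * (κ * (Λ + M * ρ)) := by ring
      _ ≤ Δ * 1 := by
        have : 0 ≤ Δ := (sub_pos.2 hwc).le
        gcongr
      _ = Δ := mul_one _
  have h4 : F (harm h g w) = c - Δ := by rw [hΔ]; ring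
  rw [h4]
  nlinarith [mul_le_mul_of_nonneg_right hΛw (norm_nonneg (y - w)),
    mul_le_mul_of_nonneg_left hv.le (mul_nonneg hM.le (norm_nonneg (y - w)))]

/-- The inverse of the level map. -/
theorem IsLevelMap.exists_inverse (hφ : IsLevelMap h g F c φ) : ∃ ψ : ℂ → ℂ,
    DifferentiableOn ℂ ψ {z | z ∈ unitDisk ∧ F (harm h g z) < c} ∧
    (∀ w ∈ {z | z ∈ unitDisk ∧ F (harm h g z) < c}, ‖ψ w‖ < 1) ∧
    (∀ z ∈ unitDisk, ψ (φ z) = z) ∧ ∀ z ∈ unitDisk, deriv ψ (φ z) * deriv φ z = 1 := by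
  obtain ⟨ψ, hψ, hψφ, hd⟩ := exists_analytic_inverse isOpen_unitDisk
    (convex_ball _ _).isPreconnected hφ.analytic hφ.injOn
  rw [hφ.image_eq] at hψ
  refine ⟨ψ, hψ, fun w hw => ?_, hψφ, hd⟩
  rw [← hφ.image_eq] at hw
  obtain ⟨z, hz, rfl⟩ := hw
  rw [hψφ z hz]
  exact mem_unitDisk.1 hz

theorem exists_le_one_sub_norm_of_le (hf : IsConvexHarmonic h g)
    (hF : IsConvexDefining F n η c) (hsub : {x | F x ≤ c} ⊆ harm h g '' unitDisk) {ψ : ℂ → ℂ}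
    (hψ : ContinuousOn ψ {z | z ∈ unitDisk ∧ F (harm h g z) < c})
    (hψ1 : ∀ w ∈ {z | z ∈ unitDisk ∧ F (harm h g z) < c}, ‖ψ w‖ < 1) {ε : ℝ} (hε : 0 < ε) :
    ∃ κ : ℝ, 0 < κ ∧ ∀ w ∈ unitDisk, F (harm h g w) ≤ c - ε → κ ≤ 1 - ‖ψ w‖ := by
  have hQ := hf.isCompact_sublevel hF hsub
  set Q := {z | z ∈ unitDisk ∧ F (harm h g z) ≤ c}
  have hcf : ContinuousOn (fun z => F (harm h g z)) Q :=
    hF.continuous_F.comp_continuousOn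
      ((continuousOn_harm hf.analytic_h hf.analytic_g).mono fun z hz => hz.1)
  have hS : IsCompact (Q ∩ (fun z => F (harm h g z)) ⁻¹' Set.Iic (c - ε)) :=
    hQ.of_isClosed_subset (hcf.preimage_isClosed_of_isClosed hQ.isClosed isClosed_Iic)
      Set.inter_subset_left
  have hSU : ∀ w ∈ Q ∩ (fun z => F (harm h g z)) ⁻¹' Set.Iic (c - ε),
      w ∈ {z | z ∈ unitDisk ∧ F (harm h g z) < c} := by
    rintro w ⟨⟨hw, -⟩, hwε⟩
    exact ⟨hw, by have : F (harm h g w) ≤ c - ε := hwε; linarith⟩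
  rcases Set.eq_empty_or_nonempty (Q ∩ (fun z => F (harm h g z)) ⁻¹' Set.Iic (c - ε)) with hS0 | hS0
  · refine ⟨1, one_pos, fun w hw hwε => ?_⟩
    have : w ∈ Q ∩ (fun z => F (harm h g z)) ⁻¹' Set.Iic (c - ε) :=
      ⟨⟨hw, by linarith⟩, hwε⟩
    rw [hS0] at this
    exact this.elim
  · obtain ⟨z, hz, hmin⟩ := hS.exists_isMinOn (f := fun w => 1 - ‖ψ w‖) hS0
      (continuousOn_const.sub (hψ.mono hSU).norm)
    exact ⟨1 - ‖ψ z‖, sub_pos.2 (hψ1 z (hSU z hz)), fun w hw hwε =>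
      hmin ⟨⟨hw, by linarith⟩, hwε⟩⟩

/-- A Hopf-type estimate, opposite to `IsLevelMap.mul_one_sub_norm_le`. Near the boundary Harnack is
applied to the inverse of φ on an interior ball, whose centre lies at a fixed depth where 1 - |ψ| is
bounded below. Elsewhere compactness suffices. -/
theorem IsLevelMap.exists_mul_sub_le (hφ : IsLevelMap h g F c φ) (hf : IsConvexHarmonic h g)
    (hF : IsConvexDefining F n η c) (hsub : {x | F x ≤ c} ⊆ harm h g '' unitDisk) :
    ∃ κ : ℝ, 0 < κ ∧ ∀ z ∈ unitDisk, κ * (c - F (harm h g (φ z))) ≤ 1 - ‖z‖ := by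
  obtain ⟨ψ, hψ, hψ1, hψφ, -⟩ := hφ.exists_inverse
  obtain ⟨ρ, κ, ε, hρ, hκ, hε, hint⟩ := exists_interior_ball hf hF hsub
  obtain ⟨T, hT, hTle⟩ := hF.exists_sub_le
  have hc := hF.c_pos
  obtain ⟨k₁, hk₁, hk₁le⟩ := exists_le_one_sub_norm_of_le hf hF hsub hψ.continuousOn hψ1 hε
  obtain ⟨k₂, hk₂, hk₂le⟩ := exists_le_one_sub_norm_of_le hf hF hsub hψ.continuousOn hψ1
    (half_pos hc)
  refine ⟨min (k₂ / T) (k₁ * κ / (4 * ρ)), lt_min (by positivity) (by positivity),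
    fun z hz => ?_⟩
  obtain ⟨hφz, hφc⟩ := hφ.mem hz
  set w := φ z with hw
  have hΔ0 : 0 < c - F (harm h g w) := sub_pos.2 hφc
  rcases le_total (c / 2) (F (harm h g w)) with hcase | hcase
  · obtain ⟨hδρ, w₀, hw₀, hdist, hw₀ε, hball⟩ := hint w hφz hφc hcase
    set Δ := c - F (harm h g w) with hΔ
    have hδ0 : 0 < κ * Δ := by positivity
    have hwb : w ∈ Metric.ball w₀ (ρ + κ * Δ) := by
      rw [Metric.mem_ball, hdist]; linarith
    have h1 := one_sub_norm_mul_le (hψ.mono hball) (fun y hy => hψ1 y (hball hy)) hwb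
    rw [hdist, hw, hψφ z hz] at h1
    have h2 := hk₁le w₀ hw₀ hw₀ε
    have h3 : κ * Δ / (2 * ρ) ≤ 1 - ρ / (ρ + κ * Δ) := by
      rw [one_sub_div (by positivity), add_sub_cancel_left]
      gcongr
      linarith
    calc min (k₂ / T) (k₁ * κ / (4 * ρ)) * Δ ≤ (k₁ * κ / (4 * ρ)) * Δ := by
          gcongr; exact min_le_right _ _
      _ = k₁ * (κ * Δ / (2 * ρ)) / 2 := by field_simp; ring
      _ ≤ (1 - ‖ψ w₀‖) * (1 - ρ / (ρ + κ * Δ)) / 2 := by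
          have := hk₁.le.trans h2
          gcongr
      _ ≤ 1 - ‖z‖ := by linarith
  · have h1 := hk₂le w hφz (by linarith)
    rw [hw, hψφ z hz] at h1
    calc min (k₂ / T) (k₁ * κ / (4 * ρ)) * (c - F (harm h g w)) ≤ (k₂ / T) * T := by
          gcongr
          · exact min_le_left _ _
          · exact hTle _ hφc.le
      _ = k₂ := div_mul_cancel₀ _ hT.ne'
      _ ≤ _ := h1

/-- The gradient bound for the support function gives |λφ'| ≤ 2(c - F)/(1 - |z|), where λ is the
pulled-back gradient, and the Hopf-type estimate bounds this quotient. Near the boundary λ is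
bounded below; elsewhere 1 - |z| is. -/
theorem IsLevelMap.exists_norm_deriv_le (hφ : IsLevelMap h g F c φ) (hf : IsConvexHarmonic h g)
    (hF : IsConvexDefining F n η c) (hsub : {x | F x ≤ c} ⊆ harm h g '' unitDisk) :
    ∃ C : ℝ, 0 < C ∧ ∀ z ∈ unitDisk, ‖deriv φ z‖ ≤ C := by
  obtain ⟨κ, hκ, hκle⟩ := hφ.exists_mul_sub_le hf hF hsub
  obtain ⟨_, _, _, _, m, -, -, -, -, hm, hQ⟩ := hf.exists_pullback_bound hF hsub
  obtain ⟨l, hl, hlle⟩ := hF.exists_le_norm_pullbackGrad hm fun w hw hwc => (hQ w hw hwc).2.1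
  have hc := hF.c_pos
  refine ⟨2 / (κ * l) + 2 / (κ * (c / 2)), by positivity, fun z hz => ?_⟩
  obtain ⟨hφz, hφc⟩ := hφ.mem hz
  have hz1 := mem_unitDisk.1 hz
  have hΔ0 : 0 < c - F (harm h g (φ z)) := sub_pos.2 hφc
  have hκz := hκle z hz
  rcases le_total (c / 2) (F (harm h g (φ z))) with hcase | hcase
  · refine le_trans ?_ (le_add_of_nonneg_right (by positivity))
    obtain ⟨p, hp, hre, hpz, -, hpd⟩ := hφ.re_support hf hF hz
    have hsubz : Metric.ball z (1 - ‖z‖) ⊆ unitDisk := fun y hy => by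
      rw [mem_unitDisk]
      have := norm_le_norm_add_norm_sub' y z
      rw [Metric.mem_ball, dist_eq_norm] at hy
      linarith
    have h1 := norm_deriv_le_of_re_nonneg (by linarith) (hp.mono hsubz)
      fun y hy => hre y (hsubz hy)
    rw [hpd, norm_neg, norm_mul, hpz, le_div_iff₀ (by linarith)] at h1
    have h2 := hlle _ hφz hφc.le hcase
    rw [le_div_iff₀ (by positivity)]
    have h3 : (‖deriv φ z‖ * (κ * l)) * (c - F (harm h g (φ z)))
        ≤ 2 * (c - F (harm h g (φ z))) := by
      refine le_trans ?_ h1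
      calc _ = l * ‖deriv φ z‖ * (κ * (c - F (harm h g (φ z)))) := by ring
        _ ≤ _ := by gcongr
    exact le_of_mul_le_mul_right h3 hΔ0
  · refine le_trans ?_ (le_add_of_nonneg_left (by positivity))
    refine (hφ.norm_deriv_le hz).trans ?_
    gcongr
    refine le_trans ?_ hκz
    gcongr
    linarith

/-- The inverse ψ is defined on a ball of radius proportional to the depth, and 1 - |ψ| is at most a
multiple of the depth. The gradient bound therefore controls ψ' = 1/φ'. -/
theorem IsLevelMap.exists_le_norm_deriv (hφ : IsLevelMap h g F c φ) (hf : IsConvexHarmonic h g)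
    (hF : IsConvexDefining F n η c) (hsub : {x | F x ≤ c} ⊆ harm h g '' unitDisk) :
    ∃ C : ℝ, 0 < C ∧ ∀ z ∈ unitDisk, C ≤ ‖deriv φ z‖ := by
  obtain ⟨κ, hκ, hball⟩ := exists_ball_subset_sublevel hf hF hsub
  obtain ⟨ψ, hψ, hψ1, hψφ, hψd⟩ := hφ.exists_inverse
  have hc := hF.c_pos
  refine ⟨κ * c / 4, by positivity, fun z hz => ?_⟩
  obtain ⟨hφz, hφc⟩ := hφ.mem hz
  have hΔ0 : 0 < c - F (harm h g (φ z)) := sub_pos.2 hφc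
  have hb := hball _ hφz hφc
  have h1 := norm_deriv_le_one_sub_norm (by positivity) (hψ.mono hb) fun y hy => hψ1 y (hb hy)
  rw [hψφ z hz, le_div_iff₀ (by positivity)] at h1
  have h2 := congrArg norm (hψd z hz)
  rw [norm_mul, norm_one] at h2
  have h3 := hφ.mul_one_sub_norm_le hf hF hz
  have h4 : ‖deriv ψ (φ z)‖ * (κ * c) ≤ 4 := by
    have : (‖deriv ψ (φ z)‖ * (κ * c)) * (c - F (harm h g (φ z)))
        ≤ 4 * (c - F (harm h g (φ z))) := by nlinarith
    exact le_of_mul_le_mul_right this hΔ0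
  have h5 : 0 < ‖deriv φ z‖ := by
    rcases (norm_nonneg (deriv φ z)).eq_or_lt with h | h
    · rw [← h, mul_zero] at h2; exact absurd h2 zero_ne_one
    · exact h
  calc κ * c / 4 = (‖deriv ψ (φ z)‖ * ‖deriv φ z‖) * (κ * c) / 4 := by rw [h2, one_mul]
    _ = ‖deriv ψ (φ z)‖ * (κ * c) * ‖deriv φ z‖ / 4 := by ring
    _ ≤ 4 * ‖deriv φ z‖ / 4 := by gcongr
    _ = _ := by ring

theorem IsLevelMap.harm_comp_image (hφ : IsLevelMap h g F c φ)
    (hsub : {x | F x ≤ c} ⊆ harm h g '' unitDisk) :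
    harm (h ∘ φ) (g ∘ φ) '' unitDisk = {x | F x < c} := by
  have : harm (h ∘ φ) (g ∘ φ) = harm h g ∘ φ := rfl
  rw [this, Set.image_comp, hφ.image_eq]
  ext x
  constructor
  · rintro ⟨z, hz, rfl⟩
    exact hz.2
  · intro hx
    have hx' : F x < c := hx
    obtain ⟨z, hz, rfl⟩ := hsub (show F x ≤ c from hx'.le)
    exact ⟨z, ⟨hz, hx⟩, rfl⟩

/-- Bounds on the differential integrate to bounds on distances in both directions, since the disk
and the range {F < c} are both convex. -/
theorem IsLevelMap.bilipschitz (hφ : IsLevelMap h g F c φ) (hf : IsConvexHarmonic h g)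
    (hF : IsConvexDefining F n η c) (hsub : {x | F x ≤ c} ⊆ harm h g '' unitDisk) :
    ∃ m C : ℝ, 0 < m ∧ 0 < C ∧ ∀ z ∈ unitDisk, ∀ w ∈ unitDisk,
      m * ‖z - w‖ ≤ ‖harm h g (φ z) - harm h g (φ w)‖ ∧
      ‖harm h g (φ z) - harm h g (φ w)‖ ≤ C * ‖z - w‖ := by
  obtain ⟨C, hC, hCle⟩ := hφ.exists_norm_deriv_le hf hF hsub
  obtain ⟨k, hk, hkle⟩ := hφ.exists_le_norm_deriv hf hF hsub
  obtain ⟨_, _, B, _, m, -, -, hB, -, hm, hQ⟩ := hf.exists_pullback_bound hF hsub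
  have hmaps : Set.MapsTo φ unitDisk unitDisk := fun y hy => (hφ.mem hy).1
  have hH : DifferentiableOn ℂ (h ∘ φ) unitDisk := hf.analytic_h.comp hφ.analytic hmaps
  have hG : DifferentiableOn ℂ (g ∘ φ) unitDisk := hf.analytic_g.comp hφ.analytic hmaps
  have hd : ∀ {u : ℂ → ℂ}, DifferentiableOn ℂ u unitDisk → ∀ z ∈ unitDisk,
      ‖deriv (u ∘ φ) z‖ = ‖deriv u (φ z)‖ * ‖deriv φ z‖ := by
    intro u hu z hz
    rw [((hu.differentiableAt (isOpen_unitDisk.mem_nhds (hmaps hz))).hasDerivAt.comp z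
      (hφ.analytic.differentiableAt (isOpen_unitDisk.mem_nhds hz)).hasDerivAt).deriv, norm_mul]
  refine ⟨m * k, B * C, by positivity, by positivity, fun z hz w hw => ⟨?_, ?_⟩⟩
  · refine mul_norm_sub_le_norm_harm_sub (h := h ∘ φ) (g := g ∘ φ) isOpen_unitDisk hH hG
      (by positivity) (fun y hy => ?_) ?_ ?_ hz hw
    · obtain ⟨hy1, hy2⟩ := hφ.mem hy
      rw [hd hf.analytic_h y hy, hd hf.analytic_g y hy, ← sub_mul]
      exact mul_le_mul (hQ _ hy1 hy2.le).2.1 (hkle y hy) hk.le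
        (sub_nonneg.2 (hf.lt _ hy1).le)
    · intro x hx y hy hxy
      exact hφ.injOn hx hy (hf.injOn (hmaps hx) (hmaps hy) hxy)
    · rw [hφ.harm_comp_image hsub]
      exact hF.convex_lt
  · refine norm_harm_sub_le (h := h ∘ φ) (g := g ∘ φ) isOpen_unitDisk (convex_ball _ _) hH hG
      (fun y hy => ?_) hz hw
    obtain ⟨hy1, hy2⟩ := hφ.mem hy
    rw [hd hf.analytic_h y hy, hd hf.analytic_g y hy, ← add_mul]
    exact mul_le_mul (hQ _ hy1 hy2.le).1 (hCle y hy) (norm_nonneg _) hB.le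

end boundary

/-! ### Turning of the normal and monotone heights -/

/-- A continuous unimodular function on the line has a continuous argument. -/
theorem exists_continuous_arg {N : ℝ → ℂ} (hN : Continuous N) (hN1 : ∀ t, ‖N t‖ = 1) :
    ∃ Ψ : ℝ → ℝ, Continuous Ψ ∧ ∀ t, N t = Complex.exp (Ψ t * Complex.I) := by
  have hsc : IsSimplyConnected (Set.univ : Set ℝ) := by
    have : ContractibleSpace (Set.univ : Set ℝ) := convex_univ.contractibleSpace Set.univ_nonempty
    exact SimplyConnectedSpace.ofContractible _
  obtain ⟨f, hf, hexp⟩ := Complex.exists_continuousOn_eqOn_exp_comp hsc isOpen_univ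
    (g := N) hN.continuousOn (by
      rintro ⟨t, -, ht⟩
      have := hN1 t
      rw [ht, norm_zero] at this
      exact zero_ne_one this)
  refine ⟨fun t => (f t).im, Complex.continuous_im.comp (continuousOn_univ.1 hf), fun t => ?_⟩
  have h1 : Complex.exp (f t) = N t := hexp (Set.mem_univ t)
  have h2 := hN1 t
  rw [← h1, Complex.norm_exp, Real.exp_eq_one_iff] at h2
  rw [← h1]
  congr 1
  apply Complex.ext <;> simp [h2]

/-- The strip of pairs s < t < s + L is convex, hence connected. The increment omits 0 and M on it,
so one value in (0, M) decides for all. -/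
theorem sub_mem_Ioo_of_ne {Ψ : ℝ → ℝ} (hΨ : Continuous Ψ) {L M : ℝ}
    (h0 : ∀ s t, s < t → t < s + L → Ψ t - Ψ s ≠ 0)
    (hM : ∀ s t, s < t → t < s + L → Ψ t - Ψ s ≠ M) {s₀ t₀ : ℝ} (hs₀ : s₀ < t₀) (ht₀ : t₀ < s₀ + L)
    (hmem : Ψ t₀ - Ψ s₀ ∈ Set.Ioo 0 M) (s t : ℝ) (hst : s < t) (hts : t < s + L) :
    Ψ t - Ψ s ∈ Set.Ioo 0 M := by
  set R : Set (ℝ × ℝ) := {p | p.1 < p.2 ∧ p.2 < p.1 + L} with hR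
  have hRc : IsPreconnected R := by
    refine Convex.isPreconnected ?_
    rintro ⟨a, b⟩ ⟨ha, hb⟩ ⟨a', b'⟩ ⟨ha', hb'⟩ x y hx hy hxy
    simp only [hR, Set.mem_ofPred_eq, Prod.fst_add, Prod.snd_add, Prod.smul_fst, Prod.smul_snd,
      smul_eq_mul] at *
    rcases hx.eq_or_lt with rfl | hx'
    · rw [zero_add] at hxy
      subst hxy
      constructor <;> linarith
    · constructor <;> nlinarith
  have hc : ContinuousOn (fun p : ℝ × ℝ => Ψ p.2 - Ψ p.1) R := by fun_prop
  have hm0 : ((s₀, t₀) : ℝ × ℝ) ∈ R := ⟨hs₀, ht₀⟩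
  have hm1 : ((s, t) : ℝ × ℝ) ∈ R := ⟨hst, hts⟩
  constructor
  · by_contra! hle
    obtain ⟨p, hp, hp0⟩ := hRc.intermediate_value hm1 hm0 hc ⟨hle, hmem.1.le⟩
    exact h0 p.1 p.2 hp.1 hp.2 hp0
  · by_contra! hle
    obtain ⟨p, hp, hp0⟩ := hRc.intermediate_value hm0 hm1 hc ⟨hmem.2.le, hle⟩
    exact hM p.1 p.2 hp.1 hp.2 hp0

/-- The increment over a period is an integer multiple of 2π, positive as a sum of two positive
increments, and at most 2π by continuity. -/
theorem apply_add_two_pi_of_sub_mem_Ioo {Ψ : ℝ → ℝ} (hΨ : Continuous Ψ)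
    (hmem : ∀ s t, s < t → t < s + 2 * Real.pi → Ψ t - Ψ s ∈ Set.Ioo 0 (2 * Real.pi))
    (hper : ∀ t, Complex.exp (Ψ (t + 2 * Real.pi) * Complex.I) = Complex.exp (Ψ t * Complex.I))
    (t : ℝ) : Ψ (t + 2 * Real.pi) = Ψ t + 2 * Real.pi := by
  have hpi := Real.pi_pos
  have h1 := (hmem t (t + Real.pi) (by linarith) (by linarith)).1
  have h2 := (hmem (t + Real.pi) (t + 2 * Real.pi) (by linarith) (by linarith)).1
  have h3 : Ψ (t + 2 * Real.pi) - Ψ t ≤ 2 * Real.pi := by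
    have hlim : Tendsto (fun x => Ψ x - Ψ t) (𝓝[<] (t + 2 * Real.pi))
        (𝓝 (Ψ (t + 2 * Real.pi) - Ψ t)) :=
      ((hΨ.tendsto _).mono_left nhdsWithin_le_nhds).sub_const _
    refine le_of_tendsto hlim ?_
    filter_upwards [Ioo_mem_nhdsLT (show t < t + 2 * Real.pi by linarith)] with x hx
    exact (hmem t x hx.1 hx.2).2.le
  obtain ⟨k, hk⟩ := Complex.exp_eq_exp_iff_exists_int.1 (hper t)
  have hk' : Ψ (t + 2 * Real.pi) = Ψ t + k * (2 * Real.pi) := by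
    have := congrArg Complex.im hk
    simpa using this
  have h4 : (0 : ℝ) < k := by
    by_contra! h
    nlinarith
  have h5 : (k : ℝ) < 2 := by
    by_contra! h
    nlinarith
  have h6 : k = 1 := by
    have : 0 < k := by exact_mod_cast h4
    have : k < 2 := by exact_mod_cast h5
    omega
  rw [hk', h6]
  simp

/-- A closed curve with monotone outward normal turning once has two points with opposite normals,
and the corresponding coordinate is monotone on the two arcs between them. -/
theorem exists_monotoneOn_antitoneOn {γ : ℝ → ℂ} {Ψ : ℝ → ℝ} (hΨ : Continuous Ψ)
    (hmem : ∀ s t, s < t → t < s + 2 * Real.pi → Ψ t - Ψ s ∈ Set.Ioo 0 (2 * Real.pi))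
    (hper : ∀ t, Ψ (t + 2 * Real.pi) = Ψ t + 2 * Real.pi)
    (hsupp : ∀ s t, ((starRingEnd ℂ) (Complex.exp (Ψ t * Complex.I)) * (γ s - γ t)).re ≤ 0) :
    ∃ (τ : ℝ) (e : ℂ), ‖e‖ = 1 ∧
      AntitoneOn (fun t => ((starRingEnd ℂ) e * γ t).re) (Set.Icc τ (τ + Real.pi)) ∧
      MonotoneOn (fun t => ((starRingEnd ℂ) e * γ t).re) (Set.Icc (τ - Real.pi) τ) := by
  have hpi := Real.pi_pos
  have hmono : StrictMono Ψ := by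
    have hloc : ∀ s t, s < t → t < s + 2 * Real.pi → Ψ s < Ψ t := fun s t h1 h2 =>
      sub_pos.1 (hmem s t h1 h2).1
    have hn : ∀ (k : ℕ) (s t : ℝ), s < t → t < s + (k + 1) * Real.pi → Ψ s < Ψ t := by
      intro k
      induction k with
      | zero => intro s t h1 h2; exact hloc s t h1 (by push_cast at h2; linarith)
      | succ k ih =>
        intro s t h1 h2
        rcases lt_or_ge t (s + 2 * Real.pi) with h | h
        · exact hloc s t h1 h
        · refine (hloc s (s + Real.pi) (by linarith) (by linarith)).trans
            (ih _ _ (by linarith) ?_)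
          push_cast at h2 ⊢
          linarith
    intro s t hst
    obtain ⟨k, hk⟩ := exists_nat_gt ((t - s) / Real.pi)
    refine hn k s t hst ?_
    rw [div_lt_iff₀ hpi] at hk
    nlinarith
  -- The half-period increments starting at 0 and at π add up to 2π, so they lie on opposite sides
  -- of π.
  obtain ⟨t₀, ht₀⟩ : ∃ t₀, Ψ (t₀ + Real.pi) - Ψ t₀ = Real.pi := by
    have hg : Continuous fun t => Ψ (t + Real.pi) - Ψ t := by fun_prop
    have hsum : (Ψ (0 + Real.pi) - Ψ 0) + (Ψ (Real.pi + Real.pi) - Ψ Real.pi) = 2 * Real.pi := by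
      have := hper 0
      rw [zero_add] at this ⊢
      rw [← two_mul, this]
      ring
    rcases le_total (Ψ (0 + Real.pi) - Ψ 0) Real.pi with h | h
    · exact mem_range_of_exists_le_of_exists_ge hg ⟨0, h⟩ ⟨Real.pi, by linarith⟩
    · exact mem_range_of_exists_le_of_exists_ge hg ⟨Real.pi, by linarith⟩ ⟨0, h⟩
  set τ := t₀ + Real.pi with hτ
  set E := Ψ τ with hE
  have hE1 : Ψ (τ + Real.pi) = E + Real.pi := by
    have := hper t₀
    rw [show t₀ + 2 * Real.pi = τ + Real.pi by rw [hτ]; ring] at this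
    linarith
  have hE0 : Ψ (τ - Real.pi) = E - Real.pi := by
    rw [hτ, add_sub_cancel_right]
    linarith
  have hexp : ∀ (x : ℝ) (d : ℂ), ((starRingEnd ℂ) (Complex.exp (x * Complex.I)) * d).re
      = Real.cos x * d.re + Real.sin x * d.im := by
    intro x d
    rw [Complex.mul_re, Complex.conj_re, Complex.conj_im, Complex.exp_ofReal_mul_I_re,
      Complex.exp_ofReal_mul_I_im]
    ring
  -- The direction E is resolved along the directions p and q. For p = Ψ s and q = Ψ t, the support
  -- inequalities at both ends fix the sign of each term.
  have hid : ∀ (p q : ℝ) (d : ℂ), Real.sin (q - p) *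
      ((starRingEnd ℂ) (Complex.exp (E * Complex.I)) * d).re
      = Real.sin (E - p) * ((starRingEnd ℂ) (Complex.exp (q * Complex.I)) * d).re
        - Real.sin (E - q) * ((starRingEnd ℂ) (Complex.exp (p * Complex.I)) * d).re := by
    intro p q d
    simp only [hexp, Real.sin_sub]
    ring
  have hs1 : ∀ s t, ((starRingEnd ℂ) (Complex.exp (Ψ s * Complex.I)) * (γ t - γ s)).re ≤ 0 :=
    fun s t => hsupp t s
  have hs2 : ∀ s t, 0 ≤ ((starRingEnd ℂ) (Complex.exp (Ψ t * Complex.I)) * (γ t - γ s)).re := by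
    intro s t
    have := hsupp s t
    rw [← neg_sub, mul_neg, Complex.neg_re] at this
    linarith
  have hsub : ∀ s t, ((starRingEnd ℂ) (Complex.exp (E * Complex.I)) * (γ t - γ s)).re
      = ((starRingEnd ℂ) (Complex.exp (E * Complex.I)) * γ t).re
        - ((starRingEnd ℂ) (Complex.exp (E * Complex.I)) * γ s).re := by
    intro s t
    rw [mul_sub, Complex.sub_re]
  refine ⟨τ, Complex.exp (E * Complex.I), Complex.norm_exp_ofReal_mul_I E, ?_, ?_⟩
  · intro s hs t ht hst
    rcases hst.eq_or_lt with rfl | hst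
    · exact le_rfl
    refine sub_nonpos.1 (le_trans (le_of_eq (hsub s t).symm) ?_)
    have hp1 : E ≤ Ψ s := hmono.monotone hs.1
    have hpq : Ψ s < Ψ t := hmono hst
    have hq1 : Ψ t ≤ E + Real.pi := hE1 ▸ hmono.monotone ht.2
    -- If sin(Ψ t - Ψ s) = 0, the normal has made the full half turn, so E = Ψ s and the support
    -- inequality at s is already the claim.
    rcases (show Ψ t - Ψ s ≤ Real.pi by linarith).eq_or_lt with h | h
    · have : E = Ψ s := by linarith
      rw [this]
      exact hs1 s t
    · have hsin := Real.sin_pos_of_pos_of_lt_pi (sub_pos.2 hpq) h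
      have h1 : Real.sin (E - Ψ s) ≤ 0 :=
        Real.sin_nonpos_of_nonpos_of_neg_pi_le (by linarith) (by linarith)
      have h2 : Real.sin (E - Ψ t) ≤ 0 :=
        Real.sin_nonpos_of_nonpos_of_neg_pi_le (by linarith) (by linarith)
      have h3 := hid (Ψ s) (Ψ t) (γ t - γ s)
      by_contra! hcon
      nlinarith [mul_pos hsin hcon, mul_nonneg (neg_nonneg.2 h1) (hs2 s t),
        mul_nonneg (neg_nonneg.2 h2) (neg_nonneg.2 (hs1 s t))]
  · intro s hs t ht hst
    rcases hst.eq_or_lt with rfl | hst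
    · exact le_rfl
    refine sub_nonneg.1 (le_trans ?_ (le_of_eq (hsub s t)))
    have hp1 : E - Real.pi ≤ Ψ s := hE0 ▸ hmono.monotone hs.1
    have hpq : Ψ s < Ψ t := hmono hst
    have hq1 : Ψ t ≤ E := hmono.monotone ht.2
    rcases (show Ψ t - Ψ s ≤ Real.pi by linarith).eq_or_lt with h | h
    · have : E = Ψ t := by linarith
      rw [this]
      exact hs2 s t
    · have hsin := Real.sin_pos_of_pos_of_lt_pi (sub_pos.2 hpq) h
      have h1 : 0 ≤ Real.sin (E - Ψ s) := Real.sin_nonneg_of_nonneg_of_le_pi (by linarith)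
        (by linarith)
      have h2 : 0 ≤ Real.sin (E - Ψ t) := Real.sin_nonneg_of_nonneg_of_le_pi (by linarith)
        (by linarith)
      have h3 := hid (Ψ s) (Ψ t) (γ t - γ s)
      by_contra! hcon
      nlinarith [mul_neg_of_pos_of_neg hsin hcon, mul_nonneg h1 (hs2 s t),
        mul_nonneg h2 (neg_nonneg.2 (hs1 s t))]

theorem exp_arccos_mul_I_of_im_nonneg {w : ℂ} (hw : ‖w‖ = 1) (him : 0 ≤ w.im) :
    Complex.exp (Real.arccos w.re * Complex.I) = w := by
  have h1 : w.re ^ 2 + w.im ^ 2 = 1 := by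
    have := Complex.sq_norm w
    rw [hw, Complex.normSq_apply] at this
    linarith
  have h2 := abs_le.1 (abs_le_one_iff_mul_self_le_one.2 (by nlinarith) : |w.re| ≤ 1)
  apply Complex.ext
  · rw [Complex.exp_ofReal_mul_I_re, Real.cos_arccos h2.1 h2.2]
  · rw [Complex.exp_ofReal_mul_I_im, Real.sin_arccos, show 1 - w.re ^ 2 = w.im ^ 2 by linarith,
      Real.sqrt_sq him]

theorem exp_neg_arccos_mul_I_of_im_nonpos {w : ℂ} (hw : ‖w‖ = 1) (him : w.im ≤ 0) :
    Complex.exp (-Real.arccos w.re * Complex.I) = w := by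
  have := exp_arccos_mul_I_of_im_nonneg (w := (starRingEnd ℂ) w) (by rwa [RCLike.norm_conj])
    (by rw [Complex.conj_im]; linarith)
  rw [Complex.conj_re] at this
  have h2 := congrArg (starRingEnd ℂ) this
  rw [Complex.conj_conj, ← Complex.exp_conj, map_mul, Complex.conj_I, Complex.conj_ofReal] at h2
  rw [neg_mul, ← mul_neg]
  exact h2

/-- On the circle, in suitable coordinates, the height of a strictly convex curve is monotone on the
two half circles. -/
theorem exists_unit_height_le {γ N : ℂ → ℂ} (hN : ContinuousOn N (Metric.sphere 0 1))
    (hN1 : ∀ z, ‖z‖ = 1 → ‖N z‖ = 1) (hinj : Set.InjOn N (Metric.sphere 0 1))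
    (hsupp : ∀ z w, ‖z‖ = 1 → ‖w‖ = 1 → ((starRingEnd ℂ) (N z) * (γ w - γ z)).re ≤ 0) :
    ∃ b e : ℂ, ‖b‖ = 1 ∧ ‖e‖ = 1 ∧ ∀ w w' : ℂ, ‖w‖ = 1 → ‖w'‖ = 1 → w.re ≤ w'.re →
      (0 ≤ w.im ∧ 0 ≤ w'.im ∨ w.im ≤ 0 ∧ w'.im ≤ 0) →
      ((starRingEnd ℂ) e * γ (b * w)).re ≤ ((starRingEnd ℂ) e * γ (b * w')).re := by
  have hpi := Real.pi_pos
  set P : ℝ → ℂ := fun t => Complex.exp (t * Complex.I) with hP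
  have hP1 : ∀ t, ‖P t‖ = 1 := Complex.norm_exp_ofReal_mul_I
  have hPc : Continuous P := by fun_prop
  have hPper : ∀ t, P (t + 2 * Real.pi) = P t := fun t => by
    simp only [hP]
    rw [Complex.exp_eq_exp_iff_exists_int]
    exact ⟨1, by push_cast; ring⟩
  have hPne : ∀ s t, s < t → t < s + 2 * Real.pi → P t ≠ P s := by
    intro s t hst hts h
    obtain ⟨k, hk⟩ := Complex.exp_eq_exp_iff_exists_int.1 h
    have hk' : t = s + k * (2 * Real.pi) := by simpa using congrArg Complex.im hk
    have h1 : (0 : ℝ) < k := by by_contra! h; nlinarith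
    have h2 : (k : ℝ) < 1 := by by_contra! h; nlinarith
    have h3 : 0 < k := by exact_mod_cast h1
    have h4 : k < 1 := by exact_mod_cast h2
    omega
  have hadd : ∀ x y : ℝ, P x * Complex.exp (y * Complex.I) = P (x + y) := fun x y => by
    simp only [hP]
    rw [← Complex.exp_add]
    push_cast
    ring_nf
  have hadd' : ∀ x y : ℝ, P x * Complex.exp (-y * Complex.I) = P (x - y) := fun x y => by
    simp only [hP]
    rw [← Complex.exp_add]
    push_cast
    ring_nf
  obtain ⟨Ψ, hΨ, hNΨ⟩ := exists_continuous_arg (N := fun t => N (P t))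
    (hN.comp_continuous hPc fun t => mem_sphere_zero_iff_norm.2 (hP1 t)) fun t => hN1 _ (hP1 t)
  have hne : ∀ s t, s < t → t < s + 2 * Real.pi → ∀ k : ℤ, Ψ t - Ψ s ≠ k * (2 * Real.pi) := by
    intro s t hst hts k hk
    refine hPne s t hst hts (hinj (mem_sphere_zero_iff_norm.2 (hP1 t))
      (mem_sphere_zero_iff_norm.2 (hP1 s)) ?_)
    rw [hNΨ, hNΨ, Complex.exp_eq_exp_iff_exists_int]
    refine ⟨k, ?_⟩
    rw [show Ψ t = Ψ s + k * (2 * Real.pi) by linarith]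
    push_cast
    ring
  have hne0 : ∀ s t, s < t → t < s + 2 * Real.pi → Ψ t - Ψ s ≠ 0 := fun s t h1 h2 => by
    simpa using hne s t h1 h2 0
  have hne1 : ∀ s t, s < t → t < s + 2 * Real.pi → Ψ t - Ψ s ≠ 2 * Real.pi := fun s t h1 h2 => by
    simpa using hne s t h1 h2 1
  have hne2 : ∀ s t, s < t → t < s + 2 * Real.pi → Ψ t - Ψ s ≠ -(2 * Real.pi) :=
    fun s t h1 h2 => by simpa using hne s t h1 h2 (-1)
  -- By continuity at 0 some increment is smaller than a full turn. Its sign is the orientation of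
  -- the normal.
  obtain ⟨t₀, ht₀, ht₀', hsmall⟩ : ∃ t₀, 0 < t₀ ∧ t₀ < 0 + 2 * Real.pi ∧
      |Ψ t₀ - Ψ 0| < 2 * Real.pi := by
    have h1 : ∀ᶠ t in 𝓝[>] (0 : ℝ), |Ψ t - Ψ 0| < 2 * Real.pi := by
      have : Tendsto (fun t => |Ψ t - Ψ 0|) (𝓝[>] (0 : ℝ)) (𝓝 |Ψ 0 - Ψ 0|) :=
        (((hΨ.tendsto 0).sub_const _).abs).mono_left nhdsWithin_le_nhds
      rw [sub_self, abs_zero] at this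
      exact this.eventually_lt_const (by positivity)
    obtain ⟨t, ht, ht'⟩ := (h1.and (Ioo_mem_nhdsGT (show (0 : ℝ) < 2 * Real.pi by positivity))).exists
    exact ⟨t, ht'.1, by linarith [ht'.2], ht⟩
  have hmono_arc : ∀ {w w' : ℂ}, w.re ≤ w'.re →
      Real.arccos w'.re ≤ Real.arccos w.re ∧ 0 ≤ Real.arccos w'.re ∧
        Real.arccos w.re ≤ Real.pi := fun h =>
    ⟨Real.arccos_le_arccos h, Real.arccos_nonneg _, Real.arccos_le_pi _⟩
  rcases lt_or_gt_of_ne (hne0 0 t₀ ht₀ ht₀') with hneg | hpos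
  -- The normal turns clockwise here, so the circle is traversed backwards and the two half circles
  -- exchange roles.
  · have hmem : ∀ s t, s < t → t < s + 2 * Real.pi →
        Ψ (-t) - Ψ (-s) ∈ Set.Ioo 0 (2 * Real.pi) := by
      intro s t hst hts
      have := sub_mem_Ioo_of_ne (Ψ := fun t => -Ψ t) hΨ.neg (L := 2 * Real.pi) (M := 2 * Real.pi)
        (fun s t h1 h2 h => hne0 s t h1 h2 (by linarith))
        (fun s t h1 h2 h => hne2 s t h1 h2 (by linarith)) ht₀ ht₀'
        ⟨by linarith, by linarith [abs_lt.1 hsmall]⟩ (-t) (-s) (by linarith) (by linarith)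
      constructor <;> linarith [this.1, this.2]
    have hper := apply_add_two_pi_of_sub_mem_Ioo (Ψ := fun t => Ψ (-t)) (by fun_prop) hmem
      (fun t => by
        rw [← hNΨ, ← hNΨ, ← hPper (-(t + 2 * Real.pi))]
        congr 2
        ring)
    obtain ⟨τ, e, he, hanti, hmon⟩ := exists_monotoneOn_antitoneOn (γ := fun t => γ (P (-t)))
      (Ψ := fun t => Ψ (-t)) (by fun_prop) hmem hper fun s t => by
        rw [← hNΨ]
        exact hsupp _ _ (hP1 _) (hP1 _)
    refine ⟨P (-τ), e, hP1 _, he, fun w w' hw hw' hre hor => ?_⟩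
    obtain ⟨h1, h2, h3⟩ := hmono_arc hre
    rcases hor with ⟨hi, hi'⟩ | ⟨hi, hi'⟩
    · have := hmon (a := τ - Real.arccos w.re) (b := τ - Real.arccos w'.re)
        ⟨by linarith, by linarith⟩ ⟨by linarith, by linarith⟩ (by linarith)
      rw [← exp_arccos_mul_I_of_im_nonneg hw hi, ← exp_arccos_mul_I_of_im_nonneg hw' hi',
        hadd, hadd]
      simpa [neg_add_eq_sub] using this
    · have := hanti (a := τ + Real.arccos w'.re) (b := τ + Real.arccos w.re)
        ⟨by linarith, by linarith⟩ ⟨by linarith, by linarith⟩ (by linarith)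
      rw [← exp_neg_arccos_mul_I_of_im_nonpos hw hi, ← exp_neg_arccos_mul_I_of_im_nonpos hw' hi',
        hadd', hadd']
      simpa only [neg_add'] using this
  · have hmem := sub_mem_Ioo_of_ne hΨ hne0 hne1 ht₀ ht₀'
      ⟨hpos, (le_abs_self _).trans_lt hsmall⟩
    have hper := apply_add_two_pi_of_sub_mem_Ioo hΨ hmem
      (fun t => by rw [← hNΨ, ← hNΨ, hPper])
    obtain ⟨τ, e, he, hanti, hmon⟩ := exists_monotoneOn_antitoneOn (γ := fun t => γ (P t))
      (Ψ := Ψ) hΨ hmem hper fun s t => by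
        rw [← hNΨ]
        exact hsupp _ _ (hP1 _) (hP1 _)
    refine ⟨P τ, e, hP1 _, he, fun w w' hw hw' hre hor => ?_⟩
    obtain ⟨h1, h2, h3⟩ := hmono_arc hre
    rcases hor with ⟨hi, hi'⟩ | ⟨hi, hi'⟩
    · have := hanti (a := τ + Real.arccos w'.re) (b := τ + Real.arccos w.re)
        ⟨by linarith, by linarith⟩ ⟨by linarith, by linarith⟩ (by linarith)
      rw [← exp_arccos_mul_I_of_im_nonneg hw hi, ← exp_arccos_mul_I_of_im_nonneg hw' hi',
        hadd, hadd]
      exact this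
    · have := hmon (a := τ - Real.arccos w.re) (b := τ - Real.arccos w'.re)
        ⟨by linarith, by linarith⟩ ⟨by linarith, by linarith⟩ (by linarith)
      rw [← exp_neg_arccos_mul_I_of_im_nonpos hw hi, ← exp_neg_arccos_mul_I_of_im_nonpos hw' hi',
        hadd', hadd']
      exact this

/-! ### The hyperbolic flow on the disk -/

section flow

theorem one_add_ofReal_mul_ne_zero {s : ℝ} (hs : |s| < 1) {w : ℂ} (hw : ‖w‖ ≤ 1) :
    1 + (s : ℂ) * w ≠ 0 := by
  intro h
  have h1 : ‖(s : ℂ) * w‖ = 1 := by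
    rw [eq_neg_of_add_eq_zero_right h, norm_neg, norm_one]
  rw [norm_mul, Complex.norm_real, Real.norm_eq_abs] at h1
  nlinarith [abs_nonneg s, norm_nonneg w]

theorem normSq_one_add_sub_normSq_add (s : ℝ) (w : ℂ) :
    ‖1 + (s : ℂ) * w‖ ^ 2 - ‖w + s‖ ^ 2 = (1 - s ^ 2) * (1 - ‖w‖ ^ 2) := by
  simp only [Complex.sq_norm, Complex.normSq_apply, Complex.add_re, Complex.add_im, Complex.one_re,
    Complex.one_im, Complex.re_ofReal_mul, Complex.im_ofReal_mul, Complex.ofReal_re,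
    Complex.ofReal_im]
  ring

theorem norm_add_div_lt_one {s : ℝ} (hs : |s| < 1) {w : ℂ} (hw : ‖w‖ < 1) :
    ‖(w + s) / (1 + s * w)‖ < 1 := by
  have hne := norm_pos_iff.2 (one_add_ofReal_mul_ne_zero hs hw.le)
  rw [norm_div, div_lt_one hne]
  refine lt_of_pow_lt_pow_left₀ 2 hne.le ?_
  have h1 := normSq_one_add_sub_normSq_add s w
  have h2 : 0 < 1 - s ^ 2 := by nlinarith [sq_abs s, abs_nonneg s]
  have h3 : 0 < 1 - ‖w‖ ^ 2 := by nlinarith [norm_nonneg w]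
  nlinarith [mul_pos h2 h3]

theorem norm_add_div_eq_one {s : ℝ} (hs : |s| < 1) {w : ℂ} (hw : ‖w‖ = 1) :
    ‖(w + s) / (1 + s * w)‖ = 1 := by
  have hne := norm_pos_iff.2 (one_add_ofReal_mul_ne_zero hs hw.le)
  rw [norm_div, div_eq_one_iff_eq hne.ne']
  have h1 := normSq_one_add_sub_normSq_add s w
  rw [hw] at h1
  exact (pow_left_inj₀ (norm_nonneg _) hne.le two_ne_zero).1 (by linarith)

theorem re_im_add_div {s : ℝ} {w : ℂ} (hw : ‖w‖ = 1) :
    ((w + s) / (1 + s * w)).re = (w.re + 2 * s + s ^ 2 * w.re) / Complex.normSq (1 + s * w) ∧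
    ((w + s) / (1 + s * w)).im = w.im * (1 - s ^ 2) / Complex.normSq (1 + s * w) := by
  have h1 : w.re ^ 2 + w.im ^ 2 = 1 := by
    have := Complex.sq_norm w
    rw [hw, Complex.normSq_apply] at this
    linarith
  rw [Complex.div_re, Complex.div_im, ← add_div, ← sub_div]
  simp only [Complex.add_re, Complex.add_im, Complex.one_re, Complex.one_im, Complex.re_ofReal_mul,
    Complex.im_ofReal_mul, Complex.ofReal_re, Complex.ofReal_im]
  constructor
  · congr 1
    linear_combination s * h1
  · congr 1
    ring

/-- A harmonic function whose boundary values increase along the hyperbolic flow increases along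
the flow inside the disk. -/
theorem re_deriv_mul_nonneg_of_height_le {Φ : ℂ → ℂ} {u : ℂ → ℝ} {b : ℂ}
    (hΦ : DifferentiableOn ℂ Φ unitDisk) (hu : Continuous u)
    (huΦ : ∀ z ∈ unitDisk, u z = (Φ z).re) (hb : ‖b‖ = 1)
    (hle : ∀ w w' : ℂ, ‖w‖ = 1 → ‖w'‖ = 1 → w.re ≤ w'.re →
      (0 ≤ w.im ∧ 0 ≤ w'.im ∨ w.im ≤ 0 ∧ w'.im ≤ 0) → u (b * w) ≤ u (b * w'))
    {z : ℂ} (hz : z ∈ unitDisk) :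
    0 ≤ (deriv Φ z * (b - (starRingEnd ℂ) b * z ^ 2)).re := by
  have hbb : b * (starRingEnd ℂ) b = 1 := by rw [Complex.mul_conj', hb]; simp
  -- For |s| < 1 this is the disk automorphism fixing b and -b. For s > 0 it moves points of the
  -- circle towards b within their half circle.
  set S : ℝ → ℂ → ℂ := fun s w =>
    b * (((starRingEnd ℂ) b * w + s) / (1 + s * ((starRingEnd ℂ) b * w))) with hS
  have hnb : ∀ w : ℂ, ‖(starRingEnd ℂ) b * w‖ = ‖w‖ := fun w => by
    rw [norm_mul, RCLike.norm_conj, hb, one_mul]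
  have hSD : ∀ s : ℝ, |s| < 1 → ∀ w ∈ unitDisk, S s w ∈ unitDisk := fun s hs w hw => by
    rw [mem_unitDisk] at hw ⊢
    simp only [hS]
    rw [norm_mul, hb, one_mul]
    exact norm_add_div_lt_one hs (by rwa [hnb])
  have hScont : ∀ s : ℝ, |s| < 1 → ContinuousOn (S s) (Metric.closedBall 0 1) := fun s hs => by
    refine continuousOn_const.mul (ContinuousOn.div (by fun_prop) (by fun_prop) fun w hw => ?_)
    exact one_add_ofReal_mul_ne_zero hs (by rw [hnb]; exact mem_closedBall_zero_iff.1 hw)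
  have hSdiff : ∀ s : ℝ, |s| < 1 → DifferentiableOn ℂ (S s) unitDisk := fun s hs => by
    refine (DifferentiableOn.div (by fun_prop) (by fun_prop) fun w hw => ?_).const_mul b
    exact one_add_ofReal_mul_ne_zero hs (by rw [hnb]; exact (mem_unitDisk.1 hw).le)
  have hcirc : ∀ s : ℝ, 0 < s → s < 1 → ∀ w : ℂ, ‖w‖ = 1 → u w ≤ u (S s w) := by
    intro s hs0 hs1 w hw
    have hs : |s| < 1 := by rwa [abs_of_pos hs0]
    set v := (starRingEnd ℂ) b * w with hv
    have hv1 : ‖v‖ = 1 := by rw [hv, hnb, hw]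
    have hwv : w = b * v := by rw [hv, ← mul_assoc, hbb, one_mul]
    obtain ⟨hre, him⟩ := re_im_add_div (s := s) hv1
    have hpos : 0 < Complex.normSq (1 + s * v) :=
      Complex.normSq_pos.2 (one_add_ofReal_mul_ne_zero hs hv1.le)
    have h1 : v.re ^ 2 + v.im ^ 2 = 1 := by
      have := Complex.sq_norm v
      rw [hv1, Complex.normSq_apply] at this
      linarith
    have hS' : S s w = b * ((v + s) / (1 + s * v)) := rfl
    rw [hS']
    conv_lhs => rw [hwv]
    refine hle v _ hv1 (norm_add_div_eq_one hs hv1) ?_ ?_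
    · rw [hre, le_div_iff₀ hpos, Complex.normSq_apply]
      simp only [Complex.add_re, Complex.add_im, Complex.one_re, Complex.one_im,
        Complex.re_ofReal_mul, Complex.im_ofReal_mul]
      have e : v.re + 2 * s + s ^ 2 * v.re - v.re * ((1 + s * v.re) * (1 + s * v.re)
          + (0 + s * v.im) * (0 + s * v.im)) = 2 * s * (1 - v.re ^ 2) := by
        linear_combination (-(v.re * s ^ 2)) * h1
      nlinarith [mul_nonneg hs0.le (sq_nonneg v.im)]
    · rw [him]
      have h2 : 0 ≤ 1 - s ^ 2 := by nlinarith
      rcases le_total 0 v.im with h | h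
      · exact Or.inl ⟨h, div_nonneg (mul_nonneg h h2) hpos.le⟩
      · exact Or.inr ⟨h, div_nonpos_of_nonpos_of_nonneg
          (mul_nonpos_of_nonpos_of_nonneg h h2) hpos.le⟩
  have hdisk : ∀ s : ℝ, 0 < s → s < 1 → ∀ w ∈ unitDisk, (Φ w).re ≤ (Φ (S s w)).re := by
    intro s hs0 hs1 w hw
    have hs : |s| < 1 := by rwa [abs_of_pos hs0]
    refine le_of_forall_pos_le_add fun ε hε => ?_
    -- The increment is nonnegative on the unit circle, so the set where it is at most -ε is compact
    -- in the open disk. On a larger circle it exceeds -ε, and the maximum principle for the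
    -- exponential of minus the analytic increment carries this bound to w.
    have hvc : ContinuousOn (fun y => u (S s y) - u y) (Metric.closedBall 0 1) :=
      (hu.comp_continuousOn (hScont s hs)).sub hu.continuousOn
    have hK : IsCompact (Metric.closedBall (0 : ℂ) 1 ∩
        (fun y => u (S s y) - u y) ⁻¹' Set.Iic (-ε)) :=
      (isCompact_closedBall 0 1).of_isClosed_subset
        (hvc.preimage_isClosed_of_isClosed Metric.isClosed_closedBall isClosed_Iic)
        Set.inter_subset_left
    set K := insert w (Metric.closedBall (0 : ℂ) 1 ∩ (fun y => u (S s y) - u y) ⁻¹' Set.Iic (-ε))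
    have hKc : IsCompact K := hK.insert w
    obtain ⟨y, hy, hmax⟩ := hKc.exists_isMaxOn ⟨w, Set.mem_insert _ _⟩ continuous_norm.continuousOn
    have hy1 : ‖y‖ < 1 := by
      rcases hy with rfl | ⟨hy, hyε⟩
      · exact mem_unitDisk.1 hw
      · refine lt_of_le_of_ne (mem_closedBall_zero_iff.1 hy) fun h => ?_
        have h1 := hcirc s hs0 hs1 y h
        have h2 : u (S s y) - u y ≤ -ε := hyε
        linarith
    set r := (1 + ‖y‖) / 2 with hr
    have hr1 : r < 1 := by rw [hr]; linarith
    have hyr : ‖y‖ < r := by rw [hr]; linarith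
    have hr0 : 0 < r := lt_of_le_of_lt (norm_nonneg y) hyr
    have hsub : Metric.closedBall (0 : ℂ) r ⊆ unitDisk := fun x hx => by
      rw [mem_unitDisk]; exact (mem_closedBall_zero_iff.1 hx).trans_lt hr1
    set E : ℂ → ℂ := fun x => Complex.exp (-(Φ (S s x) - Φ x)) with hE
    have hEd : DifferentiableOn ℂ E unitDisk :=
      (((hΦ.comp (hSdiff s hs) (hSD s hs)).sub hΦ).neg).cexp
    have hEn : ∀ x ∈ unitDisk, ‖E x‖ = Real.exp (-(u (S s x) - u x)) := by
      intro x hx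
      rw [hE, Complex.norm_exp, huΦ x hx, huΦ _ (hSD s hs x hx)]
      simp
    have hEle : ‖E w‖ ≤ Real.exp ε := by
      refine Complex.norm_le_of_forall_mem_frontier_norm_le (U := Metric.ball 0 r)
        Metric.isBounded_ball ?_ ?_ ?_
      · refine DifferentiableOn.diffContOnCl ?_
        rw [closure_ball 0 hr0.ne']
        exact hEd.mono hsub
      · intro x hx
        rw [frontier_ball 0 hr0.ne'] at hx
        have hxD := hsub (Metric.sphere_subset_closedBall hx)
        rw [hEn x hxD]
        refine Real.exp_le_exp.2 ?_
        by_contra! hcon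
        have hxK : x ∈ K := Or.inr ⟨mem_closedBall_zero_iff.2 (mem_unitDisk.1 hxD).le, by
          change u (S s x) - u x ≤ -ε
          linarith⟩
        have := hmax hxK
        have hxr : ‖x‖ = r := mem_sphere_zero_iff_norm.1 hx
        have h3 : ‖x‖ ≤ ‖y‖ := this
        linarith
      · refine subset_closure ?_
        rw [mem_ball_zero_iff]
        have h3 : ‖w‖ ≤ ‖y‖ := hmax (Set.mem_insert _ _)
        linarith
    rw [hEn w hw, Real.exp_le_exp, huΦ w hw, huΦ _ (hSD s hs w hw)] at hEle
    linarith
  have hS0 : S 0 z = z := by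
    simp only [hS, Complex.ofReal_zero, add_zero, zero_mul, div_one]
    rw [← mul_assoc, hbb, one_mul]
  set v := (starRingEnd ℂ) b * z with hv
  -- The velocity of the flow at time 0 is b(1 - v²) with v = conj(b) z, that is b - conj(b) z².
  have hder : HasDerivAt (fun σ : ℂ => b * ((v + σ) / (1 + σ * v)))
      (b - (starRingEnd ℂ) b * z ^ 2) ((0 : ℝ) : ℂ) := by
    rw [Complex.ofReal_zero]
    have h1 : HasDerivAt (fun σ : ℂ => v + σ) 1 0 := (hasDerivAt_id (0 : ℂ)).const_add v
    have h2 : HasDerivAt (fun σ : ℂ => 1 + σ * v) (1 * v) 0 :=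
      ((hasDerivAt_id (0 : ℂ)).mul_const v).const_add 1
    refine ((h1.div h2 (by simp)).const_mul b).congr_deriv ?_
    simp only [zero_mul, add_zero, one_mul, mul_one, one_pow, div_one]
    rw [hv]
    linear_combination (-(starRingEnd ℂ) b * z ^ 2) * hbb
  have hder2 : HasDerivAt (fun s : ℝ => (Φ (S s z)).re)
      (deriv Φ z * (b - (starRingEnd ℂ) b * z ^ 2)).re 0 := by
    have h1 : HasDerivAt Φ (deriv Φ z) (b * ((v + ((0 : ℝ) : ℂ)) / (1 + ((0 : ℝ) : ℂ) * v))) := by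
      have : b * ((v + ((0 : ℝ) : ℂ)) / (1 + ((0 : ℝ) : ℂ) * v)) = z := hS0
      rw [this]
      exact (hΦ.differentiableAt (isOpen_unitDisk.mem_nhds hz)).hasDerivAt
    exact (HasDerivAt.comp (h := fun σ : ℂ => b * ((v + σ) / (1 + σ * v)))
      ((0 : ℝ) : ℂ) h1 hder).real_of_complex
  have hlim := (hasDerivAt_iff_tendsto_slope.1 hder2).mono_left
    (nhdsWithin_mono 0 fun x (hx : 0 < x) => hx.ne' : 𝓝[>] (0 : ℝ) ≤ 𝓝[≠] 0)
  refine ge_of_tendsto hlim ?_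
  filter_upwards [Ioo_mem_nhdsGT (zero_lt_one (α := ℝ))] with s hs
  rw [slope_def_field, hS0]
  exact div_nonneg (sub_nonneg.2 (hdisk s hs.1 hs.2 z hz)) (by linarith [hs.1])

end flow

/-! ### Boundary extension and the inequality for level maps -/

theorem closure_unitDisk : closure unitDisk = Metric.closedBall 0 1 :=
  closure_ball 0 one_ne_zero

/-- A bi-Lipschitz map of the disk extends to the closed disk. -/
theorem exists_continuous_extension {f : ℂ → ℂ} {m C : ℝ} (hC : 0 < C)
    (hbi : ∀ z ∈ unitDisk, ∀ w ∈ unitDisk, m * ‖z - w‖ ≤ ‖f z - f w‖ ∧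
      ‖f z - f w‖ ≤ C * ‖z - w‖) :
    ∃ γ : ℂ → ℂ, Continuous γ ∧ Set.EqOn f γ unitDisk ∧
      ∀ z ∈ Metric.closedBall (0 : ℂ) 1, ∀ w ∈ Metric.closedBall (0 : ℂ) 1,
        m * ‖z - w‖ ≤ ‖γ z - γ w‖ := by
  have hlip : LipschitzOnWith ⟨C, hC.le⟩ f unitDisk :=
    LipschitzOnWith.of_dist_le_mul fun z hz w hw => by
      rw [dist_eq_norm, dist_eq_norm]
      exact (hbi z hz w hw).2
  obtain ⟨γ, hγ, heq⟩ := hlip.extend_finite_dimension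
  have hc := hγ.continuous
  refine ⟨γ, hc, heq, fun z hz w hw => ?_⟩
  have hcl : IsClosed {p : ℂ × ℂ | m * ‖p.1 - p.2‖ ≤ ‖γ p.1 - γ p.2‖} :=
    isClosed_le (by fun_prop) (by fun_prop)
  have hsub : closure (unitDisk ×ˢ unitDisk) ⊆
      {p : ℂ × ℂ | m * ‖p.1 - p.2‖ ≤ ‖γ p.1 - γ p.2‖} := by
    refine closure_minimal ?_ hcl
    rintro ⟨a, b⟩ ⟨ha, hb⟩
    have := (hbi a ha b hb).1
    rw [heq ha, heq hb] at this
    exact this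
  rw [closure_prod_eq, closure_unitDisk] at hsub
  exact hsub (Set.mk_mem_prod hz hw)

section level

variable {h g n φ : ℂ → ℂ} {F : ℂ → ℝ} {η c : ℝ}

/-- The convexity in one direction of a smooth strictly convex harmonic map: a
Royster–Ziegler type inequality. -/
theorem IsLevelMap.exists_re_mul_add_mul_nonneg (hφ : IsLevelMap h g F c φ)
    (hf : IsConvexHarmonic h g) (hF : IsConvexDefining F n η c)
    (hsub : {x | F x ≤ c} ⊆ harm h g '' unitDisk) :
    ∃ a b : ℂ, ‖a‖ = 1 ∧ ‖b‖ = 1 ∧ ∀ z ∈ unitDisk,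
      0 ≤ ((a * (deriv h (φ z) * deriv φ z) + (starRingEnd ℂ) a * (deriv g (φ z) * deriv φ z)) *
        (b - (starRingEnd ℂ) b * z ^ 2)).re := by
  obtain ⟨m, C, hm, hC, hbi⟩ := hφ.bilipschitz hf hF hsub
  obtain ⟨γ, hγ, heq, hγm⟩ := exists_continuous_extension (f := fun z => harm h g (φ z)) hC hbi
  have hγD : ∀ z ∈ unitDisk, F (γ z) < c := fun z hz => by
    rw [← heq hz]; exact (hφ.mem hz).2
  have hle : ∀ z ∈ Metric.closedBall (0 : ℂ) 1, F (γ z) ≤ c := fun z hz => by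
    have hcl : IsClosed {z : ℂ | F (γ z) ≤ c} :=
      isClosed_le (hF.continuous_F.comp hγ) continuous_const
    have : closure unitDisk ⊆ {z : ℂ | F (γ z) ≤ c} :=
      closure_minimal (fun z hz => (hγD z hz).le) hcl
    rw [closure_unitDisk] at this
    exact this hz
  have hmemcl : ∀ z : ℂ, ‖z‖ = 1 → z ∈ Metric.closedBall (0 : ℂ) 1 := fun z hz =>
    mem_closedBall_zero_iff.2 hz.le
  have hγinj : ∀ z w : ℂ, ‖z‖ ≤ 1 → ‖w‖ ≤ 1 → γ z = γ w → z = w := fun z w hz hw h => by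
    have h1 := hγm z (mem_closedBall_zero_iff.2 hz) w (mem_closedBall_zero_iff.2 hw)
    rw [h, sub_self, norm_zero] at h1
    have h2 : ‖z - w‖ ≤ 0 := by
      by_contra! h3
      nlinarith
    exact sub_eq_zero.1 (norm_le_zero_iff.1 h2)
  -- The map f ∘ φ already covers {F < c} from inside the disk, so a circle point landing there
  -- would contradict injectivity of the extension.
  have hFc : ∀ z : ℂ, ‖z‖ = 1 → F (γ z) = c := fun z hz => by
    refine le_antisymm (hle z (hmemcl z hz)) ?_
    by_contra! hlt
    have h1 : γ z ∈ harm (h ∘ φ) (g ∘ φ) '' unitDisk := by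
      rw [hφ.harm_comp_image hsub]; exact hlt
    obtain ⟨w, hw, hwz⟩ := h1
    have hw1 := mem_unitDisk.1 hw
    have h2 : γ w = γ z := (heq hw).symm.trans hwz
    have h3 := hγinj w z hw1.le hz.le h2
    rw [h3, hz] at hw1
    exact lt_irrefl _ hw1
  have hn0 : ∀ z : ℂ, ‖z‖ = 1 → 0 < ‖n (γ z)‖ := fun z hz => by
    refine norm_pos_iff.2 fun h0 => ?_
    have h1 := hF.le_re_conj_mul_self (γ z)
    simp only [h0, RingHom.map_zero, zero_mul, Complex.zero_re, hFc z hz] at h1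
    linarith [hF.c_pos]
  have hstrict : ∀ z w : ℂ, ‖z‖ = 1 → ‖w‖ = 1 →
      ((starRingEnd ℂ) (n (γ z)) * (γ w - γ z)).re ≤ -(η * ‖γ w - γ z‖ ^ 2) := fun z w hz hw => by
    have h1 := hF.lower (γ z) (γ w)
    rw [hFc z hz, hFc w hw] at h1
    linarith
  set N : ℂ → ℂ := fun z => ((‖n (γ z)‖⁻¹ : ℝ) : ℂ) * n (γ z) with hN
  have hNre : ∀ z d : ℂ, ((starRingEnd ℂ) (N z) * d).re
      = ‖n (γ z)‖⁻¹ * ((starRingEnd ℂ) (n (γ z)) * d).re := fun z d => by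
    rw [hN, map_mul, Complex.conj_ofReal, mul_assoc, Complex.re_ofReal_mul]
  have hNsupp : ∀ z w : ℂ, ‖z‖ = 1 → ‖w‖ = 1 →
      ((starRingEnd ℂ) (N z) * (γ w - γ z)).re ≤ 0 := fun z w hz hw => by
    rw [hNre]
    refine mul_nonpos_of_nonneg_of_nonpos (inv_nonneg.2 (norm_nonneg _))
      ((hstrict z w hz hw).trans ?_)
    have := hF.eta_pos
    rw [neg_nonpos]
    positivity
  obtain ⟨b, e, hb, he, hheight⟩ := exists_unit_height_le (γ := γ) (N := N) (by
      refine ContinuousOn.mul (Complex.continuous_ofReal.comp_continuousOn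
        (ContinuousOn.inv₀ (hF.continuous_n.comp hγ).norm.continuousOn fun z hz =>
          (hn0 z (mem_sphere_zero_iff_norm.1 hz)).ne')) (hF.continuous_n.comp hγ).continuousOn)
    (fun z hz => by
      rw [hN, norm_mul, Complex.norm_real, norm_inv, norm_norm, inv_mul_cancel₀ (hn0 z hz).ne'])
    -- Equal normals make the support inequalities at z and w opposite to each other, and strong
    -- convexity then forces γ z = γ w.
    (fun z hz w hw hzw => by
      rw [mem_sphere_zero_iff_norm] at hz hw
      have h1 := hNsupp w z hw hz
      rw [← hzw, hNre, ← neg_sub, mul_neg, Complex.neg_re] at h1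
      have h2 := hstrict z w hz hw
      have h3 : 0 ≤ ((starRingEnd ℂ) (n (γ z)) * (γ w - γ z)).re := by
        have h4 : 0 < ‖n (γ z)‖⁻¹ := inv_pos.2 (hn0 z hz)
        by_contra! hcon
        nlinarith
      have h5 : ‖γ w - γ z‖ = 0 := by
        by_contra hne
        have : 0 < ‖γ w - γ z‖ := lt_of_le_of_ne (norm_nonneg _) (Ne.symm hne)
        have := mul_pos hF.eta_pos (pow_pos this 2)
        linarith
      exact (hγinj w z hw.le hz.le (sub_eq_zero.1 (norm_eq_zero.1 h5))).symm)
    hNsupp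
  have hmaps : Set.MapsTo φ unitDisk unitDisk := fun y hy => (hφ.mem hy).1
  -- The height Re(ē f ∘ φ) is the real part of the analytic function ē h ∘ φ + e g ∘ φ, so a = ē.
  refine ⟨(starRingEnd ℂ) e, b, by rwa [RCLike.norm_conj], hb, fun z hz => ?_⟩
  have hΦ : DifferentiableOn ℂ (fun z => (starRingEnd ℂ) e * h (φ z) + e * g (φ z)) unitDisk :=
    ((hf.analytic_h.comp hφ.analytic hmaps).const_mul _).add
      ((hf.analytic_g.comp hφ.analytic hmaps).const_mul _)
  have key := re_deriv_mul_nonneg_of_height_le hΦ (u := fun z => ((starRingEnd ℂ) e * γ z).re)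
    (by fun_prop) (fun y hy => by
      rw [← heq hy]
      simp only [harm, Complex.add_re, Complex.mul_re, Complex.add_im, Complex.conj_re,
        Complex.conj_im]
      ring) hb hheight hz
  have hzn := isOpen_unitDisk.mem_nhds hz
  have hφzn := isOpen_unitDisk.mem_nhds (hφ.mem hz).1
  have hφd := (hφ.analytic.differentiableAt hzn).hasDerivAt
  have h1 := ((hf.analytic_h.differentiableAt hφzn).hasDerivAt.comp z hφd).const_mul
    ((starRingEnd ℂ) e)
  have h2 := ((hf.analytic_g.differentiableAt hφzn).hasDerivAt.comp z hφd).const_mul e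
  have h3 : deriv (fun z => (starRingEnd ℂ) e * h (φ z) + e * g (φ z)) z
      = (starRingEnd ℂ) e * (deriv h (φ z) * deriv φ z) + e * (deriv g (φ z) * deriv φ z) :=
    (h1.add h2).deriv
  rw [h3] at key
  rwa [Complex.conj_conj]

end level

/-! ### Exhaustion and passage to the limit -/

/-- The closed convex hull works: a point x of it is a small translate of a hull point, and
translating K by a small vector keeps K, hence its hull, inside the convex set Ω. -/
theorem IsCompact.exists_isCompact_convex_subset {K Ω : Set ℂ} (hK : IsCompact K) (hΩ : IsOpen Ω)
    (hΩc : Convex ℝ Ω) (hKΩ : K ⊆ Ω) :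
    ∃ L : Set ℂ, IsCompact L ∧ Convex ℝ L ∧ K ⊆ L ∧ L ⊆ Ω := by
  refine ⟨closure (convexHull ℝ K), ?_, (convex_convexHull ℝ K).closure,
    (subset_convexHull ℝ K).trans subset_closure, fun x hx => ?_⟩
  · exact (hK.totallyBounded.convexHull.closure).isCompact_of_isClosed isClosed_closure
  · obtain ⟨δ, hδ, hδΩ⟩ := hK.exists_cthickening_subset_open hΩ hKΩ
    obtain ⟨y, hy, hxy⟩ := Metric.mem_closure_iff.1 hx δ hδ
    have hsub : convexHull ℝ K ⊆ (fun w => w + (x - y)) ⁻¹' Ω := by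
      refine convexHull_min (fun w hw => hδΩ ?_) (hΩc.translate_preimage_left (x - y))
      refine Metric.mem_cthickening_of_dist_le _ w δ K hw ?_
      rw [dist_eq_norm, add_sub_cancel_left, ← dist_eq_norm]
      exact hxy.le
    have := hsub hy
    rwa [Set.mem_preimage, add_sub_cancel] at this

/-- The sublevel set is taken to contain the image of the closed disk of radius r. The inverse of φ
then maps that disk into the unit disk, so its derivative at 0 is at most 1/r and φ'(0) ≥ r. -/
theorem exists_approximation {h g : ℂ → ℂ} (hf : IsConvexHarmonic h g) {r : ℝ} (hr0 : 0 < r)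
    (hr1 : r < 1) :
    ∃ (φ : ℂ → ℂ) (a b : ℂ) (t : ℝ), DifferentiableOn ℂ φ unitDisk ∧
      Set.MapsTo φ unitDisk unitDisk ∧ φ 0 = 0 ∧ r ≤ t ∧ deriv φ 0 = t ∧ ‖a‖ = 1 ∧ ‖b‖ = 1 ∧
      ∀ z ∈ unitDisk, 0 ≤ ((a * (deriv h (φ z) * deriv φ z)
        + (starRingEnd ℂ) a * (deriv g (φ z) * deriv φ z)) *
        (b - (starRingEnd ℂ) b * z ^ 2)).re := by
  have hrD : Metric.closedBall (0 : ℂ) r ⊆ unitDisk := fun z hz =>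
    mem_unitDisk.2 ((mem_closedBall_zero_iff.1 hz).trans_lt hr1)
  have hΩ := isOpen_image_harm isOpen_unitDisk hf.analytic_h hf.analytic_g hf.lt
  have hK : IsCompact (harm h g '' Metric.closedBall 0 r) :=
    (isCompact_closedBall 0 r).image_of_continuousOn
      ((continuousOn_harm hf.analytic_h hf.analytic_g).mono hrD)
  obtain ⟨L, hL, hLc, hKL, hLΩ⟩ := hK.exists_isCompact_convex_subset hΩ hf.convex
    (Set.image_mono hrD)
  have h0 : (0 : ℂ) ∈ L := hKL ⟨0, Metric.mem_closedBall_self hr0.le, hf.harm_zero⟩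
  obtain ⟨F, n, η, c, hF, hLF, hsub⟩ := exists_isConvexDefining hL hLc h0 hΩ hLΩ
  obtain ⟨φ, hφ⟩ := exists_isLevelMap hf hF hsub
  obtain ⟨a, b, ha, hb, hab⟩ := hφ.exists_re_mul_add_mul_nonneg hf hF hsub
  obtain ⟨t, ht, htd⟩ := hφ.deriv_zero
  obtain ⟨ψ, hψ, hψ1, hψφ, hψd⟩ := hφ.exists_inverse
  refine ⟨φ, a, b, t, hφ.analytic, fun z hz => (hφ.mem hz).1, hφ.map_zero, ?_, htd, ha, hb, hab⟩
  have hball : Metric.ball (0 : ℂ) r ⊆ {z | z ∈ unitDisk ∧ F (harm h g z) < c} := fun z hz =>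
    ⟨hrD (Metric.ball_subset_closedBall hz),
      hLF _ (hKL ⟨z, Metric.ball_subset_closedBall hz, rfl⟩)⟩
  have hψ0 : ψ 0 = 0 := by
    have := hψφ 0 zero_mem_unitDisk
    rwa [hφ.map_zero] at this
  have h1 : ‖deriv ψ 0‖ ≤ 1 / r := by
    refine Complex.norm_deriv_le_div_of_mapsTo_ball (hψ.mono hball) (fun z hz => ?_) hr0
    rw [hψ0, mem_closedBall_zero_iff]
    exact (hψ1 z (hball hz)).le
  have h2 := congrArg norm (hψd 0 zero_mem_unitDisk)
  rw [hφ.map_zero, htd, norm_mul, norm_one, Complex.norm_real, Real.norm_of_nonneg ht.le] at h2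
  rw [le_div_iff₀ hr0] at h1
  nlinarith [norm_nonneg (deriv ψ 0)]

/-- The function 1 - φ(z)/z has nonnegative real part and value at most 1 - r at the origin. The
growth theorem spreads this smallness over the disk. -/
theorem norm_sub_id_le {φ : ℂ → ℂ} (hφ : DifferentiableOn ℂ φ unitDisk)
    (hmaps : Set.MapsTo φ unitDisk unitDisk) (h0 : φ 0 = 0) {r t : ℝ} (hrt : r ≤ t)
    (ht : deriv φ 0 = t) {z : ℂ} (hz : z ∈ unitDisk) :
    ‖φ z - z‖ * (1 - ‖z‖) ≤ 3 * (1 - r) := by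
  set q := dslope φ 0 with hq
  have hqd : DifferentiableOn ℂ q unitDisk :=
    (Complex.differentiableOn_dslope (isOpen_unitDisk.mem_nhds zero_mem_unitDisk)).2 hφ
  have hq1 : ∀ y ∈ unitDisk, ‖q y‖ ≤ 1 := fun y hy => by
    have := Complex.norm_dslope_le_div_of_mapsTo_ball (R₂ := 1) hφ (fun x hx => by
      rw [h0, mem_closedBall_zero_iff]
      exact (mem_unitDisk.1 (hmaps hx)).le) hy
    rwa [div_one] at this
  have hq0 : q 0 = t := by rw [hq, dslope_same, ht]
  have hφq : φ z = z * q z := by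
    have := sub_smul_dslope φ 0 z
    rw [h0, sub_zero, sub_zero, smul_eq_mul] at this
    exact this.symm
  have ht1 : t ≤ 1 := by
    have := hq1 0 zero_mem_unitDisk
    rw [hq0, Complex.norm_real] at this
    exact (le_abs_self t).trans this
  have hz1 := mem_unitDisk.1 hz
  have h1 := norm_sub_mul_le_of_re_nonneg (p := fun y => 1 - q y) (c := 0) (R := 1)
    (hqd.const_sub 1) (fun y hy => by
      rw [Complex.sub_re, Complex.one_re]
      linarith [Complex.re_le_norm (q y), hq1 y hy]) hz
  rw [dist_zero_right, div_one, hq0, Complex.sub_re, Complex.one_re, Complex.ofReal_re] at h1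
  have h2 : ‖1 - q z‖ ≤ ‖(1 - q z) - (1 - t)‖ + (1 - t) := by
    have := norm_le_norm_add_norm_sub' (1 - q z) (1 - t)
    have e : ‖(1 : ℂ) - t‖ = 1 - t := by
      rw [← Complex.ofReal_one, ← Complex.ofReal_sub, Complex.norm_real,
        Real.norm_of_nonneg (by linarith)]
    rw [e] at this
    linarith
  have h3 : ‖φ z - z‖ = ‖z‖ * ‖1 - q z‖ := by
    rw [hφq, ← norm_mul, ← norm_neg]
    congr 1
    ring
  have h4 : ‖1 - q z‖ * (1 - ‖z‖) ≤ 3 * (1 - r) := by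
    have h5 := mul_le_mul_of_nonneg_right h2 (by linarith : 0 ≤ 1 - ‖z‖)
    have h6 : (1 - t) * ‖z‖ ≤ (1 - t) * 1 := by
      gcongr
    nlinarith [mul_nonneg (by linarith : 0 ≤ 1 - t) (norm_nonneg z)]
  calc ‖φ z - z‖ * (1 - ‖z‖) = ‖z‖ * (‖1 - q z‖ * (1 - ‖z‖)) := by rw [h3]; ring
    _ ≤ 1 * (‖1 - q z‖ * (1 - ‖z‖)) := by
      refine mul_le_mul_of_nonneg_right hz1.le (mul_nonneg (norm_nonneg _) (by linarith))
    _ ≤ _ := by rw [one_mul]; exact h4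

/-- Cauchy's estimate for φ(z) - z on a circle of half the distance to the boundary. -/
theorem norm_deriv_sub_one_le {φ : ℂ → ℂ} (hφ : DifferentiableOn ℂ φ unitDisk)
    (hmaps : Set.MapsTo φ unitDisk unitDisk) (h0 : φ 0 = 0) {r t : ℝ} (hrt : r ≤ t)
    (ht : deriv φ 0 = t) {z : ℂ} (hz : z ∈ unitDisk) :
    ‖deriv φ z - 1‖ ≤ 12 * (1 - r) / (1 - ‖z‖) ^ 2 := by
  have hz1 := mem_unitDisk.1 hz
  set ρ := (1 - ‖z‖) / 2 with hρ
  have hρ0 : 0 < ρ := by rw [hρ]; linarith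
  have hsub : Metric.closedBall z ρ ⊆ unitDisk := fun y hy => by
    rw [mem_unitDisk]
    have h1 := norm_le_norm_add_norm_sub' y z
    have h2 := mem_closedBall_iff_norm.1 hy
    linarith
  have hd : DifferentiableOn ℂ (fun y => φ y - y) unitDisk := hφ.sub differentiableOn_id
  have h1 := Complex.norm_deriv_le_of_forall_mem_sphere_norm_le (f := fun y => φ y - y)
    (C := 3 * (1 - r) / ρ) hρ0 (DifferentiableOn.diffContOnCl (by
      rw [closure_ball z hρ0.ne']
      exact hd.mono hsub)) fun y hy => by
      have hyD := hsub (Metric.sphere_subset_closedBall hy)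
      have h2 := norm_sub_id_le hφ hmaps h0 hrt ht hyD
      have h3 := norm_le_norm_add_norm_sub' y z
      have h4 := mem_sphere_iff_norm.1 hy
      rw [le_div_iff₀ hρ0]
      refine le_trans ?_ h2
      gcongr
      linarith
  have h2 : deriv (fun y => φ y - y) z = deriv φ z - 1 :=
    ((hφ.differentiableAt (isOpen_unitDisk.mem_nhds hz)).hasDerivAt.sub (hasDerivAt_id z)).deriv
  rw [h2] at h1
  refine h1.trans_eq ?_
  have : 1 - ‖z‖ ≠ 0 := by linarith
  rw [hρ]
  field_simp
  ring

/-- A Royster–Ziegler type inequality for convex harmonic maps. -/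
theorem IsConvexHarmonic.exists_re_mul_add_mul_nonneg {h g : ℂ → ℂ} (hf : IsConvexHarmonic h g) :
    ∃ a b : ℂ, ‖a‖ = 1 ∧ ‖b‖ = 1 ∧ ∀ z ∈ unitDisk,
      0 ≤ ((a * deriv h z + (starRingEnd ℂ) a * deriv g z) *
        (b - (starRingEnd ℂ) b * z ^ 2)).re := by
  have hr0 : ∀ k : ℕ, 0 < 1 - 1 / ((k : ℝ) + 2) := fun k => by
    rw [sub_pos, div_lt_one (by positivity)]
    linarith [(Nat.cast_nonneg k : (0 : ℝ) ≤ k)]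
  have hr1 : ∀ k : ℕ, 1 - 1 / ((k : ℝ) + 2) < 1 := fun k => by
    have : 0 < 1 / ((k : ℝ) + 2) := by positivity
    linarith
  choose φ a b t hφ hmaps h0 hrt ht ha hb hre using fun k => exists_approximation hf (hr0 k) (hr1 k)
  have hlim0 : Tendsto (fun k : ℕ => 1 - (1 - 1 / ((k : ℝ) + 2))) atTop (𝓝 0) := by
    have : Tendsto (fun k : ℕ => 1 / ((k : ℝ) + 2)) atTop (𝓝 0) :=
      tendsto_const_nhds.div_atTop (tendsto_natCast_atTop_atTop.atTop_add tendsto_const_nhds)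
    simpa using this
  have hφlim : ∀ z ∈ unitDisk, Tendsto (fun k => φ k z) atTop (𝓝 z) := fun z hz => by
    rw [tendsto_iff_norm_sub_tendsto_zero]
    have hz1 := mem_unitDisk.1 hz
    have : Tendsto (fun k : ℕ => 3 * (1 - (1 - 1 / ((k : ℝ) + 2))) / (1 - ‖z‖)) atTop (𝓝 0) := by
      simpa using (hlim0.const_mul 3).div_const (1 - ‖z‖)
    refine squeeze_zero (fun k => norm_nonneg _) (fun k => ?_) this
    rw [le_div_iff₀ (by linarith)]
    exact norm_sub_id_le (hφ k) (hmaps k) (h0 k) (hrt k) (ht k) hz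
  have hφ'lim : ∀ z ∈ unitDisk, Tendsto (fun k => deriv (φ k) z) atTop (𝓝 1) := fun z hz => by
    rw [tendsto_iff_norm_sub_tendsto_zero]
    have : Tendsto (fun k : ℕ => 12 * (1 - (1 - 1 / ((k : ℝ) + 2))) / (1 - ‖z‖) ^ 2) atTop
        (𝓝 0) := by
      simpa using (hlim0.const_mul 12).div_const ((1 - ‖z‖) ^ 2)
    exact squeeze_zero (fun k => norm_nonneg _) (fun k =>
      norm_deriv_sub_one_le (hφ k) (hmaps k) (h0 k) (hrt k) (ht k) hz) this
  -- The pairs (a_k, b_k) need not converge, so a subsequence is taken on the product of two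
  -- circles.
  obtain ⟨⟨a₀, b₀⟩, ⟨ha₀, hb₀⟩, s, hs, hab⟩ :=
    ((isCompact_sphere (0 : ℂ) 1).prod (isCompact_sphere (0 : ℂ) 1)).tendsto_subseq
      (x := fun k => (a k, b k)) fun k =>
        Set.mk_mem_prod (mem_sphere_zero_iff_norm.2 (ha k)) (mem_sphere_zero_iff_norm.2 (hb k))
  have hal : Tendsto (fun k => a (s k)) atTop (𝓝 a₀) := (continuous_fst.tendsto _).comp hab
  have hbl : Tendsto (fun k => b (s k)) atTop (𝓝 b₀) := (continuous_snd.tendsto _).comp hab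
  refine ⟨a₀, b₀, mem_sphere_zero_iff_norm.1 ha₀, mem_sphere_zero_iff_norm.1 hb₀, fun z hz => ?_⟩
  have hzn := isOpen_unitDisk.mem_nhds hz
  have hconj : ∀ {u : ℕ → ℂ} {x : ℂ}, Tendsto u atTop (𝓝 x) →
      Tendsto (fun k => (starRingEnd ℂ) (u k)) atTop (𝓝 ((starRingEnd ℂ) x)) := fun hu =>
    (Complex.continuous_conj.tendsto _).comp hu
  have hφs := (hφlim z hz).comp hs.tendsto_atTop
  have hφ's := (hφ'lim z hz).comp hs.tendsto_atTop
  have hhs := (((hf.analytic_h.deriv isOpen_unitDisk).continuousOn.continuousAt hzn).tendsto.comp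
    hφs).mul hφ's
  have hgs := (((hf.analytic_g.deriv isOpen_unitDisk).continuousOn.continuousAt hzn).tendsto.comp
    hφs).mul hφ's
  have hall := (((hal.mul hhs).add ((hconj hal).mul hgs)).mul
    (hbl.sub ((hconj hbl).mul (tendsto_const_nhds (x := z ^ 2)))))
  have hfin := (Complex.continuous_re.tendsto _).comp hall
  rw [mul_one, mul_one] at hfin
  exact ge_of_tendsto' hfin fun k => hre (s k) z hz

/-! ### Uniqueness of the representation and conclusion -/

/-- The analytic and co-analytic parts of a harmonic function are unique. -/
theorem IsCanonicalRep.eqOn {f h₁ g₁ h₂ g₂ : ℂ → ℂ} (H₁ : IsCanonicalRep f h₁ g₁)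
    (H₂ : IsCanonicalRep f h₂ g₂) : Set.EqOn h₁ h₂ unitDisk ∧ Set.EqOn g₁ g₂ unitDisk := by
  have hu : DifferentiableOn ℂ (fun z => h₁ z - h₂ z) unitDisk := H₁.analytic_h.sub H₂.analytic_h
  have hv : DifferentiableOn ℂ (fun z => g₁ z - g₂ z) unitDisk := H₁.analytic_g.sub H₂.analytic_g
  have hzero : ∀ z ∈ unitDisk, harm (fun z => h₁ z - h₂ z) (fun z => g₁ z - g₂ z) z = 0 := by
    intro z hz
    have h1 := H₁.eq_on_disk z hz
    rw [H₂.eq_on_disk z hz] at h1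
    simp only [harm, map_sub]
    linear_combination -h1
  have hder : Set.EqOn (deriv fun z => h₁ z - h₂ z) 0 unitDisk := by
    intro z hz
    have h1 := (hasStrictFDerivAt_harm isOpen_unitDisk hu hv hz).hasFDerivAt
    have h2 : HasFDerivAt (harm (fun z => h₁ z - h₂ z) fun z => g₁ z - g₂ z) (0 : ℂ →L[ℝ] ℂ) z :=
      (hasFDerivAt_const (0 : ℂ) z).congr_of_eventuallyEq
        (Filter.eventually_of_mem (isOpen_unitDisk.mem_nhds hz) hzero)
    have h3 := h1.unique h2
    -- Evaluating the vanishing real differential at 1 and at i separates its complex-linear and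
    -- antilinear parts.
    have h4 := DFunLike.congr_fun h3 1
    have h5 := DFunLike.congr_fun h3 Complex.I
    simp only [harmDeriv_apply, zero_apply, mul_one, map_mul,
      Complex.conj_I] at h4 h5
    have h6 : (2 : ℂ) * deriv (fun z => h₁ z - h₂ z) z = 0 := by
      linear_combination h4 - Complex.I * h5
        + (deriv (fun z => h₁ z - h₂ z) z - (starRingEnd ℂ) (deriv (fun z => g₁ z - g₂ z) z))
          * Complex.I_sq
    simpa using h6
  have hh : ∀ z ∈ unitDisk, h₁ z - h₂ z = 0 := fun z hz => by
    have h1 := isOpen_unitDisk.is_const_of_deriv_eq_zero (convex_ball _ _).isPreconnected hu hder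
      hz zero_mem_unitDisk
    simpa [H₁.h_zero, H₂.h_zero] using h1
  refine ⟨fun z hz => sub_eq_zero.1 (hh z hz), fun z hz => ?_⟩
  have h1 := hzero z hz
  simp only [harm, hh z hz, zero_add] at h1
  exact sub_eq_zero.1 ((map_eq_zero _).1 h1)

/-- Sense preservation and g'(0) = 0 may be witnessed by different representations of f. Uniqueness
transfers both to the given one. -/
theorem IsCanonicalRep.isConvexHarmonic {f h g : ℂ → ℂ} (hrep : IsCanonicalRep f h g)
    (hf : f ∈ classKHo) : IsConvexHarmonic h g ∧ deriv g 0 = 0 := by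
  obtain ⟨⟨⟨h₁, g₁, H₁, hlt, hinj⟩, h₂, g₂, H₂, hg₂⟩, hconv⟩ := hf
  have e1 := hrep.eqOn H₁
  have e2 := hrep.eqOn H₂
  have heq : Set.EqOn f (harm h g) unitDisk := hrep.eq_on_disk
  refine ⟨⟨hrep.analytic_h, hrep.analytic_g, hrep.h_zero, hrep.g_zero, fun z hz => ?_,
    hinj.congr heq, ?_⟩, ?_⟩
  · rw [e1.1.deriv isOpen_unitDisk hz, e1.2.deriv isOpen_unitDisk hz]
    exact hlt z hz
  · rwa [← heq.image_eq]
  · rw [e2.2.deriv isOpen_unitDisk zero_mem_unitDisk, hg₂]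

theorem mainTheorem8 (α₁ β₁ γ₁ δ₁ α₂ β₂ γ₂ δ₂ : ℝ) (σ : ℂ)
    (hα₁ : 0 < α₁) (hγ₁ : 0 < γ₁) (hα₂ : 0 < α₂) (hγ₂ : 0 < γ₂)
    (hβ₁ : 0 ≤ β₁) (hδ₁ : 0 ≤ δ₁) (hβ₂ : 0 ≤ β₂) (hδ₂ : 0 ≤ δ₂)
    (hconv₁ : 0 < β₁ + δ₁) (hconv₂ : 0 < β₂ + δ₂) (hσ : ‖σ‖ < 1)
    (f h g : ℂ → ℂ) (hrep : IsCanonicalRep f h g) (hf : f ∈ classKHo)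
    (hineq : (iteratedDeriv 2 (normWright α₁ β₁ γ₁ δ₁) 1).re
      + 2 * (deriv (normWright α₁ β₁ γ₁ δ₁) 1).re
      + (iteratedDeriv 2 (normWright α₂ β₂ γ₂ δ₂) 1).re ≤ 4) :
    convOperator (normWright α₁ β₁ γ₁ δ₁) (normWright α₂ β₂ γ₂ δ₂) σ h g ∈ classCH ∧
    (fun z => hadamardProd h (normWright α₁ β₁ γ₁ δ₁) z
      + (starRingEnd ℂ) (hadamardProd g (normWright α₂ β₂ γ₂ δ₂) z)) ∈ classCH := by
  obtain ⟨hconv, hg1⟩ := hrep.isConvexHarmonic hf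
  obtain ⟨a, b, ha, hb, hre⟩ := hconv.exists_re_mul_add_mul_nonneg
  have hcoef := norm_taylorCoeff_le_of_re_mul_add_mul_nonneg hrep.analytic_h hrep.analytic_g
    hconv.lt hrep.deriv_h_zero hg1 ha hb hre
  have key : ∀ τ : ℂ, ‖τ‖ ≤ 1 →
      (fun z => hadamardProd h (normWright α₁ β₁ γ₁ δ₁) z + (starRingEnd ℂ)
        (τ * hadamardProd g (normWright α₂ β₂ γ₂ δ₂) z)) ∈ classCH := fun τ hτ =>
    hadamardProd_add_conj_mem_classCH hα₁ hγ₁ hα₂ hγ₂ hβ₁ hδ₁ hβ₂ hδ₂ hconv₁ hconv₂ hτ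
      hrep.h_zero hrep.deriv_h_zero hrep.g_zero hg1 (fun n => (hcoef n).1) (fun n => (hcoef n).2)
      hineq
  refine ⟨key σ hσ.le, ?_⟩
  -- The estimate allows modulus exactly 1, so τ = 1 gives the second conclusion.
  have h1 := key 1 (by simp)
  simpa only [one_mul] using h1
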